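/- Let $n\ge 2$ be an integer and let $u,v,x\in\mathbb R$ satisfy $u<v$, $v\ne -u$, $x\neq 0$. Let $SB(2n)\subset SL(2n,\mathbb C)$ be the group of upper triangular matrices with positive diagonal entries. Every $K\in SL(2n,\mathbb C)$ factorizes uniquely as $K=g_Lb_R^{-1}=b_Lg_R^{-1}$ with $g_L,g_R\in SU(2n)$, $b_L,b_R\in SB(2n)$. Put $\Phi_+(K)=(\pi(b_L),\pi(b_R))$, where $\pi$ replaces the off-diagonal $n\times n$ blocks by zero. Let $\mu=(\mu_L,\mu_R)$ with $$\mu_L=\begin{pmatrix}e^u\nu(x)&0\\0&e^{-u}1_n\end{pmatrix},\qquad \mu_R=\begin{pmatrix}e^v1_n&0\\0&e^{-v}1_n\end{pmatrix},$$ where $\nu(x)$ is the upper triangular $n\times n$ matrix with $\nu(x)_{jj}=1$ and $\nu(x)_{jk}=(1-e^{-x})e^{(k-j)x/2}$ for $j<k$. Let $G_+=S(U(n)\times U(n))$ be the block-diagonal subgroup of $SU(2n)$, and let $G_\mu=G_+(\mu_L)\times G_+$, where $G_+(\mu_L)$ consists of those $\eta=\mathrm{diag}(\eta(1),\eta(2))\in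 G_+$ for which $\eta(1)\nu(x)\nu(x)^\dagger\eta(1)^{-1}=\nu(x)\nu(x)^\dagger$. The group $G_\mu$ acts by $(\eta_L,\eta_R)\cdot K=\eta_LK\eta_R^{-1}$. Let $\bar{\mathcal C}_x=\{\hat p\in\mathbb R^n : 0\ge \hat p_1,\ \hat p_k-\hat p_{k+1}\ge |x|/2\ (1\le k\le n-1)\}$, and let $\mathbb T_n$ be the group of diagonal unitary $n\times n$ matrices. All square roots below are non-negative. Let $\theta(x,\hat p)$ be the $n\times n$ matrix with entries $$\theta(x,\hat p)_{jk}=\frac{\sinh\frac x2}{\sinh(\hat p_k-\hat p_j)}\prod_{m\ne j,k}\left[\frac{\sinh(\hat p_j-\hat p_m-\frac x2)\sinh(\hat p_k-\hat p_m+\frac x2)}{\sinh(\hat p_j-\hat p_m)\sinh(\hat p_k-\hat p_m)}\right]^{1/2}\quad(j\neq k),$$ $$\theta(x,\hat p)_{jj}=\prod_{m\ne j}\left[\frac{\sinh(\hat p_j-\hat p_m-\frac x2)\sinh(\hat p_j-\hat p_m+\frac x2)}{\sinh^2(\hat p_j-\hat p_m)}\right]^{1/2}.$$ Let $a=n$ if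 $x>0$ and $a=1$ if $x<0$. With $$r_j=\sqrt{\frac{1-e^{-x}}{1-e^{-nx}}}\prod_{k\neq j}\sqrt{\frac{1-e^{2\hat p_j-2\hat p_k-x}}{1-e^{2\hat p_j-2\hat p_k}}},\qquad v(x)_j=\sqrt{\frac{n(e^x-1)}{1-e^{-nx}}}\,e^{-jx/2},$$ define $n\times n$ matrices $\zeta=\zeta(x,\hat p)$ and $\kappa=\kappa(x)$ by (for $i,j\ne a$) $$\zeta_{aa}=r_a,\quad \zeta_{ij}=\delta_{ij}-\frac{r_ir_j}{1+r_a},\quad \zeta_{ia}=-\zeta_{ai}=r_i,$$ $$\kappa_{aa}=\frac{v(x)_a}{\sqrt n},\quad \kappa_{ij}=\delta_{ij}-\frac{v(x)_iv(x)_j}{n+\sqrt n\,v(x)_a},\quad \kappa_{ia}=-\kappa_{ai}=\frac{v(x)_i}{\sqrt n}.$$ For $\hat p\in\bar{\mathcal C}_x$ and $e^{i\hat q}\in\mathbb T_n$ set $T=e^{i\hat q}\theta(-x,\hat p)$ and $\rho=\kappa(x)\zeta(x,\hat p)^{-1}$. Let $q=\mathrm{diag}(q_1,\dots,q_n)$ with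 $q_k\in(0,\pi/2]$ and $\sin q_k=e^{\hat p_k}$, let $\Lambda=\sqrt{e^{-2u}1_n-e^{-2v}(\sin q)^2}$, let $\alpha$ be determined by $i(\sin q)\alpha+e^v\cos q=\Lambda T$, and put $$K(\hat p,e^{i\hat q})=\begin{pmatrix}\rho&0\\0&1_n\end{pmatrix}\begin{pmatrix}\cos q&i\sin q\\ i\sin q&\cos q\end{pmatrix}\begin{pmatrix}e^{-v}1_n&\alpha\\0&e^v1_n\end{pmatrix}.$$ Then for every $\hat p\in\bar{\mathcal C}_x$ and $e^{i\hat q}\in\mathbb T_n$ one has $T\in U(n)$, $\rho\in SU(n)$, and $K(\hat p,e^{i\hat q})$ belongs to $SL(2n,\mathbb C)$ and satisfies $\Phi_+(K(\hat p,e^{i\hat q}))=\mu$. Moreover, every $G_\mu$-orbit in $\Phi_+^{-1}(\mu)$ intersects the set $\{K(\hat p,e^{i\hat q}) : \hat p\in\bar{\mathcal C}_x,\ e^{i\hat q}\in\mathbb T_n\}$. -/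

import Mathlib

noncomputable section

namespace RSReduction

open Matrix

/-- The group `SL(2n, ℂ)`. Rows and columns are indexed by `Fin n ⊕ Fin n`, in the order
(first block, then second block), so that the four blocks of a matrix are `toBlocks₁₁`, …,
`toBlocks₂₂`. -/
abbrev SL2n (n : ℕ) := SpecialLinearGroup (Fin n ⊕ Fin n) ℂ

/-- `SU(2n)`, as a subset of `SL(2n, ℂ)`. -/
def SU2n (n : ℕ) : Set (SL2n n) :=
  {g | (g : Matrix (Fin n ⊕ Fin n) (Fin n ⊕ Fin n) ℂ) ∈ unitaryGroup (Fin n ⊕ Fin n) ℂ}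

/-- `SB(2n)`: upper triangular elements of `SL(2n, ℂ)` with positive (real) diagonal entries.
The relevant order of the indices is the lexicographic one on `Fin n ⊕ Fin n`. -/
def SB2n (n : ℕ) : Set (SL2n n) :=
  {b | (b : Matrix (Fin n ⊕ Fin n) (Fin n ⊕ Fin n) ℂ).BlockTriangular toLex ∧
    ∀ i, 0 < (b.1 i i).re ∧ (b.1 i i).im = 0}

/-- The projection that erases the off-diagonal blocks. -/
def blockProj {n : ℕ} (b : Matrix (Fin n ⊕ Fin n) (Fin n ⊕ Fin n) ℂ) :
    Matrix (Fin n ⊕ Fin n) (Fin n ⊕ Fin n) ℂ :=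
  fromBlocks b.toBlocks₁₁ 0 0 b.toBlocks₂₂

/-- The graph of the momentum map `Φ₊ : K ↦ (π(b_L), π(b_R))`, where `b_L, b_R ∈ SB(2n)` are the
(uniquely determined) factors in the Iwasawa decompositions `K = g_L b_R⁻¹ = b_L g_R⁻¹`. -/
def MomentumMapEq {n : ℕ} (K : SL2n n)
    (β : Matrix (Fin n ⊕ Fin n) (Fin n ⊕ Fin n) ℂ × Matrix (Fin n ⊕ Fin n) (Fin n ⊕ Fin n) ℂ) :
    Prop :=
  ∃ gL ∈ SU2n n, ∃ gR ∈ SU2n n, ∃ bL ∈ SB2n n, ∃ bR ∈ SB2n n,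
    K = gL * bR⁻¹ ∧ K = bL * gR⁻¹ ∧ blockProj bL.1 = β.1 ∧ blockProj bR.1 = β.2

/-- The upper triangular `n × n` matrix `ν(x)`. -/
def nu (n : ℕ) (x : ℝ) : Matrix (Fin n) (Fin n) ℂ := fun j k =>
  if j = k then 1
  else if j < k then
    (((1 - Real.exp (-x)) * Real.exp (((k : ℕ) - (j : ℕ) : ℝ) * x / 2) : ℝ) : ℂ)
  else 0

/-- `μ_L = diag(e^u ν(x), e^{-u} 1)`. -/
def muL (n : ℕ) (u x : ℝ) : Matrix (Fin n ⊕ Fin n) (Fin n ⊕ Fin n) ℂ :=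
  fromBlocks ((Real.exp u : ℂ) • nu n x) 0 0 ((Real.exp (-u) : ℂ) • 1)

/-- `μ_R = diag(e^v 1, e^{-v} 1)`. -/
def muR (n : ℕ) (v : ℝ) : Matrix (Fin n ⊕ Fin n) (Fin n ⊕ Fin n) ℂ :=
  fromBlocks ((Real.exp v : ℂ) • 1) 0 0 ((Real.exp (-v) : ℂ) • 1)

/-- The constraint surface `Φ₊⁻¹(μ)`, `μ = (μ_L, μ_R)`. -/
def constraintSurface (n : ℕ) (u v x : ℝ) : Set (SL2n n) :=
  {K | MomentumMapEq K (muL n u x, muR n v)}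

/-- The inverse of a unitary element of `SL(2n, ℂ)` is its conjugate transpose. -/
theorem coe_inv_of_unitary {n : ℕ} {g : SL2n n} (hg : g ∈ SU2n n) :
    ((g⁻¹ : SL2n n) : Matrix (Fin n ⊕ Fin n) (Fin n ⊕ Fin n) ℂ) = (g.1)ᴴ := by
  have h1 : g.1 * (g.1)ᴴ = 1 := mem_unitaryGroup_iff.1 hg
  have h2 : (g⁻¹ : SL2n n).1 * g.1 = 1 := congrArg Subtype.val (inv_mul_cancel g)
  calc (g⁻¹ : SL2n n).1 = (g⁻¹ : SL2n n).1 * (g.1 * (g.1)ᴴ) := by rw [h1, mul_one]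
    _ = (g.1)ᴴ := by rw [← mul_assoc, h2, one_mul]

/-- `G₊ = S(U(n) × U(n))`, the block-diagonal subgroup of `SU(2n)`. -/
def Gplus (n : ℕ) : Subgroup (SL2n n) where
  carrier := {η | η ∈ SU2n n ∧ η.1.toBlocks₁₂ = 0 ∧ η.1.toBlocks₂₁ = 0}
  one_mem' := by
    refine ⟨?_, ?_, ?_⟩
    · simp [SU2n]
    · ext i j; simp [toBlocks₁₂]
    · ext i j; simp [toBlocks₂₁]
  mul_mem' := by
    rintro a b ⟨ha, ha1, ha2⟩ ⟨hb, hb1, hb2⟩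
    refine ⟨?_, ?_, ?_⟩
    · change a.1 * b.1 ∈ unitaryGroup (Fin n ⊕ Fin n) ℂ
      exact mul_mem ha hb
    · change (a.1 * b.1).toBlocks₁₂ = 0
      rw [← fromBlocks_toBlocks a.1, ← fromBlocks_toBlocks b.1,
        fromBlocks_multiply, toBlocks_fromBlocks₁₂, ha1, hb1]
      simp
    · change (a.1 * b.1).toBlocks₂₁ = 0
      rw [← fromBlocks_toBlocks a.1, ← fromBlocks_toBlocks b.1,
        fromBlocks_multiply, toBlocks_fromBlocks₂₁, ha2, hb2]
      simp
  inv_mem' := by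
    rintro a ⟨ha, ha1, ha2⟩
    have hi := coe_inv_of_unitary ha
    refine ⟨?_, ?_, ?_⟩
    · change (a⁻¹ : SL2n n).1 ∈ unitaryGroup (Fin n ⊕ Fin n) ℂ
      rw [hi]
      exact Unitary.star_mem ha
    · rw [hi]
      ext i j
      have := congrFun (congrFun ha2 j) i
      simp only [toBlocks₂₁, of_apply, Matrix.zero_apply] at this
      simp [toBlocks₁₂, this]
    · rw [hi]
      ext i j
      have := congrFun (congrFun ha1 j) i
      simp only [toBlocks₁₂, of_apply, Matrix.zero_apply] at this
      simp [toBlocks₂₁, this]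

/-- `G₊(μ_L)`: the elements `η_L` of `G₊` whose first diagonal block satisfies
`η_L(1) ν(x) ν(x)† η_L(1)⁻¹ = ν(x) ν(x)†`. The block `η_L(1)` is unitary, so its inverse is its
conjugate transpose. -/
def GplusL (n : ℕ) (x : ℝ) : Subgroup (SL2n n) where
  carrier := {η | η ∈ Gplus n ∧
    η.1.toBlocks₁₁ * (nu n x * (nu n x)ᴴ) * (η.1.toBlocks₁₁)ᴴ = nu n x * (nu n x)ᴴ}
  one_mem' := by
    refine ⟨one_mem _, ?_⟩
    have h : (1 : SL2n n).1.toBlocks₁₁ = 1 := by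
      change (1 : Matrix (Fin n ⊕ Fin n) (Fin n ⊕ Fin n) ℂ).toBlocks₁₁ = 1
      rw [← fromBlocks_one, toBlocks_fromBlocks₁₁]
    rw [h]
    simp
  mul_mem' := by
    rintro a b ⟨ha, ha1⟩ ⟨hb, hb1⟩
    refine ⟨mul_mem ha hb, ?_⟩
    have h : (a * b).1.toBlocks₁₁ = a.1.toBlocks₁₁ * b.1.toBlocks₁₁ := by
      change (a.1 * b.1).toBlocks₁₁ = _
      conv_lhs => rw [← fromBlocks_toBlocks a.1, ← fromBlocks_toBlocks b.1]
      rw [fromBlocks_multiply, toBlocks_fromBlocks₁₁, ha.2.1]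
      simp
    rw [h, conjTranspose_mul]
    calc _ = a.1.toBlocks₁₁ * (b.1.toBlocks₁₁ * (nu n x * (nu n x)ᴴ) * (b.1.toBlocks₁₁)ᴴ)
          * (a.1.toBlocks₁₁)ᴴ := by simp only [mul_assoc]
      _ = _ := by rw [hb1, ha1]
  inv_mem' := by
    rintro a ⟨ha, ha1⟩
    refine ⟨inv_mem ha, ?_⟩
    have h : (a⁻¹ : SL2n n).1.toBlocks₁₁ = (a.1.toBlocks₁₁)ᴴ := by
      rw [coe_inv_of_unitary ha.1]
      rfl
    have hu : (a.1.toBlocks₁₁)ᴴ * a.1.toBlocks₁₁ = 1 := by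
      have h2 : (a.1)ᴴ * a.1 = 1 := mem_unitaryGroup_iff'.1 ha.1
      rw [← fromBlocks_toBlocks a.1, fromBlocks_conjTranspose, fromBlocks_multiply, ha.2.2,
        ← fromBlocks_one, fromBlocks_inj] at h2
      simpa using h2.1
    change (a⁻¹ : SL2n n).1.toBlocks₁₁ * _ * ((a⁻¹ : SL2n n).1.toBlocks₁₁)ᴴ = _
    rw [h, conjTranspose_conjTranspose]
    calc _ = (a.1.toBlocks₁₁)ᴴ * (a.1.toBlocks₁₁ * (nu n x * (nu n x)ᴴ) * (a.1.toBlocks₁₁)ᴴ)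
          * a.1.toBlocks₁₁ := by rw [ha1]
      _ = ((a.1.toBlocks₁₁)ᴴ * a.1.toBlocks₁₁) * (nu n x * (nu n x)ᴴ)
          * ((a.1.toBlocks₁₁)ᴴ * a.1.toBlocks₁₁) := by simp only [mul_assoc]
      _ = _ := by rw [hu]; simp

/-- The gauge group `G_μ = G₊(μ_L) × G₊`, the isotropy group of `μ`. -/
def gaugeGroup (n : ℕ) (x : ℝ) : Subgroup (SL2n n × SL2n n) := (GplusL n x).prod (Gplus n)

/-- The `G_μ`-orbit of `K` for the action `(η_L, η_R) · K = η_L K η_R⁻¹`. -/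
def gaugeOrbit (n : ℕ) (x : ℝ) (K : SL2n n) : Set (SL2n n) :=
  {K' | ∃ η ∈ gaugeGroup n x, K' = η.1 * K * (η.2)⁻¹}

/-- The closed polyhedron `C̄_x`. Indices start from `0`. -/
def closedPolyhedron (n : ℕ) [NeZero n] (x : ℝ) : Set (Fin n → ℝ) :=
  {p | p 0 ≤ 0 ∧ ∀ k l : Fin n, (l : ℕ) = k + 1 → |x| / 2 ≤ p k - p l}

variable {n : ℕ}

/-- The matrix `θ(x, p)`. -/
def theta (x : ℝ) (p : Fin n → ℝ) : Matrix (Fin n) (Fin n) ℝ := fun j k =>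
  if j = k then
    ∏ m ∈ Finset.univ.filter (fun m => m ≠ j),
      Real.sqrt (Real.sinh (p j - p m - x / 2) * Real.sinh (p j - p m + x / 2)
        / Real.sinh (p j - p m) ^ 2)
  else
    Real.sinh (x / 2) / Real.sinh (p k - p j) *
      ∏ m ∈ Finset.univ.filter (fun m => m ≠ j ∧ m ≠ k),
        Real.sqrt (Real.sinh (p j - p m - x / 2) * Real.sinh (p k - p m + x / 2)
          / (Real.sinh (p j - p m) * Real.sinh (p k - p m)))

/-- The vector `r(x, p)`. -/
def rvec (x : ℝ) (p : Fin n → ℝ) (j : Fin n) : ℝ :=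
  Real.sqrt ((1 - Real.exp (-x)) / (1 - Real.exp (-(n * x)))) *
    ∏ k ∈ Finset.univ.filter (fun k => k ≠ j),
      Real.sqrt ((1 - Real.exp (2 * p j - 2 * p k - x)) / (1 - Real.exp (2 * p j - 2 * p k)))

/-- The distinguished index `a`: the last one if `x > 0`, the first one otherwise. -/
def pivot (n : ℕ) [NeZero n] (x : ℝ) : Fin n := if 0 < x then Fin.rev 0 else 0

/-- The matrix `ζ(x, p)`. -/
def zeta [NeZero n] (x : ℝ) (p : Fin n → ℝ) : Matrix (Fin n) (Fin n) ℝ := fun i j =>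
  if i = pivot n x then
    if j = pivot n x then rvec x p (pivot n x) else -rvec x p j
  else if j = pivot n x then rvec x p i
  else (if i = j then 1 else 0) - rvec x p i * rvec x p j / (1 + rvec x p (pivot n x))

/-- The vector `v(x)`. The index `j : Fin n` stands for the `(j + 1)`-st component. -/
def vvec (x : ℝ) (j : Fin n) : ℝ :=
  Real.sqrt (n * (Real.exp x - 1) / (1 - Real.exp (-(n * x)))) *
    Real.exp (-(((j : ℕ) + 1 : ℝ) * x / 2))

/-- The matrix `κ(x)`. -/
def kappa (n : ℕ) [NeZero n] (x : ℝ) : Matrix (Fin n) (Fin n) ℝ := fun i j =>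
  if i = pivot n x then
    if j = pivot n x then vvec x (pivot n x) / Real.sqrt n else -(vvec x j / Real.sqrt n)
  else if j = pivot n x then vvec x i / Real.sqrt n
  else (if i = j then 1 else 0) -
    vvec x i * vvec x j / (n + Real.sqrt n * vvec x (pivot n x))

/-- `T = e^{i q̂} θ(-x, p)`; the element `e^{i q̂}` of the torus is given by `τ`. -/
def Tmat (x : ℝ) (p : Fin n → ℝ) (τ : Fin n → Circle) : Matrix (Fin n) (Fin n) ℂ :=
  diagonal (fun j => (τ j : ℂ)) * (theta (-x) p).map Complex.ofReal

/-- `ρ = κ(x) ζ(x, p)⁻¹`. -/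
def rho [NeZero n] (x : ℝ) (p : Fin n → ℝ) : Matrix (Fin n) (Fin n) ℂ :=
  (kappa n x * (zeta x p)⁻¹).map Complex.ofReal

/-- The angles `q_k ∈ (0, π/2]` with `sin q_k = e^{p_k}`. -/
def qvec (p : Fin n → ℝ) (k : Fin n) : ℝ := Real.arcsin (Real.exp (p k))

/-- The diagonal matrix `sin q`. -/
def sinMat (p : Fin n → ℝ) : Matrix (Fin n) (Fin n) ℂ :=
  diagonal (fun k => (Real.sin (qvec p k) : ℂ))

/-- The diagonal matrix `cos q`. -/
def cosMat (p : Fin n → ℝ) : Matrix (Fin n) (Fin n) ℂ :=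
  diagonal (fun k => (Real.cos (qvec p k) : ℂ))

/-- The positive semi-definite matrix `Λ` with `Λ² = e^{-2u} 1 - e^{-2v} (sin q)²`. -/
def Lambda (u v : ℝ) (p : Fin n → ℝ) : Matrix (Fin n) (Fin n) ℂ :=
  diagonal (fun k =>
    (Real.sqrt (Real.exp (-2 * u) - Real.exp (-2 * v) * Real.sin (qvec p k) ^ 2) : ℂ))

/-- The matrix `α` determined by `Ω = Λ T` and `Ω = i (sin q) α + e^v cos q`. -/
def alpha (u v x : ℝ) (p : Fin n → ℝ) (τ : Fin n → Circle) : Matrix (Fin n) (Fin n) ℂ :=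
  (Complex.I • sinMat p)⁻¹ * (Lambda u v p * Tmat x p τ - (Real.exp v : ℂ) • cosMat p)

/-- The matrix `K(p, e^{i q̂})`. -/
def Kmat [NeZero n] (u v x : ℝ) (p : Fin n → ℝ) (τ : Fin n → Circle) :
    Matrix (Fin n ⊕ Fin n) (Fin n ⊕ Fin n) ℂ :=
  fromBlocks (rho x p) 0 0 1 *
    fromBlocks (cosMat p) (Complex.I • sinMat p) (Complex.I • sinMat p) (cosMat p) *
    fromBlocks ((Real.exp (-v) : ℂ) • 1) (alpha u v x p τ) 0 ((Real.exp v : ℂ) • 1)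

/-- The set of all elements `K(p, e^{i q̂})` with `p ∈ C̄_x` and `e^{i q̂}` in the torus. -/
def sectionSet (n : ℕ) [NeZero n] (u v x : ℝ) : Set (SL2n n) :=
  {K | ∃ p ∈ closedPolyhedron n x, ∃ τ : Fin n → Circle, K.1 = Kmat u v x p τ}

end RSReduction

end

noncomputable section

namespace RSReduction

open Matrix

variable {n : ℕ}

/-! Write D = sin² q = e^{2p̂}, t = e^{-x}, c = `rankCoeff n x`, and let y be the unit vector
v(x)/√n. By `mem_constraintSurface_iff`, a point of the constraint surface is at once a unitary
matrix times a block triangular one with diagonal blocks e^{-v}, e^v, and a block triangular matrix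
with diagonal blocks e^u ν, e^{-u} times a unitary one. Block-diagonal unitaries bring the first
factorization to the form diag(ρ, 1) · rot(q) · tri(α) (`exists_cartan_form`), where v ≠ -u keeps
sin q invertible. For such a matrix the second factorization says two things. Its lower block row
gives i sin q α + e^v cos q = ΛT with T unitary. Its upper left block gives T†DT = sin q (ρ†νν†ρ)
sin q (`exists_triL_iff`). Since νν† = t + c yy†, the latter reads T†DT = tD + c ww† with w = sin q
· ρ†y: a rank one perturbation problem.

Existence. θ(-x, p̂) is a rescaled Cauchy matrix 1/(D_j - tD_k). Lagrange interpolation and the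
displacement equation show that it is orthogonal and solves the problem with w = e^{p̂} r
(`theta_mul_transpose`, `theta_conj`); where a Cauchy denominator vanishes, continuity replaces the
computation. Determinants then force |r| = |y| = 1, so ζ and κ are rotations taking the basis vector
e_a to r and to y, whence ρ†y = r for ρ = κζ⁻¹.

Every orbit meets the section. Interlacing, applied to the equation and to its inverse, places p̂ in
the polyhedron (`le_of_rank_one_perturbation`). Evaluating determinants at the eigenvalues of tD
determines every |w_k| (`normSq_eq_of_rank_one`), so a diagonal phase matrix turns ρ†y into r. After
that T θ⁻¹ commutes with D, whose spectrum is simple, and is therefore a torus element. The two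
choices of ρ differ by a unitary fixing y, which preserves νν†, and a common scalar repairs the
determinants (`mem_gaugeOrbit`). -/

/-! ### Lagrange interpolation and sums over Cauchy matrices -/

/-- The product of the `f m` over all indices `m` different from `j`. -/
def prodNe (j : Fin n) (f : Fin n → ℝ) : ℝ := ∏ m ∈ Finset.univ.filter (fun m => m ≠ j), f m

theorem mul_prodNe (j : Fin n) (f : Fin n → ℝ) : f j * prodNe j f = ∏ m, f m := by
  rw [prodNe, Finset.filter_ne', Finset.mul_prod_erase _ _ (Finset.mem_univ j)]

theorem prodNe_ne_zero {j : Fin n} {f : Fin n → ℝ} (h : ∀ m, m ≠ j → f m ≠ 0) :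
    prodNe j f ≠ 0 :=
  Finset.prod_ne_zero_iff.2 fun m hm => h m (Finset.mem_filter.1 hm).2

theorem prodNe_congr {j : Fin n} {f g : Fin n → ℝ} (h : ∀ m, m ≠ j → f m = g m) :
    prodNe j f = prodNe j g :=
  Finset.prod_congr rfl fun m hm => h m (Finset.mem_filter.1 hm).2

theorem prodNe_div (j : Fin n) (f g : Fin n → ℝ) :
    prodNe j (fun m => f m / g m) = prodNe j f / prodNe j g :=
  Finset.prod_div_distrib _ _

theorem card_filter_ne (j : Fin n) : (Finset.univ.filter (fun m => m ≠ j)).card = n - 1 := by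
  rw [Finset.filter_ne', Finset.card_erase_of_mem (Finset.mem_univ j), Finset.card_univ,
    Fintype.card_fin]

theorem prodNe_const_mul (j : Fin n) (t : ℝ) (f : Fin n → ℝ) :
    prodNe j (fun m => t * f m) = t ^ (n - 1) * prodNe j f := by
  rw [prodNe, Finset.prod_mul_distrib, Finset.prod_const, card_filter_ne, prodNe]

/-- Lagrange interpolation of a polynomial of degree less than `n` at `n` nodes. -/
theorem eval_eq_sum_nodes {y : Fin n → ℝ} (hy : Function.Injective y) {f : Polynomial ℝ}
    (hf : f.degree < n) (z : ℝ) :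
    f.eval z = ∑ k, f.eval (y k) * prodNe k (fun m => (z - y m) / (y k - y m)) := by
  have h := Lagrange.eq_interpolate (s := Finset.univ) (v := y) (f := f) hy.injOn (by simpa using hf)
  conv_lhs => rw [h]
  rw [Lagrange.interpolate_apply, Polynomial.eval_finsetSum]
  refine Finset.sum_congr rfl fun k _ => ?_
  rw [Polynomial.eval_mul, Polynomial.eval_C, Lagrange.basis, Polynomial.eval_prod, prodNe,
    Finset.filter_ne']
  congr 1
  refine Finset.prod_congr rfl fun m _ => ?_
  simp [Lagrange.basisDivisor, div_eq_inv_mul]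

section Cauchy

variable {D y : Fin n → ℝ}

/-- Interpolating ∏_{m≠j}(z - D_m) at the nodes y and evaluating at z = D_l gives the sum. The
polynomial vanishes at D_l for l ≠ j, which is why rows of a suitably weighted Cauchy matrix are
orthogonal. -/
theorem sum_cauchy_mul_cauchy (hy : Function.Injective y)
    (hDy : ∀ j k, D j ≠ y k) (j l : Fin n) :
    ∑ k, (∏ m, (y k - D m)) / prodNe k (fun m => y k - y m) / ((D j - y k) * (D l - y k)) =
      if j = l then -(prodNe j (fun m => D j - D m) / ∏ m, (D j - y m)) else 0 := by
  set f : Polynomial ℝ :=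
    ∏ m ∈ Finset.univ.filter (fun m => m ≠ j), (Polynomial.X - Polynomial.C (D m)) with hf
  have hfe : ∀ z, f.eval z = prodNe j (fun m => z - D m) := by
    intro z; simp [hf, Polynomial.eval_prod, prodNe]
  have hdeg : f.degree < n := by
    rw [hf, Polynomial.degree_prod]
    simp only [Polynomial.degree_X_sub_C, Finset.sum_const, card_filter_ne]
    have := j.pos
    rw [nsmul_eq_mul, mul_one]
    exact_mod_cast (by omega : n - 1 < n)
  have key := eval_eq_sum_nodes hy hdeg (D l)
  have hg : ∏ m, (D l - y m) ≠ 0 := Finset.prod_ne_zero_iff.2 fun m _ => sub_ne_zero.2 (hDy l m)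
  have hterm : ∀ k, f.eval (y k) * prodNe k (fun m => (D l - y m) / (y k - y m)) =
      -(∏ m, (D l - y m)) * ((∏ m, (y k - D m)) / prodNe k (fun m => y k - y m) /
        ((D j - y k) * (D l - y k))) := by
    intro k
    have h1 := mul_prodNe j (fun m => y k - D m)
    have h2 := mul_prodNe k (fun m => D l - y m)
    have h3 : prodNe k (fun m => y k - y m) ≠ 0 :=
      prodNe_ne_zero fun m hm => sub_ne_zero.2 fun h => hm (hy h).symm
    have h4 : D j - y k ≠ 0 := sub_ne_zero.2 (hDy j k)
    have h5 : D l - y k ≠ 0 := sub_ne_zero.2 (hDy l k)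
    rw [hfe, prodNe_div, ← h1, ← h2]
    field_simp
    ring
  rw [Finset.sum_congr rfl fun k _ => hterm k, ← Finset.mul_sum, hfe] at key
  split_ifs with hjl
  · subst hjl
    field_simp at key ⊢
    linarith
  · have h0 : prodNe j (fun m => D l - D m) = 0 :=
      Finset.prod_eq_zero (i := l) (by simp [Ne.symm hjl]) (sub_self _)
    rw [h0] at key
    rcases mul_eq_zero.1 key.symm with h | h
    · exact absurd (neg_eq_zero.1 h) hg
    · exact h

/-- The difference of the monic polynomials with roots D and y has degree less than n. It is
interpolated at the nodes D, where only the y-product survives, and evaluated at y_k, where only the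
D-product does. -/
theorem sum_cauchy (hD : Function.Injective D) (hDy : ∀ j k, D j ≠ y k) (k : Fin n) :
    ∑ j, (∏ m, (D j - y m)) / prodNe j (fun m => D j - D m) / (D j - y k) = 1 := by
  set f : Polynomial ℝ :=
    ∏ m, (Polynomial.X - Polynomial.C (D m)) - ∏ m, (Polynomial.X - Polynomial.C (y m)) with hf
  have hfe : ∀ z, f.eval z = ∏ m, (z - D m) - ∏ m, (z - y m) := by
    intro z; simp [hf, Polynomial.eval_prod]
  have hm : ∀ w : Fin n → ℝ, (∏ m, (Polynomial.X - Polynomial.C (w m))).Monic :=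
    fun w => Polynomial.monic_prod_of_monic _ _ fun m _ => Polynomial.monic_X_sub_C _
  have hd : ∀ w : Fin n → ℝ, (∏ m, (Polynomial.X - Polynomial.C (w m))).degree = (n : WithBot ℕ) := by
    intro w
    rw [Polynomial.degree_prod]
    simp
  have hdeg : f.degree < n := by
    rw [← hd D]
    exact Polynomial.degree_sub_lt_left (by rw [hd, hd]) (hm D).ne_zero
      (by rw [(hm D).leadingCoeff, (hm y).leadingCoeff])
  have key := eval_eq_sum_nodes hD hdeg (y k)
  have hF : ∏ m, (y k - D m) ≠ 0 :=
    Finset.prod_ne_zero_iff.2 fun m _ => sub_ne_zero.2 (hDy m k).symm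
  have hterm : ∀ j, f.eval (D j) * prodNe j (fun m => (y k - D m) / (D j - D m)) =
      (∏ m, (y k - D m)) *
        ((∏ m, (D j - y m)) / prodNe j (fun m => D j - D m) / (D j - y k)) := by
    intro j
    have h1 : ∏ m, (D j - D m) = 0 := Finset.prod_eq_zero (Finset.mem_univ j) (sub_self _)
    have h2 := mul_prodNe j (fun m => y k - D m)
    have h3 : prodNe j (fun m => D j - D m) ≠ 0 :=
      prodNe_ne_zero fun m hm => sub_ne_zero.2 fun h => hm (hD h).symm
    have h4 : D j - y k ≠ 0 := sub_ne_zero.2 (hDy j k)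
    rw [hfe, prodNe_div, h1, ← h2]
    field_simp
    ring
  have h1 : ∏ m, (y k - y m) = 0 := Finset.prod_eq_zero (Finset.mem_univ k) (sub_self _)
  rw [Finset.sum_congr rfl fun k _ => hterm k, ← Finset.mul_sum, hfe, h1, sub_zero] at key
  exact mul_left_cancel₀ hF (by rw [mul_one]; exact key.symm)

end Cauchy

/-! ### Hyperbolic factors as rational functions of e^{2p} -/

theorem exp_sq_half (x : ℝ) : Real.exp (x / 2) ^ 2 = Real.exp x := by
  rw [← Real.exp_nat_mul]; congr 1; push_cast; ring

theorem sinh_sub_eq (a b : ℝ) :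
    Real.sinh (a - b) = (Real.exp a ^ 2 - Real.exp b ^ 2) / (2 * (Real.exp a * Real.exp b)) := by
  rw [Real.sinh_eq, neg_sub, Real.exp_sub, Real.exp_sub]
  field_simp

theorem sinh_add_half_eq (a b x : ℝ) :
    Real.sinh (a - b + x / 2) = Real.exp (x / 2) *
      ((Real.exp a ^ 2 - Real.exp (-x) * Real.exp b ^ 2) / (2 * (Real.exp a * Real.exp b))) := by
  rw [Real.sinh_eq, neg_add, neg_sub, Real.exp_add, Real.exp_add, Real.exp_sub, Real.exp_sub,
    Real.exp_neg, Real.exp_neg, ← exp_sq_half x]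
  field_simp

theorem sinh_sub_half_eq (a b x : ℝ) :
    Real.sinh (a - b - x / 2) = Real.exp (x / 2) *
      ((Real.exp (-x) * Real.exp a ^ 2 - Real.exp b ^ 2) / (2 * (Real.exp a * Real.exp b))) := by
  rw [show a - b - x / 2 = -(b - a + x / 2) by ring, Real.sinh_neg, sinh_add_half_eq,
    mul_comm (Real.exp b) (Real.exp a)]
  ring

/-- The factors under the square roots, expressed through the squares `D` of the `exp p`. -/
def ratioA (t : ℝ) (D : Fin n → ℝ) (j m : Fin n) : ℝ := (D j - t * D m) / (D j - D m)

/-- See `ratioA`. -/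
def ratioB (t : ℝ) (D : Fin n → ℝ) (j m : Fin n) : ℝ := (t * D j - D m) / (D j - D m)

theorem ratioA_comm (t : ℝ) (D : Fin n → ℝ) (j m : Fin n) : ratioA t D j m = ratioB t D m j := by
  rw [ratioA, ratioB, ← neg_sub (t * D m), ← neg_sub (D m), neg_div_neg_eq]

/-- The squares `sin² q = exp (2 p)`. -/
def sqExp (p : Fin n → ℝ) (j : Fin n) : ℝ := Real.exp (p j) ^ 2

theorem sqExp_pos (p : Fin n → ℝ) (j : Fin n) : 0 < sqExp p j := by
  unfold sqExp; positivity

theorem sqExp_eq (p : Fin n → ℝ) (j : Fin n) : sqExp p j = Real.exp (2 * p j) := by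
  rw [sqExp, ← Real.exp_nat_mul]; norm_num

/-- The components of `p` are separated by at least `|x| / 2`. -/
def Separated (x : ℝ) (p : Fin n → ℝ) : Prop := ∀ j k : Fin n, j < k → |x| / 2 ≤ p j - p k

theorem separated_of_mem [NeZero n] {x : ℝ} {p : Fin n → ℝ} (hp : p ∈ closedPolyhedron n x) :
    Separated x p := by
  intro j k hjk
  obtain ⟨d, hd⟩ : ∃ d, (k : ℕ) = j + 1 + d := ⟨k - (j + 1), by have : (j : ℕ) < k := hjk; omega⟩
  clear hjk
  induction d generalizing k with
  | zero => exact hp.2 j k (by omega)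
  | succ d ih =>
    have h1 := ih ⟨j + 1 + d, by omega⟩ rfl
    have h2 := hp.2 ⟨j + 1 + d, by omega⟩ k (by simp; omega)
    have := abs_nonneg x
    linarith

theorem Separated.lt {x : ℝ} (hx : x ≠ 0) {p : Fin n → ℝ} (hp : Separated x p) {j k : Fin n}
    (hjk : j < k) : p k < p j := by
  have := hp j k hjk
  have := abs_pos.2 hx
  linarith

theorem Separated.injective {x : ℝ} (hx : x ≠ 0) {p : Fin n → ℝ} (hp : Separated x p) :
    Function.Injective p := by
  intro j k h
  rcases lt_trichotomy j k with h1 | h1 | h1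
  · exact absurd h (hp.lt hx h1).ne'
  · exact h1
  · exact absurd h (hp.lt hx h1).ne

theorem Separated.sqExp_injective {x : ℝ} (hx : x ≠ 0) {p : Fin n → ℝ} (hp : Separated x p) :
    Function.Injective (sqExp p) := by
  intro j k h
  rw [sqExp_eq, sqExp_eq, Real.exp_eq_exp] at h
  exact hp.injective hx (by linarith)

/-- The gap |x|/2 gives numerator and denominator the same sign for either sign of x, so the square
roots in θ and r are genuine and can be multiplied and squared freely. -/
theorem ratioB_nonneg {x : ℝ} (hx : x ≠ 0) {p : Fin n → ℝ} (hp : Separated x p) {j m : Fin n}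
    (hjm : m ≠ j) : 0 ≤ ratioB (Real.exp (-x)) (sqExp p) j m := by
  rw [ratioB, sqExp_eq, sqExp_eq, ← Real.exp_add]
  rcases lt_or_gt_of_ne hjm with h | h
  · have h1 := hp m j h
    have h2 := hp.lt hx h
    have h3 := neg_le_abs x
    refine div_nonneg_of_nonpos ?_ ?_
    · rw [sub_nonpos, Real.exp_le_exp]; linarith
    · rw [sub_nonpos, Real.exp_le_exp]; linarith
  · have h1 := hp j m h
    have h2 := hp.lt hx h
    have h3 := le_abs_self x
    refine div_nonneg ?_ ?_
    · rw [sub_nonneg, Real.exp_le_exp]; linarith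
    · rw [sub_nonneg, Real.exp_le_exp]; linarith

theorem ratioA_nonneg {x : ℝ} (hx : x ≠ 0) {p : Fin n → ℝ} (hp : Separated x p) {j m : Fin n}
    (hjm : m ≠ j) : 0 ≤ ratioA (Real.exp (-x)) (sqExp p) j m := by
  rw [ratioA_comm]; exact ratioB_nonneg hx hp hjm.symm

/-- `∏_{m ≠ j} √(ratioA j m)`. -/
def vecA (x : ℝ) (p : Fin n → ℝ) (j : Fin n) : ℝ :=
  prodNe j fun m => Real.sqrt (ratioA (Real.exp (-x)) (sqExp p) j m)

/-- `∏_{m ≠ j} √(ratioB j m)`. -/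
def vecB (x : ℝ) (p : Fin n → ℝ) (j : Fin n) : ℝ :=
  prodNe j fun m => Real.sqrt (ratioB (Real.exp (-x)) (sqExp p) j m)

theorem vecA_sq {x : ℝ} (hx : x ≠ 0) {p : Fin n → ℝ} (hp : Separated x p) (j : Fin n) :
    vecA x p j ^ 2 = prodNe j fun m => ratioA (Real.exp (-x)) (sqExp p) j m := by
  rw [vecA, prodNe, ← Finset.prod_pow]
  exact prodNe_congr fun m hm => Real.sq_sqrt (ratioA_nonneg hx hp hm)

theorem vecB_sq {x : ℝ} (hx : x ≠ 0) {p : Fin n → ℝ} (hp : Separated x p) (j : Fin n) :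
    vecB x p j ^ 2 = prodNe j fun m => ratioB (Real.exp (-x)) (sqExp p) j m := by
  rw [vecB, prodNe, ← Finset.prod_pow]
  exact prodNe_congr fun m hm => Real.sq_sqrt (ratioB_nonneg hx hp hm)

theorem rvec_eq (x : ℝ) {p : Fin n → ℝ} (hp : Function.Injective p) (j : Fin n) :
    rvec x p j =
      Real.sqrt ((1 - Real.exp (-x)) / (1 - Real.exp (-x) ^ n)) * vecB x p j := by
  rw [rvec, vecB, ← Real.exp_nat_mul, mul_neg]
  congr 1
  refine prodNe_congr (g := fun m => Real.sqrt (ratioB (Real.exp (-x)) (sqExp p) j m))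
    fun m hm => ?_
  have h1 : Real.exp (2 * p j) ≠ Real.exp (2 * p m) := fun h =>
    hm (hp (by rw [Real.exp_eq_exp] at h; linarith)).symm
  have h3 : Real.exp (2 * p m) - Real.exp (2 * p j) ≠ 0 := sub_ne_zero.2 h1.symm
  have h2 : Real.exp (2 * p j) - Real.exp (2 * p m) ≠ 0 := sub_ne_zero.2 h1
  rw [ratioB, sqExp_eq, sqExp_eq, Real.exp_sub, Real.exp_sub, Real.exp_neg]
  congr 1
  have h4 : 1 - Real.exp (2 * p j) / Real.exp (2 * p m) ≠ 0 := by
    rw [sub_ne_zero]; intro h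
    exact h1 ((div_eq_one_iff_eq (Real.exp_pos _).ne').1 h.symm)
  rw [div_eq_div_iff h4 h2, ← Real.exp_neg]
  have := (Real.exp_pos (2 * p m)).ne'
  rw [Real.exp_neg]
  field_simp
  ring

theorem sinh_ratio (p : Fin n → ℝ) (x : ℝ) (j m : Fin n) :
    Real.sinh (p j - p m + x / 2) / Real.sinh (p j - p m) =
      Real.exp (x / 2) * ratioA (Real.exp (-x)) (sqExp p) j m := by
  have h : 2 * (Real.exp (p j) * Real.exp (p m)) ≠ 0 := by positivity
  rw [sinh_add_half_eq, sinh_sub_eq, ratioA, sqExp, sqExp, mul_div_assoc, div_div_div_cancel_right₀ h]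

theorem sinh_ratio' (p : Fin n → ℝ) (x : ℝ) (j m : Fin n) :
    Real.sinh (p j - p m - x / 2) / Real.sinh (p j - p m) =
      Real.exp (x / 2) * ratioB (Real.exp (-x)) (sqExp p) j m := by
  have h : 2 * (Real.exp (p j) * Real.exp (p m)) ≠ 0 := by positivity
  rw [sinh_sub_half_eq, sinh_sub_eq, ratioB, sqExp, sqExp, mul_div_assoc, div_div_div_cancel_right₀ h]

theorem sqrt_sinh_factor {x : ℝ} (hx : x ≠ 0) {p : Fin n → ℝ} (hp : Separated x p)
    {j k m : Fin n} (hj : m ≠ j) :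
    Real.sqrt (Real.sinh (p j - p m - -x / 2) * Real.sinh (p k - p m + -x / 2)
          / (Real.sinh (p j - p m) * Real.sinh (p k - p m))) =
      Real.exp (x / 2) * (Real.sqrt (ratioA (Real.exp (-x)) (sqExp p) j m) *
        Real.sqrt (ratioB (Real.exp (-x)) (sqExp p) k m)) := by
  rw [show p j - p m - -x / 2 = p j - p m + x / 2 by ring,
    show p k - p m + -x / 2 = p k - p m - x / 2 by ring, mul_div_mul_comm, sinh_ratio, sinh_ratio',
    mul_mul_mul_comm, Real.sqrt_mul (mul_self_nonneg _), Real.sqrt_mul_self (Real.exp_pos _).le,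
    Real.sqrt_mul (ratioA_nonneg hx hp hj)]

/-- The Cauchy form of θ: a diagonal matrix times 1/(D_j - tD_k) times a diagonal matrix. Off the
diagonal, `vecA` at j and `vecB` at k share the factor √(`ratioA` j k); its square (D_j - tD_k)/(D_j
- D_k) cancels the Cauchy denominator and leaves the sinh(p_k - p_j) of the definition. -/
theorem theta_neg_apply {x : ℝ} (hx : x ≠ 0) {p : Fin n → ℝ} (hp : Separated x p)
    (hD : ∀ j k, sqExp p j ≠ Real.exp (-x) * sqExp p k) (j k : Fin n) :
    theta (-x) p j k = Real.exp (x / 2) ^ (n - 1) * (1 - Real.exp (-x)) *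
      ((Real.exp (p j) * vecA x p j) * (Real.exp (p k) * vecB x p k) /
        (sqExp p j - Real.exp (-x) * sqExp p k)) := by
  have hjk' := sub_ne_zero.2 (hD j k)
  rw [theta]
  split_ifs with hjk
  · subst hjk
    have : ∀ m, m ≠ j → Real.sqrt (Real.sinh (p j - p m - -x / 2) * Real.sinh (p j - p m + -x / 2)
        / Real.sinh (p j - p m) ^ 2) = Real.exp (x / 2) *
        (Real.sqrt (ratioA (Real.exp (-x)) (sqExp p) j m) *
        Real.sqrt (ratioB (Real.exp (-x)) (sqExp p) j m)) := fun m hm => by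
      rw [pow_two, sqrt_sinh_factor hx hp hm]
    rw [Finset.prod_congr rfl fun m hm => this m (Finset.mem_filter.1 hm).2,
      Finset.prod_mul_distrib, Finset.prod_mul_distrib, Finset.prod_const, card_filter_ne]
    change _ * (vecA x p j * vecB x p j) = _
    have : sqExp p j - Real.exp (-x) * sqExp p j = (1 - Real.exp (-x)) * Real.exp (p j) ^ 2 := by
      rw [sqExp]; ring
    rw [this] at hjk' ⊢
    have h1 : 1 - Real.exp (-x) ≠ 0 := left_ne_zero_of_mul hjk'
    field_simp
  · have hf : ∀ i l : Fin n, l ≠ i →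
        (Finset.univ.filter fun m => m ≠ i) = insert l (Finset.univ.filter fun m => m ≠ i ∧ m ≠ l) := by
      intro i l hl
      ext m
      simp only [Finset.mem_filter, Finset.mem_univ, true_and, Finset.mem_insert]
      by_cases h : m = l <;> simp [h, hl]
    have hcard : (Finset.univ.filter fun m => m ≠ j ∧ m ≠ k).card = n - 2 := by
      have h1 := card_filter_ne j
      rw [hf j k (Ne.symm hjk), Finset.card_insert_of_notMem (by simp)] at h1
      omega
    have hA : vecA x p j = Real.sqrt (ratioA (Real.exp (-x)) (sqExp p) j k) *
        ∏ m ∈ Finset.univ.filter (fun m => m ≠ j ∧ m ≠ k),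
          Real.sqrt (ratioA (Real.exp (-x)) (sqExp p) j m) := by
      rw [vecA, prodNe, hf j k (Ne.symm hjk), Finset.prod_insert (by simp)]
    have hB : vecB x p k = Real.sqrt (ratioA (Real.exp (-x)) (sqExp p) j k) *
        ∏ m ∈ Finset.univ.filter (fun m => m ≠ j ∧ m ≠ k),
          Real.sqrt (ratioB (Real.exp (-x)) (sqExp p) k m) := by
      rw [vecB, prodNe, hf k j hjk, Finset.prod_insert (by simp), ratioA_comm]
      simp only [and_comm]
    have h2 : 2 ≤ n := by
      have := j.2; have := k.2; have : (j : ℕ) ≠ k := fun h => hjk (Fin.ext h); omega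
    rw [Finset.prod_congr rfl fun m hm => sqrt_sinh_factor hx hp (Finset.mem_filter.1 hm).2.1,
      Finset.prod_mul_distrib, Finset.prod_mul_distrib, Finset.prod_const, hcard, hA, hB]
    set PA := ∏ m ∈ Finset.univ.filter (fun m => m ≠ j ∧ m ≠ k),
          Real.sqrt (ratioA (Real.exp (-x)) (sqExp p) j m)
    set PB := ∏ m ∈ Finset.univ.filter (fun m => m ≠ j ∧ m ≠ k),
          Real.sqrt (ratioB (Real.exp (-x)) (sqExp p) k m)
    have hs := Real.mul_self_sqrt (ratioA_nonneg hx hp (Ne.symm hjk))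
    set s := Real.sqrt (ratioA (Real.exp (-x)) (sqExp p) j k)
    have hD' : Real.exp (p j) ^ 2 - Real.exp (p k) ^ 2 ≠ 0 :=
      sub_ne_zero.2 fun h => hjk (hp.sqExp_injective hx h)
    have hsh : Real.sinh (-x / 2) = -(Real.exp (x / 2) * (1 - Real.exp (-x)) / 2) := by
      have := sinh_add_half_eq 0 0 x
      rw [neg_div, Real.sinh_neg, ← zero_add (x / 2), ← sub_self (0 : ℝ), this]
      simp; ring
    have hpow : Real.exp (x / 2) ^ (n - 1) = Real.exp (x / 2) ^ (n - 2) * Real.exp (x / 2) := by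
      rw [← pow_succ]; congr 1; omega
    rw [hsh, ← neg_sub (p j), Real.sinh_neg, neg_div_neg_eq, sinh_sub_eq, hpow,
      show Real.exp (p j) * (s * PA) * (Real.exp (p k) * (s * PB)) =
        Real.exp (p j) * Real.exp (p k) * PA * PB * (s * s) by ring, hs, ratioA]
    simp only [sqExp] at hjk' ⊢
    field_simp

/-! ### Orthogonality and the rank one equation for θ in Cauchy form -/

section Interior

variable {x : ℝ} {p : Fin n → ℝ}

theorem one_sub_exp_ne_zero (hx : x ≠ 0) : 1 - Real.exp (-x) ≠ 0 := by
  rw [sub_ne_zero]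
  intro h
  exact hx (by simpa using h.symm)

theorem prod_sub_eq (t : ℝ) (D : Fin n → ℝ) (j : Fin n) :
    ∏ m, (D j - t * D m) = (1 - t) * D j * prodNe j (fun m => D j - t * D m) := by
  rw [← mul_prodNe j]; ring

theorem prod_sub_eq' (t : ℝ) (D : Fin n → ℝ) (j : Fin n) :
    ∏ m, (t * D j - D m) = -((1 - t) * D j) * prodNe j (fun m => t * D j - D m) := by
  rw [← mul_prodNe j]; ring

/-- With nodes y_k = tD_k, the squared column weights of θ are, up to a constant, the coefficients
in `sum_cauchy_mul_cauchy`, and the squared row weights are the reciprocals of its diagonal values.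
-/
theorem theta_mul_transpose_of_interior (hx : x ≠ 0) (hp : Separated x p)
    (hD : ∀ j k, sqExp p j ≠ Real.exp (-x) * sqExp p k) :
    theta (-x) p * (theta (-x) p)ᵀ = 1 := by
  set t := Real.exp (-x) with ht
  have ht0 : t ≠ 0 := (Real.exp_pos _).ne'
  have ht1 : 1 - t ≠ 0 := one_sub_exp_ne_zero hx
  set D := sqExp p with hDdef
  have hDi : Function.Injective D := hp.sqExp_injective hx
  have hy : Function.Injective (fun k => t * D k) := fun i j h => hDi (mul_left_cancel₀ ht0 h)
  have hD0 : ∀ j, D j ≠ 0 := fun j => (sqExp_pos p j).ne'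
  -- The power of e^{x/2} collected from the sinh quotients exactly compensates the powers of t
  -- produced by scaling the nodes.
  have hG : (Real.exp (x / 2) ^ (n - 1)) ^ 2 * t ^ (n - 1) = 1 := by
    rw [← pow_mul, mul_comm (n - 1) 2, pow_mul, exp_sq_half, ← mul_pow, ht, ← Real.exp_add]
    simp
  ext j l
  have key := sum_cauchy_mul_cauchy hy hD j l
  have hβ : ∀ k, (∏ m, (t * D k - D m)) / prodNe k (fun m => t * D k - t * D m) =
      -((1 - t) * (D k * vecB x p k ^ 2)) / t ^ (n - 1) := by
    intro k
    have h3 : prodNe k (fun m => D k - D m) ≠ 0 :=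
      prodNe_ne_zero fun m hm => sub_ne_zero.2 fun h => hm (hDi h).symm
    simp only [← mul_sub]
    rw [prodNe_const_mul, prod_sub_eq', vecB_sq hx hp]
    simp only [ratioB, prodNe_div, ← ht, ← hDdef]
    field_simp
  simp only [hβ] at key
  have hsum : (theta (-x) p * (theta (-x) p)ᵀ) j l = -((Real.exp (x / 2) ^ (n - 1)) ^ 2 *
      t ^ (n - 1)) * (1 - t) * (Real.exp (p j) * vecA x p j) * (Real.exp (p l) * vecA x p l) *
      ∑ k, -((1 - t) * (D k * vecB x p k ^ 2)) / t ^ (n - 1) /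
        ((D j - t * D k) * (D l - t * D k)) := by
    rw [Matrix.mul_apply, Finset.mul_sum]
    refine Finset.sum_congr rfl fun k _ => ?_
    have h4 := sub_ne_zero.2 (hD j k)
    have h5 := sub_ne_zero.2 (hD l k)
    rw [transpose_apply, theta_neg_apply hx hp hD, theta_neg_apply hx hp hD]
    rw [show D k = Real.exp (p k) ^ 2 from rfl] at *
    rw [show sqExp p k = Real.exp (p k) ^ 2 from rfl] at *
    simp only [← ht, ← hDdef]
    field_simp
  rw [hsum, key, hG]
  by_cases hjl : j = l
  · subst hjl
    have h3 : prodNe j (fun m => D j - D m) ≠ 0 :=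
      prodNe_ne_zero fun m hm => sub_ne_zero.2 fun h => hm (hDi h).symm
    have h6 : prodNe j (fun m => D j - t * D m) ≠ 0 :=
      prodNe_ne_zero fun m _ => sub_ne_zero.2 (hD j m)
    rw [if_pos rfl, Matrix.one_apply_eq, prod_sub_eq]
    have h7 := vecA_sq hx hp j
    simp only [ratioA, prodNe_div, ← ht, ← hDdef] at h7
    have h8 : D j = Real.exp (p j) ^ 2 := rfl
    have h9 := hD0 j
    calc _ = (1 - t) * (Real.exp (p j) ^ 2) * vecA x p j ^ 2 * (prodNe j (fun m => D j - D m) /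
          ((1 - t) * D j * prodNe j fun m => D j - t * D m)) := by ring
      _ = 1 := by rw [h7, ← h8]; field_simp
  · rw [if_neg hjl, Matrix.one_apply_ne hjl, mul_zero]

theorem one_sub_exp_div_pos (hx : x ≠ 0) (hn : n ≠ 0) :
    0 < (1 - Real.exp (-x)) / (1 - Real.exp (-x) ^ n) := by
  rcases lt_or_gt_of_ne hx with h | h
  · have h1 : 1 < Real.exp (-x) := Real.one_lt_exp_iff.2 (by linarith)
    have h2 := one_lt_pow₀ h1 hn
    exact div_pos_of_neg_of_neg (by linarith) (by linarith)
  · have h1 : Real.exp (-x) < 1 := by simpa using h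
    have h2 := pow_lt_one₀ (Real.exp_pos _).le h1 hn
    exact div_pos (by linarith) (by linarith)

/-- The coefficient of the rank one term in `ν ν†`, divided by the squared length. -/
def rankCoeff (n : ℕ) (x : ℝ) : ℝ := Real.exp ((n - 1) * x) - Real.exp (-x)

theorem rankCoeff_mul (n : ℕ) (x : ℝ) :
    rankCoeff n x * Real.exp (-x) ^ n = Real.exp (-x) * (1 - Real.exp (-x) ^ n) := by
  rw [rankCoeff, sub_mul, ← Real.exp_nat_mul, ← Real.exp_add]
  ring_nf

theorem rankCoeff_ne_zero (hx : x ≠ 0) (hn : n ≠ 0) : rankCoeff n x ≠ 0 := by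
  rw [rankCoeff, sub_ne_zero, Ne, Real.exp_eq_exp]
  intro h
  have : (n : ℝ) * x = 0 := by linarith
  simp_all

/-- The vector `e^p r`. -/
def wvec (x : ℝ) (p : Fin n → ℝ) (j : Fin n) : ℝ := Real.exp (p j) * rvec x p j

/-- θ satisfies the displacement equation Dθ = tθD + G ab^T, so multiplying by θ^T from the left
leaves tD plus a rank one term with left vector θ^T a. `sum_cauchy` identifies θ^T a as a multiple
of b, and the constants combine to `rankCoeff n x`. -/
theorem theta_conj_of_interior (hx : x ≠ 0) (hp : Separated x p)
    (hD : ∀ j k, sqExp p j ≠ Real.exp (-x) * sqExp p k) :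
    (theta (-x) p)ᵀ * diagonal (sqExp p) * theta (-x) p =
      Real.exp (-x) • diagonal (sqExp p) + rankCoeff n x • vecMulVec (wvec x p) (wvec x p) := by
  have horth := theta_mul_transpose_of_interior hx hp hD
  have horth' : (theta (-x) p)ᵀ * theta (-x) p = 1 := mul_eq_one_comm.1 horth
  set t := Real.exp (-x) with ht
  have ht0 : t ≠ 0 := (Real.exp_pos _).ne'
  have ht1 : 1 - t ≠ 0 := one_sub_exp_ne_zero hx
  set D := sqExp p with hDdef
  have hDi : Function.Injective D := hp.sqExp_injective hx
  set G := Real.exp (x / 2) ^ (n - 1) * (1 - t) with hGdef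
  have hD0 : ∀ j, D j ≠ 0 := fun j => (sqExp_pos p j).ne'
  set θ := theta (-x) p with hθ
  set a : Fin n → ℝ := fun j => Real.exp (p j) * vecA x p j with ha
  set b : Fin n → ℝ := fun j => Real.exp (p j) * vecB x p j with hb
  have hθe : ∀ j k, θ j k = G * (a j * b k / (D j - t * D k)) := theta_neg_apply hx hp hD
  -- Clearing the Cauchy denominator: (D_j - tD_k) θ_jk = G a_j b_k.
  have h1 : diagonal D * θ = t • (θ * diagonal D) + G • vecMulVec a b := by
    ext j k
    have h4 := sub_ne_zero.2 (hD j k)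
    simp only [diagonal_mul, Matrix.add_apply, Matrix.smul_apply, mul_diagonal, hθe,
      vecMulVec_apply, smul_eq_mul]
    field_simp
    ring
  have h2 : θᵀ *ᵥ a = (G / (1 - t)) • b := by
    ext k
    have key := sum_cauchy (y := fun k => t * D k) hDi hD k
    have hα : ∀ j, (∏ m, (D j - t * D m)) / prodNe j (fun m => D j - D m) = (1 - t) * a j ^ 2 := by
      intro j
      have h3 : prodNe j (fun m => D j - D m) ≠ 0 :=
        prodNe_ne_zero fun m hm => sub_ne_zero.2 fun h => hm (hDi h).symm
      have h7 := vecA_sq hx hp j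
      simp only [ratioA, prodNe_div, ← ht, ← hDdef] at h7
      rw [prod_sub_eq, ha, mul_pow, h7, show D j = Real.exp (p j) ^ 2 from rfl]
      field_simp
    simp only [hα] at key
    calc (θᵀ *ᵥ a) k = ∑ j, θ j k * a j := rfl
      _ = G * b k / (1 - t) * ∑ j, (1 - t) * a j ^ 2 / (D j - t * D k) := by
        rw [Finset.mul_sum]
        refine Finset.sum_congr rfl fun j _ => ?_
        have h4 := sub_ne_zero.2 (hD j k)
        rw [hθe]
        field_simp
      _ = _ := by rw [key]; simp; ring
  have h3 : (G ^ 2 / (1 - t)) • vecMulVec b b = rankCoeff n x • vecMulVec (wvec x p) (wvec x p) := by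
    ext j k
    have hn : n ≠ 0 := j.pos.ne'
    have hN := one_sub_exp_div_pos (n := n) hx hn
    have hs := Real.mul_self_sqrt hN.le
    have hne : 1 - t ^ n ≠ 0 := by
      intro h
      rw [← ht, h, div_zero] at hN
      exact lt_irrefl _ hN
    have hc := rankCoeff_mul n x
    have hG : (Real.exp (x / 2) ^ (n - 1)) ^ 2 * t ^ (n - 1) = 1 := by
      rw [← pow_mul, mul_comm (n - 1) 2, pow_mul, exp_sq_half, ← mul_pow, ht, ← Real.exp_add]
      simp
    have hpow : t ^ n = t ^ (n - 1) * t := by rw [← pow_succ]; congr 1; omega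
    have hr := rvec_eq x (hp.injective hx)
    simp only [Matrix.smul_apply, vecMulVec_apply, wvec, hr, smul_eq_mul, hb]
    rw [← ht] at hs hc ⊢
    set N := Real.sqrt ((1 - t) / (1 - t ^ n))
    -- The constant in `rvec` is chosen so that this holds; it uses c t^n = t(1 - t^n).
    have hcc : G ^ 2 / (1 - t) = rankCoeff n x * (N * N) := by
      rw [hs]
      have h5 : rankCoeff n x = t * (1 - t ^ n) / t ^ n := by
        rw [eq_div_iff (pow_ne_zero _ ht0), hc]
      have h6 : (Real.exp (x / 2) ^ (n - 1)) ^ 2 = 1 / t ^ (n - 1) := by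
        rw [eq_div_iff (pow_ne_zero _ ht0), hG]
      rw [h5, hGdef, mul_pow, h6, hpow]
      rw [hpow] at hne
      field_simp
    rw [hcc]
    ring
  rw [Matrix.mul_assoc, h1, Matrix.mul_add, Matrix.mul_smul, ← Matrix.mul_assoc, horth', one_mul, ← h3,
    Matrix.mul_smul, mul_vecMulVec, h2]
  congr 1
  rw [smul_vecMulVec, smul_smul]
  congr 1
  ring

end Interior

/-! ### Extension to the walls of the polyhedron by continuity -/

section Boundary

variable {x : ℝ} {p : Fin n → ℝ}

theorem continuousAt_theta (hp : Function.Injective p) (x : ℝ) (j k : Fin n) :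
    ContinuousAt (fun q : Fin n → ℝ => theta x q j k) p := by
  have hs : ∀ {i m : Fin n}, i ≠ m → Real.sinh (p i - p m) ≠ 0 := fun h h0 =>
    h (hp (sub_eq_zero.1 (Real.sinh_eq_zero.1 h0)))
  unfold theta
  split_ifs with h
  · refine tendsto_finsetProd _ fun m hm => ?_
    have := hs (Finset.mem_filter.1 hm).2.symm
    refine (Real.continuous_sqrt.continuousAt).comp ?_
    exact ContinuousAt.div (by fun_prop) (by fun_prop) (pow_ne_zero _ this)
  · refine ContinuousAt.mul (ContinuousAt.div (by fun_prop) (by fun_prop) (hs (Ne.symm h))) ?_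
    refine tendsto_finsetProd _ fun m hm => ?_
    have h1 := hs (Finset.mem_filter.1 hm).2.1.symm
    have h2 := hs (Finset.mem_filter.1 hm).2.2.symm
    refine (Real.continuous_sqrt.continuousAt).comp ?_
    exact ContinuousAt.div (by fun_prop) (by fun_prop) (mul_ne_zero h1 h2)

theorem continuousAt_wvec (hp : Function.Injective p) (x : ℝ) (j : Fin n) :
    ContinuousAt (fun q : Fin n → ℝ => wvec x q j) p := by
  unfold wvec rvec
  refine ContinuousAt.mul (Real.continuous_exp.comp (continuous_apply j)).continuousAt
    (ContinuousAt.mul continuousAt_const ?_)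
  refine tendsto_finsetProd _ fun m hm => ?_
  refine (Real.continuous_sqrt.continuousAt).comp ?_
  refine ContinuousAt.div (by fun_prop) (by fun_prop) ?_
  rw [sub_ne_zero]
  intro h
  have h1 : 2 * p j - 2 * p m = 0 := by simpa using h.symm
  exact (Finset.mem_filter.1 hm).2 (hp (by linarith)).symm

/-- A shift of `p` into the open polyhedron. -/
def shift (p : Fin n → ℝ) (ε : ℝ) (j : Fin n) : ℝ := p j - ε * (j : ℕ)

theorem shift_gap (hp : Separated x p) {ε : ℝ} (hε : 0 < ε) {j k : Fin n} (hjk : j < k) :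
    |x| / 2 < shift p ε j - shift p ε k := by
  have h1 := hp j k hjk
  have h2 : ((j : ℕ) : ℝ) < (k : ℕ) := by exact_mod_cast hjk
  have h3 := mul_lt_mul_of_pos_left h2 hε
  unfold shift
  linarith

theorem shift_interior (hx : x ≠ 0) (hp : Separated x p) {ε : ℝ} (hε : 0 < ε) (j k : Fin n) :
    sqExp (shift p ε) j ≠ Real.exp (-x) * sqExp (shift p ε) k := by
  rw [sqExp_eq, sqExp_eq, ← Real.exp_add, Ne, Real.exp_eq_exp]
  intro h
  rcases lt_trichotomy j k with h1 | h1 | h1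
  · have := shift_gap hp hε h1
    have := neg_le_abs x
    linarith
  · subst h1
    exact hx (by linarith)
  · have := shift_gap hp hε h1
    have := le_abs_self x
    linarith

/-- On a wall some D_j equals tD_k and the Cauchy form degenerates to 0/0, although θ and w
themselves stay continuous. Shifting p by ε(0, -1, -2, …) makes every gap strict, and ε → 0 from
above carries identities to p. -/
theorem eq_of_interior_eq (hx : x ≠ 0) (hp : Separated x p) {f g : (Fin n → ℝ) → ℝ}
    (hf : ContinuousAt f p) (hg : ContinuousAt g p)
    (h : ∀ q, Separated x q → (∀ j k, sqExp q j ≠ Real.exp (-x) * sqExp q k) → f q = g q) :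
    f p = g p := by
  have hs : Filter.Tendsto (shift p) (nhdsWithin 0 (Set.Ioi 0)) (nhds p) := by
    have h0 : shift p 0 = p := by ext j; simp [shift]
    have hc : Continuous (shift p) := by unfold shift; fun_prop
    have := hc.tendsto 0
    rw [h0] at this
    exact this.mono_left nhdsWithin_le_nhds
  refine tendsto_nhds_unique (hf.tendsto.comp hs) ((hg.tendsto.comp hs).congr' ?_)
  filter_upwards [self_mem_nhdsWithin] with ε hε
  exact (h _ (fun j k hjk => (shift_gap hp hε hjk).le) (shift_interior hx hp hε)).symm

theorem theta_mul_transpose (hx : x ≠ 0) (hp : Separated x p) :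
    theta (-x) p * (theta (-x) p)ᵀ = 1 := by
  have hc := continuousAt_theta (hp.injective hx) (-x)
  ext j l
  refine eq_of_interior_eq hx hp (f := fun q => (theta (-x) q * (theta (-x) q)ᵀ) j l)
    (g := fun _ => (1 : Matrix (Fin n) (Fin n) ℝ) j l) ?_ continuousAt_const
    fun q hq hD => by rw [theta_mul_transpose_of_interior hx hq hD]
  simp only [Matrix.mul_apply, transpose_apply]
  exact tendsto_finsetSum _ fun k _ => (hc j k).mul (hc l k)

theorem theta_conj (hx : x ≠ 0) (hp : Separated x p) :
    (theta (-x) p)ᵀ * diagonal (sqExp p) * theta (-x) p =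
      Real.exp (-x) • diagonal (sqExp p) + rankCoeff n x • vecMulVec (wvec x p) (wvec x p) := by
  have hc := continuousAt_theta (hp.injective hx) (-x)
  have hw := continuousAt_wvec (hp.injective hx) x
  have hS : ∀ k, ContinuousAt (fun q : Fin n → ℝ => sqExp q k) p := fun k =>
    (Real.continuous_exp.comp (continuous_apply k)).continuousAt.pow 2
  ext j l
  refine eq_of_interior_eq hx hp
    (f := fun q => ((theta (-x) q)ᵀ * diagonal (sqExp q) * theta (-x) q) j l)
    (g := fun q => (Real.exp (-x) • diagonal (sqExp q) +
      rankCoeff n x • vecMulVec (wvec x q) (wvec x q)) j l) ?_ ?_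
    fun q hq hD => by rw [theta_conj_of_interior hx hq hD]
  · simp only [Matrix.mul_apply (M := _ * diagonal _), mul_diagonal, transpose_apply]
    exact tendsto_finsetSum _ fun k _ => ((hc k j).mul (hS k)).mul (hc k l)
  · simp only [Matrix.add_apply, Matrix.smul_apply, vecMulVec_apply, smul_eq_mul]
    refine ContinuousAt.add (continuousAt_const.mul ?_) (continuousAt_const.mul ((hw j).mul (hw l)))
    by_cases h : j = l
    · subst h; simpa using hS j
    · simp only [diagonal_apply_ne _ h]; exact continuousAt_const

end Boundary

/-! ### Determinants of rank one perturbations and the length of r -/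

theorem det_one_add_vecMulVec {R : Type*} [CommRing R] (u v : Fin n → R) :
    (1 + vecMulVec u v).det = 1 + v ⬝ᵥ u := by
  rw [vecMulVec_eq Unit, det_one_add_replicateCol_mul_replicateRow]

theorem det_diagonal_add_vecMulVec_of_ne_zero {K : Type*} [Field K] {d : Fin n → K}
    (hd : ∀ i, d i ≠ 0) (u v : Fin n → K) :
    (diagonal d + vecMulVec u v).det =
      ∏ i, d i + ∑ k, u k * v k * ∏ i ∈ Finset.univ.erase k, d i := by
  have h : diagonal d + vecMulVec u v = diagonal d * (1 + vecMulVec (fun i => u i / d i) v) := by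
    ext i j
    have := hd i
    rw [Matrix.mul_add, Matrix.mul_one, Matrix.add_apply, Matrix.add_apply, diagonal_mul,
      vecMulVec_apply, vecMulVec_apply]
    field_simp
  rw [h, det_mul, det_diagonal, det_one_add_vecMulVec, mul_add, mul_one, dotProduct,
    Finset.mul_sum]
  congr 1
  refine Finset.sum_congr rfl fun k _ => ?_
  rw [← Finset.mul_prod_erase _ _ (Finset.mem_univ k)]
  have := hd k
  field_simp

/-- The determinant of a rank one perturbation of a diagonal matrix. -/
theorem det_diagonal_add_vecMulVec {K : Type*} [NontriviallyNormedField K] (d u v : Fin n → K) :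
    (diagonal d + vecMulVec u v).det =
      ∏ i, d i + ∑ k, u k * v k * ∏ i ∈ Finset.univ.erase k, d i := by
  -- Both sides are continuous in the shift d ↦ d + ε, and for all small ε ≠ 0 no shifted entry
  -- vanishes, so the nonvanishing case passes to the limit.
  have hL : Continuous fun ε : K => (diagonal (fun i => d i + ε) + vecMulVec u v).det := by
    refine Continuous.matrix_det ?_
    have h : Continuous fun (ε : K) i => d i + ε := continuous_pi fun i => by fun_prop
    exact h.matrix_diagonal.add continuous_const
  have hR : Continuous fun ε : K =>
      ∏ i, (d i + ε) + ∑ k, u k * v k * ∏ i ∈ Finset.univ.erase k, (d i + ε) := by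
    fun_prop
  have h1 := (hL.tendsto 0).mono_left (nhdsWithin_le_nhds (s := {0}ᶜ))
  have h2 := (hR.tendsto 0).mono_left (nhdsWithin_le_nhds (s := {0}ᶜ))
  simp only [add_zero] at h1 h2
  refine tendsto_nhds_unique h1 (h2.congr' ?_)
  have : ∀ i, ∀ᶠ ε in nhdsWithin (0 : K) {0}ᶜ, d i + ε ≠ 0 := by
    intro i
    by_cases hi : d i = 0
    · filter_upwards [self_mem_nhdsWithin] with ε hε
      simpa [hi] using hε
    · refine Filter.Eventually.filter_mono nhdsWithin_le_nhds ?_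
      refine ContinuousAt.eventually_ne (by fun_prop) (by simpa using hi)
  filter_upwards [Filter.eventually_all.2 this] with ε hε
  exact (det_diagonal_add_vecMulVec_of_ne_zero hε u v).symm

/-- If `∏ D = det (t D + c w wᵀ)` and `w = S r` with `S² = D`, then `r` is a unit vector. -/
theorem sum_sq_eq_one {x : ℝ} (hx : x ≠ 0) (hn : n ≠ 0) {s : ℝ}
    (h : 1 = Real.exp (-x) ^ n * (1 + rankCoeff n x / Real.exp (-x) * s)) : s = 1 := by
  have h1 := rankCoeff_mul n x
  have h2 := one_sub_exp_div_pos hx hn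
  set t := Real.exp (-x) with ht
  have ht0 : t ≠ 0 := (Real.exp_pos _).ne'
  have h3 : 1 - t ^ n ≠ 0 := by
    intro h0; rw [h0, div_zero] at h2; exact lt_irrefl _ h2
  have h4 : t * (1 - t ^ n) = t * (1 - t ^ n) * s := by
    rw [← h1]
    field_simp at h
    linarith
  exact (mul_left_cancel₀ (mul_ne_zero (Real.exp_pos (-x)).ne' h3) (by rw [mul_one]; exact h4)).symm

theorem det_smul_diagonal_add_vecMulVec (t c : ℝ) (ht : t ≠ 0) (s r : Fin n → ℝ)
    (hs : ∀ i, s i ≠ 0) :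
    (t • diagonal (fun i => s i ^ 2) + c • vecMulVec (fun i => s i * r i) (fun i => s i * r i)).det
      = (∏ i, s i ^ 2) * (t ^ n * (1 + c / t * ∑ i, r i ^ 2)) := by
  have h0 : t • diagonal (fun i => s i ^ 2) = diagonal (fun i => t * s i ^ 2) := by
    ext i j
    simp [diagonal_apply]
  rw [h0, ← smul_vecMulVec, det_diagonal_add_vecMulVec, Finset.prod_mul_distrib,
    Finset.prod_const, Finset.card_univ, Fintype.card_fin, Finset.mul_sum, mul_add, mul_one,
    mul_add, mul_comm (t ^ n), Finset.mul_sum, Finset.mul_sum]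
  congr 1
  refine Finset.sum_congr rfl fun k _ => ?_
  have h1 : t * s k ^ 2 * ∏ i ∈ Finset.univ.erase k, t * s i ^ 2 = t ^ n * ∏ i, s i ^ 2 := by
    rw [Finset.mul_prod_erase Finset.univ (fun i => t * s i ^ 2) (Finset.mem_univ k),
      Finset.prod_mul_distrib, Finset.prod_const, Finset.card_univ, Fintype.card_fin]
  have h2 := hs k
  have h3 : ∏ i ∈ Finset.univ.erase k, t * s i ^ 2 = t ^ n * (∏ i, s i ^ 2) / (t * s k ^ 2) := by
    rw [← h1]; field_simp
  rw [h3, Pi.smul_apply, smul_eq_mul]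
  field_simp

/-- Taking determinants in `theta_conj` avoids summing the explicit products. The left side is ∏ D
because θ is orthogonal, and the right side depends on r only through ∑ r_j². -/
theorem sum_rvec_sq {x : ℝ} (hx : x ≠ 0) (hn : n ≠ 0) {p : Fin n → ℝ} (hp : Separated x p) :
    ∑ j, rvec x p j ^ 2 = 1 := by
  refine sum_sq_eq_one hx hn ?_
  have h1 := congrArg det (theta_conj hx hp)
  have h2 := congrArg det (theta_mul_transpose hx hp)
  have h3 := det_smul_diagonal_add_vecMulVec (Real.exp (-x)) (rankCoeff n x) (Real.exp_pos _).ne'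
    (fun i => Real.exp (p i)) (rvec x p) fun i => (Real.exp_pos _).ne'
  rw [det_mul, det_mul, det_diagonal, det_transpose] at h1
  rw [det_mul, det_transpose, det_one] at h2
  have h4 : ∏ i, sqExp p i ≠ 0 := Finset.prod_ne_zero_iff.2 fun i _ => (sqExp_pos p i).ne'
  refine mul_left_cancel₀ h4 ?_
  calc (∏ i, sqExp p i) * 1
      = (theta (-x) p).det * (∏ i, sqExp p i) * (theta (-x) p).det := by rw [← h2]; ring
    _ = _ := by rw [h1]; exact h3

/-! ### The rotation taking a basis vector to a given unit vector -/

section Rotation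

/-- The reflection `1 - s⁻¹ w wᵀ`. -/
def reflMat (s : ℝ) (w : Fin n → ℝ) : Matrix (Fin n) (Fin n) ℝ := 1 - s⁻¹ • vecMulVec w w

theorem reflMat_transpose (s : ℝ) (w : Fin n → ℝ) : (reflMat s w)ᵀ = reflMat s w := by
  simp [reflMat, transpose_vecMulVec]

theorem reflMat_mul_self {s : ℝ} (hs : s ≠ 0) {w : Fin n → ℝ} (hw : w ⬝ᵥ w = 2 * s) :
    reflMat s w * reflMat s w = 1 := by
  have h : (s⁻¹ • vecMulVec w w) * (s⁻¹ • vecMulVec w w) = (2 : ℝ) • (s⁻¹ • vecMulVec w w) := by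
    rw [Matrix.smul_mul, Matrix.mul_smul, vecMulVec_mul_vecMulVec, hw, vecMulVec_smul, smul_smul,
      smul_smul, smul_smul]
    congr 1
    field_simp
  rw [reflMat, sub_mul, mul_sub, mul_sub, h, one_mul, mul_one, one_mul, two_smul]
  abel

theorem det_reflMat {s : ℝ} (hs : s ≠ 0) {w : Fin n → ℝ} (hw : w ⬝ᵥ w = 2 * s) :
    (reflMat s w).det = -1 := by
  rw [reflMat, sub_eq_add_neg, ← neg_smul, ← smul_vecMulVec, det_one_add_vecMulVec,
    dotProduct_smul, hw, smul_eq_mul]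
  field_simp
  norm_num

/-- A rotation that maps the basis vector `e_a` to the unit vector `r`. -/
def rotTo (a : Fin n) (r : Fin n → ℝ) : Matrix (Fin n) (Fin n) ℝ :=
  reflMat (1 + r a) (Pi.single a 1 + r) * reflMat 2⁻¹ (Pi.single a 1)

variable {a : Fin n} {r : Fin n → ℝ}

theorem single_dotProduct_self (a : Fin n) :
    (Pi.single a 1 : Fin n → ℝ) ⬝ᵥ Pi.single a 1 = 2 * 2⁻¹ := by
  simp

theorem single_add_dotProduct_self (hr : ∑ j, r j ^ 2 = 1) :
    (Pi.single a 1 + r) ⬝ᵥ (Pi.single a 1 + r) = 2 * (1 + r a) := by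
  have : r ⬝ᵥ r = 1 := by rw [← hr]; simp [dotProduct, pow_two]
  simp [this]
  ring

/-- Both factors are reflections: the right one sends e_a to -e_a, the left one sends -e_a to r. The
condition r_a ≥ 0 keeps the reflecting vector e_a + r nonzero. As a product of two reflections the
matrix has determinant one. -/
theorem rotTo_mul_transpose (hr : ∑ j, r j ^ 2 = 1) (ha : 0 ≤ r a) :
    rotTo a r * (rotTo a r)ᵀ = 1 := by
  have h1 : 1 + r a ≠ 0 := by positivity
  rw [rotTo, transpose_mul, reflMat_transpose, reflMat_transpose, Matrix.mul_assoc,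
    ← Matrix.mul_assoc (reflMat 2⁻¹ _),
    reflMat_mul_self (by norm_num) (single_dotProduct_self a), one_mul,
    reflMat_mul_self h1 (single_add_dotProduct_self hr)]

theorem det_rotTo (hr : ∑ j, r j ^ 2 = 1) (ha : 0 ≤ r a) : (rotTo a r).det = 1 := by
  have h1 : 1 + r a ≠ 0 := by positivity
  rw [rotTo, det_mul, det_reflMat h1 (single_add_dotProduct_self hr),
    det_reflMat (by norm_num) (single_dotProduct_self a)]
  norm_num

theorem rotTo_apply (ha : 0 ≤ r a) (i j : Fin n) : rotTo a r i j =
    if i = a then if j = a then r a else -r j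
    else if j = a then r i else (if i = j then 1 else 0) - r i * r j / (1 + r a) := by
  have h1 : 1 + r a ≠ 0 := by positivity
  rw [rotTo, reflMat, reflMat, mul_sub, mul_one, inv_inv, Matrix.mul_smul, mul_vecMulVec,
    sub_mulVec, one_mulVec, smul_mulVec, vecMulVec_mulVec]
  by_cases hi : i = a <;> by_cases hj : j = a
  all_goals
    simp [hi, hj, Matrix.one_apply, vecMulVec_apply]
  · field_simp
    ring
  · rw [if_neg (Ne.symm hj)]
    field_simp
    ring
  · field_simp
    ring
  · ring

theorem rotTo_mulVec_single (ha : 0 ≤ r a) : rotTo a r *ᵥ Pi.single a 1 = r := by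
  ext i
  rw [mulVec_single_one, col_apply, rotTo_apply ha]
  by_cases hi : i = a <;> simp [hi]

end Rotation

theorem rvec_nonneg (x : ℝ) (p : Fin n → ℝ) (j : Fin n) : 0 ≤ rvec x p j :=
  mul_nonneg (Real.sqrt_nonneg _) (Finset.prod_nonneg fun _ _ => Real.sqrt_nonneg _)

/-- The unit vector `v(x) / √n`. -/
def uvec (n : ℕ) (x : ℝ) (j : Fin n) : ℝ := vvec x j / Real.sqrt n

theorem uvec_nonneg (x : ℝ) (j : Fin n) : 0 ≤ uvec n x j :=
  div_nonneg (mul_nonneg (Real.sqrt_nonneg _) (Real.exp_pos _).le) (Real.sqrt_nonneg _)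

theorem zeta_eq_rotTo [NeZero n] (x : ℝ) (p : Fin n → ℝ) :
    zeta x p = rotTo (pivot n x) (rvec x p) := by
  ext i j
  rw [rotTo_apply (rvec_nonneg _ _ _), zeta]

theorem kappa_eq_rotTo [NeZero n] (x : ℝ) : kappa n x = rotTo (pivot n x) (uvec n x) := by
  ext i j
  have hs : (0 : ℝ) < n := by exact_mod_cast Nat.pos_of_ne_zero (NeZero.ne n)
  have h1 : 0 < Real.sqrt n := Real.sqrt_pos.2 hs
  have h2 := Real.mul_self_sqrt hs.le
  have h3 := uvec_nonneg x (pivot n x)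
  rw [rotTo_apply h3, kappa]
  have h4 : vvec x i * vvec x j / (n + Real.sqrt n * vvec x (pivot n x)) =
      uvec n x i * uvec n x j / (1 + uvec n x (pivot n x)) := by
    have h5 : (n : ℝ) + Real.sqrt n * vvec x (pivot n x) = (Real.sqrt n * Real.sqrt n) *
        (1 + uvec n x (pivot n x)) := by
      rw [uvec, mul_add, mul_one, h2]
      congr 1
      field_simp
      rw [pow_two, h2, mul_comm]
    have h6 : 1 + uvec n x (pivot n x) ≠ 0 := by positivity
    rw [h5]
    simp only [uvec] at h6 ⊢
    field_simp
  rw [h4]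
  rfl

/-! ### νν† as a scalar plus a rank one matrix -/

section Nu

/-- The entries of `ν(x)` for natural number indices. -/
def nuEntry (x : ℝ) (j m : ℕ) : ℝ :=
  if j = m then 1
  else if j < m then (1 - Real.exp (-x)) * Real.exp (((m : ℝ) - (j : ℝ)) * x / 2) else 0

/-- Induction on N starts at N = k + 1, where only m = k contributes because row k vanishes to the
left of the diagonal. Each further term is exactly the increment of the factor e^{Nx}. -/
theorem sum_nuEntry (x : ℝ) {j k N : ℕ} (hjk : j ≤ k) (hN : k + 1 ≤ N) :
    ∑ m ∈ Finset.range N, nuEntry x j m * nuEntry x k m =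
      (if j = k then Real.exp (-x) else 0) +
        Real.exp (N * x) * (1 - Real.exp (-x)) * Real.exp (-x) *
          Real.exp (-(((j : ℝ) + k) * x / 2)) := by
  induction N, hN using Nat.le_induction with
  | base =>
    rw [Finset.sum_range_succ, Finset.sum_eq_zero, zero_add]
    · by_cases h : j = k
      · subst h
        have : Real.exp (((j + 1 : ℕ) : ℝ) * x) * Real.exp (-x) *
            Real.exp (-(((j : ℝ) + j) * x / 2)) = 1 := by
          rw [← Real.exp_add, ← Real.exp_add, Real.exp_eq_one_iff]
          push_cast; ring
        simp only [nuEntry, if_true]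
        linear_combination (-(1 - Real.exp (-x))) * this
      · have hlt : j < k := lt_of_le_of_ne hjk h
        have : Real.exp (((k + 1 : ℕ) : ℝ) * x) * Real.exp (-x) *
            Real.exp (-(((j : ℝ) + k) * x / 2)) = Real.exp (((k : ℝ) - (j : ℝ)) * x / 2) := by
          rw [← Real.exp_add, ← Real.exp_add, Real.exp_eq_exp]
          push_cast; ring
        simp only [nuEntry, if_true, if_neg h, if_pos hlt]
        linear_combination (-(1 - Real.exp (-x))) * this
    · intro m hm
      have hm := Finset.mem_range.1 hm
      have h1 : nuEntry x k m = 0 := by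
        rw [nuEntry, if_neg (by omega), if_neg (by omega)]
      rw [h1, mul_zero]
  | succ N hN ih =>
    have h3 : Real.exp ((N + 1 : ℕ) * x) = Real.exp (N * x) * Real.exp x := by
      rw [← Real.exp_add]; push_cast; ring_nf
    have h4 : ∀ i, i ≤ k →
        nuEntry x i N = (1 - Real.exp (-x)) * Real.exp (((N : ℝ) - (i : ℝ)) * x / 2) := by
      intro i hi
      rw [nuEntry, if_neg (by omega), if_pos (by omega)]
    rw [Finset.sum_range_succ, ih, h4 j hjk, h4 k le_rfl, h3]
    have h1 : Real.exp x * Real.exp (-x) = 1 := by rw [← Real.exp_add]; simp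
    have h2 : Real.exp (((N : ℝ) - j) * x / 2) * Real.exp (((N : ℝ) - k) * x / 2) =
        Real.exp (N * x) * Real.exp (-(((j : ℝ) + k) * x / 2)) := by
      rw [← Real.exp_add, ← Real.exp_add, Real.exp_eq_exp]; ring
    linear_combination (1 - Real.exp (-x)) ^ 2 * h2 -
      Real.exp (N * x) * Real.exp (-(((j : ℝ) + k) * x / 2)) * (1 - Real.exp (-x)) * h1

theorem nu_apply (x : ℝ) (j k : Fin n) : nu n x j k = (nuEntry x j k : ℂ) := by
  rw [nu, nuEntry]
  by_cases h : j = k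
  · simp [h]
  · have h' : (j : ℕ) ≠ k := fun e => h (Fin.ext e)
    rw [if_neg h, if_neg h']
    by_cases h2 : j < k
    · rw [if_pos h2, if_pos (show (j : ℕ) < k from h2)]
    · rw [if_neg h2, if_neg (show ¬ (j : ℕ) < k from h2)]; simp

/-- The normalization of v(x) is such that c yy^T reproduces the closed form in `sum_nuEntry` at N =
n. -/
theorem uvec_mul_uvec {x : ℝ} (hx : x ≠ 0) (j k : Fin n) :
    rankCoeff n x * (uvec n x j * uvec n x k) = Real.exp (n * x) * (1 - Real.exp (-x)) *
      Real.exp (-x) * Real.exp (-(((j : ℕ) + (k : ℕ) : ℝ) * x / 2)) := by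
  have hn : n ≠ 0 := j.pos.ne'
  have hn' : (0 : ℝ) < n := by exact_mod_cast j.pos
  have hq := one_sub_exp_div_pos hx hn
  have hex : Real.exp x * Real.exp (-x) = 1 := by rw [← Real.exp_add]; simp
  have hq2 : (n : ℝ) * (Real.exp x - 1) / (1 - Real.exp (-(n * x))) =
      n * Real.exp x * ((1 - Real.exp (-x)) / (1 - Real.exp (-x) ^ n)) := by
    rw [← Real.exp_nat_mul, mul_neg]
    linear_combination ((n : ℝ) / (1 - Real.exp (-(n * x)))) * hex
  have hs : Real.sqrt (n * (Real.exp x - 1) / (1 - Real.exp (-(n * x)))) ^ 2 =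
      n * Real.exp x * ((1 - Real.exp (-x)) / (1 - Real.exp (-x) ^ n)) := by
    rw [hq2, Real.sq_sqrt]
    have := Real.exp_pos x
    positivity
  have hs2 : Real.sqrt n ^ 2 = n := Real.sq_sqrt hn'.le
  have hc := rankCoeff_mul n x
  have hne : 1 - Real.exp (-x) ^ n ≠ 0 := by
    intro h; rw [h, div_zero] at hq; exact lt_irrefl _ hq
  have he : Real.exp (-(((j : ℕ) + 1 : ℝ) * x / 2)) * Real.exp (-(((k : ℕ) + 1 : ℝ) * x / 2)) =
      Real.exp (-x) * Real.exp (-(((j : ℕ) + (k : ℕ) : ℝ) * x / 2)) := by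
    rw [← Real.exp_add, ← Real.exp_add, Real.exp_eq_exp]; ring
  have hen : Real.exp (n * x) * Real.exp (-x) ^ n = 1 := by
    rw [← Real.exp_nat_mul, ← Real.exp_add]; simp
  have hc' : rankCoeff n x = Real.exp (n * x) * (Real.exp (-x) * (1 - Real.exp (-x) ^ n)) := by
    linear_combination Real.exp (n * x) * hc - rankCoeff n x * hen
  have hu : uvec n x j * uvec n x k =
      Real.exp x * ((1 - Real.exp (-x)) / (1 - Real.exp (-x) ^ n)) *
        (Real.exp (-x) * Real.exp (-(((j : ℕ) + (k : ℕ) : ℝ) * x / 2))) := by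
    rw [← he, uvec, uvec, vvec, vvec, div_mul_div_comm, ← pow_two (Real.sqrt n), hs2,
      mul_mul_mul_comm, ← pow_two (Real.sqrt _), hs]
    field_simp
  rw [hu, hc']
  linear_combination Real.exp (n * x) * Real.exp (-x) * Real.exp x * Real.exp (-x) *
    Real.exp (-(((j : ℕ) + (k : ℕ) : ℝ) * x / 2)) * div_mul_cancel₀ (1 - Real.exp (-x)) hne +
    Real.exp (n * x) * (1 - Real.exp (-x)) * Real.exp (-x) *
      Real.exp (-(((j : ℕ) + (k : ℕ) : ℝ) * x / 2)) * hex

/-- The matrix `ν ν†`, as a real matrix. -/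
def nuSq (n : ℕ) (x : ℝ) : Matrix (Fin n) (Fin n) ℝ :=
  Real.exp (-x) • 1 + rankCoeff n x • vecMulVec (uvec n x) (uvec n x)

theorem nu_mul_conjTranspose {x : ℝ} (hx : x ≠ 0) :
    nu n x * (nu n x)ᴴ = (nuSq n x).map Complex.ofReal := by
  ext j k
  have hsum : (nu n x * (nu n x)ᴴ) j k =
      ((∑ m ∈ Finset.range n, nuEntry x j m * nuEntry x k m : ℝ) : ℂ) := by
    rw [Finset.sum_range, Matrix.mul_apply, Complex.ofReal_sum]
    refine Finset.sum_congr rfl fun m _ => ?_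
    rw [conjTranspose_apply, nu_apply, nu_apply]
    simp
  have hval : ∑ m ∈ Finset.range n, nuEntry x j m * nuEntry x k m = nuSq n x j k := by
    have hu := uvec_mul_uvec hx j k
    rw [nuSq, Matrix.add_apply, Matrix.smul_apply, Matrix.smul_apply, vecMulVec_apply, smul_eq_mul,
      smul_eq_mul, hu, Matrix.one_apply]
    rcases le_total (j : ℕ) k with h | h
    · rw [sum_nuEntry x h (by omega)]
      simp [Fin.ext_iff]
    · rw [Finset.sum_congr rfl fun m _ => mul_comm _ _, sum_nuEntry x h (by omega)]
      simp [Fin.ext_iff, eq_comm, add_comm]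
  rw [hsum, hval, map_apply]

theorem det_nu (n : ℕ) (x : ℝ) : (nu n x).det = 1 := by
  rw [det_of_isUpperTriangular]
  · simp [nu]
  · intro i j hij
    have hij : j < i := hij
    simp [nu, hij.ne', hij.not_gt]

/-- The same determinant argument as for r: ν is unipotent, so det νν† = 1, and this fixes |y|². -/
theorem sum_uvec_sq {x : ℝ} (hx : x ≠ 0) (hn : n ≠ 0) : ∑ j, uvec n x j ^ 2 = 1 := by
  refine sum_sq_eq_one hx hn ?_
  have h1 := congrArg det (nu_mul_conjTranspose (n := n) hx)
  have h0 : ((nuSq n x).det : ℂ) = ((nuSq n x).map Complex.ofReal).det :=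
    Complex.ofRealHom.map_det _
  rw [det_mul, det_conjTranspose, det_nu, ← h0] at h1
  have h2 : (nuSq n x).det = 1 := by
    have : ((nuSq n x).det : ℂ) = 1 := by simpa using h1.symm
    exact_mod_cast this
  have h3 := det_smul_diagonal_add_vecMulVec (Real.exp (-x)) (rankCoeff n x) (Real.exp_pos _).ne'
    (fun _ => 1) (uvec n x) fun i => one_ne_zero
  simp only [one_pow, one_mul, Finset.prod_const_one, diagonal_one] at h3
  rw [← h3, ← h2]
  rfl

end Nu

/-! ### Block factorizations and the left momentum condition -/

/-- `n × n` complex matrices. -/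
abbrev Mat (n : ℕ) := Matrix (Fin n) (Fin n) ℂ

/-- `2n × 2n` complex matrices. -/
abbrev Mat2 (n : ℕ) := Matrix (Fin n ⊕ Fin n) (Fin n ⊕ Fin n) ℂ

/-- The complex diagonal matrix with the given real diagonal. -/
def rdiag (s : Fin n → ℝ) : Mat n := diagonal fun k => (s k : ℂ)

theorem rdiag_conjTranspose (s : Fin n → ℝ) : (rdiag s)ᴴ = rdiag s := by
  rw [rdiag, diagonal_conjTranspose]
  congr 1
  ext k
  simp

theorem rdiag_mul_rdiag (s t : Fin n → ℝ) : rdiag s * rdiag t = rdiag fun k => s k * t k := by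
  simp [rdiag, diagonal_mul_diagonal]

theorem rdiag_one : rdiag (fun _ : Fin n => (1 : ℝ)) = 1 := by simp [rdiag]

theorem rdiag_inv_mul {s : Fin n → ℝ} (hs : ∀ k, s k ≠ 0) : rdiag (fun k => (s k)⁻¹) * rdiag s = 1 := by
  rw [rdiag_mul_rdiag, ← rdiag_one]
  congr 1
  ext k
  exact inv_mul_cancel₀ (hs k)

theorem rdiag_mul_inv {s : Fin n → ℝ} (hs : ∀ k, s k ≠ 0) : rdiag s * rdiag (fun k => (s k)⁻¹) = 1 :=
  mul_eq_one_comm.1 (rdiag_inv_mul hs)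

/-- The matrix with blocks `cos`, `i sin`. -/
def rotBlock (s c : Fin n → ℝ) : Mat2 n :=
  fromBlocks (rdiag c) (Complex.I • rdiag s) (Complex.I • rdiag s) (rdiag c)

theorem rotBlock_unitary {s c : Fin n → ℝ} (h : ∀ k, s k ^ 2 + c k ^ 2 = 1) :
    rotBlock s c * (rotBlock s c)ᴴ = 1 := by
  have h1 : rdiag s * rdiag s + rdiag c * rdiag c = 1 := by
    rw [rdiag_mul_rdiag, rdiag_mul_rdiag, rdiag, rdiag, diagonal_add, ← diagonal_one]
    congr 1
    ext k
    rw [← Complex.ofReal_add, show s k * s k + c k * c k = 1 by rw [← h k]; ring,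
      Complex.ofReal_one]
  have h2 : rdiag s * rdiag c = rdiag c * rdiag s := by
    rw [rdiag_mul_rdiag, rdiag_mul_rdiag]; congr 1; ext k; ring
  have h3 : ∀ M : Mat n, (Complex.I • M)ᴴ = -(Complex.I • Mᴴ) := fun M => by
    rw [conjTranspose_smul]; simp
  rw [rotBlock, fromBlocks_conjTranspose, fromBlocks_multiply, ← fromBlocks_one, h3,
    rdiag_conjTranspose, rdiag_conjTranspose]
  simp only [Matrix.mul_neg, Matrix.smul_mul, Matrix.mul_smul, smul_smul, Complex.I_mul_I, neg_smul,
    one_smul, neg_neg, h2]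
  rw [add_comm (rdiag c * rdiag c), h1, neg_add_cancel, add_neg_cancel]

/-- Block upper triangular matrices with scalar (inverse) diagonal blocks. -/
def triR (v : ℝ) (α : Mat n) : Mat2 n :=
  fromBlocks ((Real.exp (-v) : ℂ) • 1) α 0 ((Real.exp v : ℂ) • 1)

/-- Block upper triangular matrices with diagonal blocks `e^u P` and `e^{-u}`. -/
def triL (u : ℝ) (P β : Mat n) : Mat2 n :=
  fromBlocks ((Real.exp u : ℂ) • P) β 0 ((Real.exp (-u) : ℂ) • 1)

theorem cexp_mul_cexp_neg (v : ℝ) : (Real.exp v : ℂ) * (Real.exp (-v) : ℂ) = 1 := by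
  rw [← Complex.ofReal_mul, ← Real.exp_add]; simp

/-- An explicit factorization into block triangular times unitary. The lower block row of the left
side is (i e^{-v} s, lT); rescaled by e^u it is the lower row of the unitary on the right. The
relation for l makes the new sines and cosines satisfy s² + c² = 1. The upper row then dictates the
triangular factor. -/
theorem rotBlock_mul_triR {u v : ℝ} {s c l : Fin n → ℝ} (hs : ∀ k, s k ≠ 0)
    (hsc : ∀ k, s k ^ 2 + c k ^ 2 = 1)
    (hl : ∀ k, l k ^ 2 = Real.exp (-2 * u) - Real.exp (-2 * v) * s k ^ 2) {T α : Mat n}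
    (hT : Tᴴ * T = 1)
    (hα : Complex.I • rdiag s * α + (Real.exp v : ℂ) • rdiag c = rdiag l * T) :
    rotBlock s c * triR v α =
      triL u (rdiag (fun k => (s k)⁻¹) * Tᴴ * rdiag s)
        (-Complex.I • ((Real.exp (-u) : ℂ) • rdiag (fun k => (s k)⁻¹ * c k) -
          (Real.exp (u + v) : ℂ) • (rdiag (fun k => (s k)⁻¹) * Tᴴ * rdiag l))) *
      (rotBlock (fun k => Real.exp (u - v) * s k) (fun k => Real.exp u * l k) *
        fromBlocks 1 0 0 T) := by
  have hs' : ∀ k, (s k : ℂ) ≠ 0 := fun k => by exact_mod_cast hs k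
  have hI : Complex.I ^ 2 = -1 := Complex.I_sq
  have e1 : (Real.exp (u - v) : ℂ) = Real.exp u * Real.exp (-v) := by
    rw [← Complex.ofReal_mul, ← Real.exp_add, sub_eq_add_neg]
  have e2 : (Real.exp (u + v) : ℂ) = Real.exp u * Real.exp v := by
    rw [← Complex.ofReal_mul, ← Real.exp_add]
  have e3 := cexp_mul_cexp_neg u
  have e4 := cexp_mul_cexp_neg v
  -- The identity e^{2u-v} s² + e^{2u+v} l² = e^v, conjugated by T; it is what the upper right block
  -- needs.
  have hQ : (Real.exp u * Real.exp u * Real.exp (-v) : ℂ) • (Tᴴ * rdiag (fun k => s k ^ 2) * T) +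
      (Real.exp u * Real.exp v * Real.exp u : ℂ) • (Tᴴ * rdiag (fun k => l k ^ 2) * T) =
      (Real.exp v : ℂ) • (1 : Mat n) := by
    have h : ∀ (a : ℂ) (f : Fin n → ℝ), a • (Tᴴ * rdiag f * T) = Tᴴ * (a • rdiag f) * T := by
      intro a f; rw [Matrix.mul_smul, Matrix.smul_mul]
    rw [h, h, ← Matrix.add_mul, ← Matrix.mul_add]
    suffices hX : (Real.exp u * Real.exp u * Real.exp (-v) : ℂ) • rdiag (fun k => s k ^ 2) +
        (Real.exp u * Real.exp v * Real.exp u : ℂ) • rdiag (fun k => l k ^ 2) =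
        (Real.exp v : ℂ) • (1 : Mat n) by
      rw [hX, Matrix.mul_smul, Matrix.smul_mul, Matrix.mul_one, hT]
    ext i j
    by_cases hij : i = j
    · subst hij
      have h1 : (l i : ℂ) ^ 2 = Real.exp (-u) ^ 2 - Real.exp (-v) ^ 2 * s i ^ 2 := by
        have h2 : ∀ w : ℝ, Real.exp (-2 * w) = Real.exp (-w) ^ 2 := fun w => by
          rw [← Real.exp_nat_mul]; congr 1; push_cast; ring
        rw [← Complex.ofReal_pow, hl, h2, h2, Complex.ofReal_sub, Complex.ofReal_mul,
          Complex.ofReal_pow, Complex.ofReal_pow, Complex.ofReal_pow]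
      simp only [rdiag, Matrix.add_apply, Matrix.smul_apply, diagonal_apply_eq, smul_eq_mul,
        Matrix.one_apply_eq, Complex.ofReal_pow, h1]
      linear_combination (Real.exp v : ℂ) * ((Real.exp u : ℂ) * Real.exp (-u) + 1) * e3 -
        (Real.exp u : ℂ) ^ 2 * Real.exp (-v) * s i ^ 2 * e4
    · simp [rdiag, hij]
  have hα' : ∀ i j, Complex.I * s i * α i j = l i * T i j - Real.exp v * rdiag c i j := by
    intro i j
    have := congrFun (congrFun hα i) j
    simp only [rdiag, Matrix.smul_mul, Matrix.add_apply, Matrix.smul_apply, diagonal_mul,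
      smul_eq_mul] at this
    rw [rdiag]
    linear_combination this
  have hsm : ∀ (a : ℝ) (f : Fin n → ℝ), rdiag (fun k => a * f k) = (a : ℂ) • rdiag f := by
    intro a f
    ext i j
    simp [rdiag, diagonal_apply]
  have h2 : ∀ f : Fin n → ℝ, (rdiag fun k => f k ^ 2) = rdiag f * rdiag f := by
    intro f; rw [rdiag_mul_rdiag]; congr 1; ext k; ring
  rw [h2, h2] at hQ
  have hls : rdiag s * rdiag l = rdiag l * rdiag s := by
    rw [rdiag_mul_rdiag, rdiag_mul_rdiag]; congr 1; ext k; ring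
  rw [rotBlock, rotBlock, triR, triL, fromBlocks_multiply, fromBlocks_multiply,
    fromBlocks_multiply, fromBlocks_inj, hsm, hsm]
  simp only [Matrix.mul_zero, Matrix.mul_one, Matrix.zero_mul, add_zero, zero_add, Matrix.mul_smul,
    Matrix.smul_mul, Matrix.one_mul, smul_smul]
  refine ⟨?_, ?_, ?_, ?_⟩
  · have h4 : rdiag (fun k => (s k)⁻¹) * Tᴴ * rdiag l * rdiag s =
        rdiag (fun k => (s k)⁻¹) * Tᴴ * rdiag s * rdiag l := by
      rw [Matrix.mul_assoc _ (rdiag s), hls, Matrix.mul_assoc _ (rdiag l)]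
    have h5 : rdiag (fun k => (s k)⁻¹ * c k) * rdiag s = rdiag c := by
      rw [rdiag_mul_rdiag]; congr 1; ext k; have := hs k; field_simp
    simp only [Matrix.sub_mul, Matrix.smul_mul, h4, h5, smul_sub, smul_smul, e1, e2]
    generalize (Real.exp u : ℂ) = U at e3 e4 ⊢
    generalize (Real.exp (-u) : ℂ) = U' at e3 e4 ⊢
    generalize (Real.exp v : ℂ) = V at e3 e4 ⊢
    generalize (Real.exp (-v) : ℂ) = V' at e3 e4 ⊢
    match_scalars
    · linear_combination U * U' * V' * hI - V' * e3
    · linear_combination -(U ^ 2 * V * V') * hI + U ^ 2 * e4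
  · have h6 : rdiag (fun k => (s k)⁻¹) * Tᴴ * rdiag s * (rdiag s * T) =
        rdiag (fun k => (s k)⁻¹) * (Tᴴ * (rdiag s * rdiag s) * T) := by
      simp only [Matrix.mul_assoc]
    have h7 : rdiag (fun k => (s k)⁻¹) * Tᴴ * rdiag l * (rdiag l * T) =
        rdiag (fun k => (s k)⁻¹) * (Tᴴ * (rdiag l * rdiag l) * T) := by
      simp only [Matrix.mul_assoc]
    simp only [Matrix.sub_mul, Matrix.smul_mul, h6, h7, smul_sub, smul_smul, e1, e2]
    set Q1 := Tᴴ * (rdiag s * rdiag s) * T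
    set Q2 := Tᴴ * (rdiag l * rdiag l) * T
    ext i j
    have hq := congrFun (congrFun hQ i) j
    have ha := hα' i j
    have hsc' : (s i : ℂ) ^ 2 + (c i : ℂ) ^ 2 = 1 := by exact_mod_cast hsc i
    have hsi := hs' i
    have hd : ∀ f : Fin n → ℝ, rdiag f i j = f i * (1 : Mat n) i j := fun f => by
      simp [rdiag, diagonal_apply, Matrix.one_apply]
    have hm : ∀ (f : Fin n → ℝ) (M : Mat n), (rdiag f * M) i j = f i * M i j := fun f M => by
      rw [rdiag, diagonal_mul]
    rw [hd] at ha
    simp only [Matrix.add_apply, Matrix.sub_apply, Matrix.smul_apply, smul_eq_mul, hm, hd,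
      Complex.ofReal_inv, Complex.ofReal_mul] at hq ⊢
    generalize (Real.exp u : ℂ) = U at e3 e4 hq ha ⊢
    generalize (Real.exp (-u) : ℂ) = U' at e3 e4 hq ha ⊢
    generalize (Real.exp v : ℂ) = V at e3 e4 hq ha ⊢
    generalize (Real.exp (-v) : ℂ) = V' at e3 e4 hq ha ⊢
    generalize (1 : Mat n) i j = δ at *
    rw [← sub_eq_zero]
    refine mul_left_cancel₀ hsi ?_
    have hinv : (s i : ℂ) * (s i : ℂ)⁻¹ = 1 := mul_inv_cancel₀ hsi
    linear_combination (-Complex.I * c i) * ha + c i * s i * α i j * hI +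
      Complex.I * V * δ * hsc' - Complex.I * hq + Complex.I * c i * l i * T i j * e3 +
      (-(Complex.I * U * V' * U * Q1 i j) + U * Complex.I * U' * c i * (l i * T i j) -
        U * Complex.I * U * V * Q2 i j) * hinv
  · rw [e1, smul_zero, zero_add]
    congr 1
    linear_combination (-Complex.I * Real.exp (-v)) * e3
  · rw [e3, smul_zero, zero_add, one_smul, ← hα, Matrix.smul_mul]

/-- The `(1,1)` block of a matrix of the form `triL u P β * H` determines `P Pᴴ`. -/
theorem triL_mul_eq {u : ℝ} {P P' β β' : Mat n} {H H' : Mat2 n} (hH : H * Hᴴ = 1)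
    (hH' : H' * H'ᴴ = 1) (h : triL u P β * H = triL u P' β' * H') : P * Pᴴ = P' * P'ᴴ := by
  have h1 : triL u P β * (triL u P β)ᴴ = triL u P' β' * (triL u P' β')ᴴ := by
    calc _ = (triL u P β * H) * (triL u P β * H)ᴴ := by
          rw [conjTranspose_mul, Matrix.mul_assoc, ← Matrix.mul_assoc H, hH, Matrix.one_mul]
      _ = _ := by
          rw [h, conjTranspose_mul, Matrix.mul_assoc, ← Matrix.mul_assoc H', hH', Matrix.one_mul]
  have hu : (Real.exp u : ℂ) ≠ 0 := by exact_mod_cast (Real.exp_pos u).ne'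
  simp only [triL, fromBlocks_conjTranspose, fromBlocks_multiply, fromBlocks_inj,
    conjTranspose_smul, conjTranspose_one, conjTranspose_zero, Matrix.mul_zero, Matrix.smul_mul,
    Matrix.mul_smul, Matrix.mul_one, zero_add] at h1
  obtain ⟨h11, h12, -, -⟩ := h1
  -- The lower right block is the same nonzero scalar on both sides, so the off-diagonal block of
  -- bb† already determines β; subtracting ββ† from the upper left block then isolates PP†.
  have hβ : β = β' := by
    have : (star (Real.exp (-u) : ℂ)) ≠ 0 := by simp
    exact smul_right_injective _ this h12
  subst hβ
  have h3 := add_right_cancel h11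
  have : (star (Real.exp u : ℂ)) ≠ 0 := by simp
  exact smul_right_injective _ this (smul_right_injective _ hu (by simpa only [smul_smul, mul_comm] using h3))

theorem fromBlocks_unitary {U V : Mat n} (hU : U * Uᴴ = 1) (hV : V * Vᴴ = 1) :
    fromBlocks U 0 0 V * (fromBlocks U 0 0 V)ᴴ = 1 := by
  rw [fromBlocks_conjTranspose, fromBlocks_multiply, ← fromBlocks_one]
  simp [hU, hV]

theorem mul_unitary {m : Type*} [Fintype m] [DecidableEq m] {A B : Matrix m m ℂ}
    (hA : A * Aᴴ = 1) (hB : B * Bᴴ = 1) : A * B * (A * B)ᴴ = 1 := by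
  rw [conjTranspose_mul, Matrix.mul_assoc, ← Matrix.mul_assoc B, hB, Matrix.one_mul, hA]

theorem conjTranspose_unitary {m : Type*} [Fintype m] [DecidableEq m] {A : Matrix m m ℂ}
    (hA : A * Aᴴ = 1) : Aᴴ * Aᴴᴴ = 1 := by
  rw [conjTranspose_conjTranspose]; exact mul_eq_one_comm.1 hA

theorem triL_eq_mul (u : ℝ) (P W β : Mat n) :
    triL u (P * W) β = triL u P β * fromBlocks W 0 0 1 := by
  rw [triL, triL, fromBlocks_multiply]
  simp

/-- The condition on the left momentum, in terms of `T`. -/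
theorem exists_triL_iff {u v : ℝ} {s c l : Fin n → ℝ} (hs : ∀ k, s k ≠ 0)
    (hsc : ∀ k, s k ^ 2 + c k ^ 2 = 1)
    (hl : ∀ k, l k ^ 2 = Real.exp (-2 * u) - Real.exp (-2 * v) * s k ^ 2) {T α ρ ν : Mat n}
    (hT : T * Tᴴ = 1) (hρ : ρ * ρᴴ = 1)
    (hα : Complex.I • rdiag s * α + (Real.exp v : ℂ) • rdiag c = rdiag l * T) :
    (∃ β H, H * Hᴴ = 1 ∧ fromBlocks ρ 0 0 1 * (rotBlock s c * triR v α) = triL u ν β * H) ↔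
      Tᴴ * rdiag (fun k => s k ^ 2) * T = rdiag s * (ρᴴ * (ν * νᴴ) * ρ) * rdiag s := by
  have hT' : Tᴴ * T = 1 := mul_eq_one_comm.1 hT
  have hρ' : ρᴴ * ρ = 1 := mul_eq_one_comm.1 hρ
  set P : Mat n := ρ * (rdiag (fun k => (s k)⁻¹) * Tᴴ * rdiag s) with hP
  have key := rotBlock_mul_triR hs hsc hl hT' hα
  set β₀ := -Complex.I • ((Real.exp (-u) : ℂ) • rdiag (fun k => (s k)⁻¹ * c k) -
          (Real.exp (u + v) : ℂ) • (rdiag (fun k => (s k)⁻¹) * Tᴴ * rdiag l))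
  set H₀ := rotBlock (fun k => Real.exp (u - v) * s k) (fun k => Real.exp u * l k) *
        fromBlocks 1 0 0 T
  have hH₀ : H₀ * H₀ᴴ = 1 := by
    refine mul_unitary (rotBlock_unitary fun k => ?_) (fromBlocks_unitary (by simp) hT)
    rw [mul_pow, mul_pow, hl, mul_sub, ← mul_assoc (Real.exp u ^ 2), ← Real.exp_nat_mul,
      ← Real.exp_nat_mul, ← Real.exp_add, ← Real.exp_add]
    have h1 : ((2 : ℕ) : ℝ) * (u - v) = ((2 : ℕ) : ℝ) * u + -2 * v := by push_cast; ring
    have h2 : ((2 : ℕ) : ℝ) * u + -2 * u = 0 := by push_cast; ring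
    rw [h1, h2, Real.exp_zero]
    ring
  have hK : fromBlocks ρ 0 0 1 * (rotBlock s c * triR v α) = triL u P (ρ * β₀) * H₀ := by
    rw [key, ← Matrix.mul_assoc]
    congr 1
    rw [triL, triL, fromBlocks_multiply]
    simp [hP]
  have hPP : P * Pᴴ = ν * νᴴ ↔
      Tᴴ * rdiag (fun k => s k ^ 2) * T = rdiag s * (ρᴴ * (ν * νᴴ) * ρ) * rdiag s := by
    have h2 : (rdiag fun k => s k ^ 2) = rdiag s * rdiag s := by
      rw [rdiag_mul_rdiag]; congr 1; ext k; ring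
    have h3 : P * Pᴴ = ρ * (rdiag (fun k => (s k)⁻¹) * (Tᴴ * rdiag (fun k => s k ^ 2) * T) *
        rdiag (fun k => (s k)⁻¹)) * ρᴴ := by
      rw [hP, h2]
      simp only [conjTranspose_mul, rdiag_conjTranspose, conjTranspose_conjTranspose,
        Matrix.mul_assoc]
    have h4 := rdiag_inv_mul hs
    have h5 := rdiag_mul_inv hs
    rw [h3]
    generalize rdiag (fun k => (s k)⁻¹) = Si at *
    generalize rdiag s = S at *
    generalize Tᴴ * rdiag (fun k => s k ^ 2) * T = M at *
    generalize ν * νᴴ = N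
    constructor
    · rintro rfl
      calc M = (S * Si) * M * (Si * S) := by rw [h4, h5]; simp
        _ = S * (Si * M * Si) * S := by simp only [Matrix.mul_assoc]
        _ = S * ((ρᴴ * ρ) * (Si * M * Si) * (ρᴴ * ρ)) * S := by rw [hρ']; simp
        _ = _ := by simp only [Matrix.mul_assoc]
    · rintro rfl
      calc _ = ρ * ((Si * S) * (ρᴴ * N * ρ) * (S * Si)) * ρᴴ := by simp only [Matrix.mul_assoc]
        _ = (ρ * ρᴴ) * N * (ρ * ρᴴ) := by rw [h4, h5]; simp [Matrix.mul_assoc]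
        _ = N := by rw [hρ]; simp
  rw [← hPP]
  constructor
  · rintro ⟨β, H, hH, h⟩
    exact triL_mul_eq hH₀ hH (hK.symm.trans h)
  · intro h
    -- Q is P⁻¹. From PP† = νν† it follows that P⁻¹ν is unitary, so replacing P by ν only moves the
    -- block matrix diag(P⁻¹ν, 1) into the unitary factor.
    set Q : Mat n := rdiag (fun k => (s k)⁻¹) * T * rdiag s * ρᴴ with hQ
    have hQP : Q * P = 1 := by
      rw [hQ, hP]
      calc _ = rdiag (fun k => (s k)⁻¹) * (T * (rdiag s * (ρᴴ * ρ) * rdiag (fun k => (s k)⁻¹)) *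
            Tᴴ) * rdiag s := by simp only [Matrix.mul_assoc]
        _ = 1 := by
          rw [hρ', Matrix.mul_one, rdiag_mul_inv hs, Matrix.mul_one, hT, Matrix.mul_one,
            rdiag_inv_mul hs]
    have hPQ : P * Q = 1 := mul_eq_one_comm.1 hQP
    clear_value P Q
    have hW : (Q * ν) * (Q * ν)ᴴ = 1 := by
      rw [conjTranspose_mul]
      calc _ = Q * (ν * νᴴ) * Qᴴ := by simp only [Matrix.mul_assoc]
        _ = (Q * P) * (Q * P)ᴴ := by
          rw [← h, conjTranspose_mul]; simp only [Matrix.mul_assoc]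
        _ = 1 := by rw [hQP]; simp
    have hW' := fromBlocks_unitary hW (V := (1 : Mat n)) (by simp)
    refine ⟨ρ * β₀, (fromBlocks (Q * ν) 0 0 1)ᴴ * H₀,
      mul_unitary (conjTranspose_unitary hW') hH₀, ?_⟩
    have hν : P * (Q * ν) = ν := by rw [← Matrix.mul_assoc, hPQ, Matrix.one_mul]
    have h6 := triL_eq_mul u P (Q * ν) (ρ * β₀)
    rw [hν] at h6
    rw [hK, h6, Matrix.mul_assoc (triL u P _), ← Matrix.mul_assoc (fromBlocks _ _ _ _) _ H₀, hW',
      Matrix.one_mul]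

/-! ### The constraint surface in block form -/

theorem mem_SU2n_iff {g : SL2n n} : g ∈ SU2n n ↔ g.1 * (g.1)ᴴ = 1 := mem_unitaryGroup_iff

theorem triR_eq_inv (v : ℝ) (γ : Mat n) :
    triR v (-γ) * fromBlocks ((Real.exp v : ℂ) • 1) γ 0 ((Real.exp (-v) : ℂ) • 1) = 1 := by
  have h := cexp_mul_cexp_neg v
  have h' := (mul_comm _ _).trans h
  rw [triR, fromBlocks_multiply, ← fromBlocks_one, fromBlocks_inj]
  simp only [Matrix.mul_zero, Matrix.zero_mul, add_zero, zero_add, Matrix.mul_smul,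
    Matrix.smul_mul, Matrix.one_mul, Matrix.mul_one, smul_smul, h, h', one_smul, smul_neg,
    add_neg_cancel, smul_zero, and_self]

theorem det_smul_smul (v : ℝ) (P : Mat n) (hP : P.det = 1) :
    ((Real.exp v : ℂ) • P).det * ((Real.exp (-v) : ℂ) • (1 : Mat n)).det = 1 := by
  rw [det_smul, det_smul, hP, det_one, mul_one, mul_one, ← mul_pow, cexp_mul_cexp_neg, one_pow]

theorem det_triL (u : ℝ) {P : Mat n} (hP : P.det = 1) (β : Mat n) : (triL u P β).det = 1 := by
  rw [triL, det_fromBlocks_zero₂₁, det_smul_smul u P hP]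

theorem det_triR (v : ℝ) (α : Mat n) : (triR v α).det = 1 := by
  have := det_smul_smul (n := n) (-v) 1 det_one
  rw [neg_neg] at this
  rw [triR, det_fromBlocks_zero₂₁, this]

theorem mem_SB2n_of_blocks {b : SL2n n} {P Q β : Mat n} (hb : b.1 = fromBlocks P β 0 Q)
    (hP : P.BlockTriangular id) (hQ : Q.BlockTriangular id)
    (hP' : ∀ i, 0 < (P i i).re ∧ (P i i).im = 0) (hQ' : ∀ i, 0 < (Q i i).re ∧ (Q i i).im = 0) :
    b ∈ SB2n n := by
  refine ⟨?_, ?_⟩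
  · rw [hb]
    rintro (i | i) (j | j) hij
    · exact hP (by simpa using hij)
    · simp at hij
    · rfl
    · exact hQ (by simpa using hij)
  · rw [hb]
    rintro (i | i)
    · exact hP' i
    · exact hQ' i

theorem blockTriangular_smul_one (a : ℂ) : (a • (1 : Mat n)).BlockTriangular id := by
  intro i j hij
  have hij : j < i := hij
  simp [hij.ne']

theorem smul_one_diag_pos (v : ℝ) (i : Fin n) :
    0 < (((Real.exp v : ℂ) • (1 : Mat n)) i i).re ∧ (((Real.exp v : ℂ) • (1 : Mat n)) i i).im = 0 := by
  rw [Matrix.smul_apply, Matrix.one_apply_eq, smul_eq_mul, mul_one, Complex.ofReal_re,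
    Complex.ofReal_im]
  exact ⟨Real.exp_pos _, rfl⟩

theorem eq_fromBlocks_of_mem_SB2n {b : SL2n n} (hb : b ∈ SB2n n) {P Q : Mat n}
    (h : blockProj b.1 = fromBlocks P 0 0 Q) : b.1 = fromBlocks P b.1.toBlocks₁₂ 0 Q := by
  rw [blockProj, fromBlocks_inj] at h
  have h21 : b.1.toBlocks₂₁ = 0 := by
    ext i j
    exact hb.1 (by simp)
  conv_lhs => rw [← fromBlocks_toBlocks b.1, h.1, h.2.2.2, h21]

/-- Prescribing the diagonal blocks of b_L and b_R leaves only their upper right blocks free.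
Conversely, membership in SB(2n) and all determinants are automatic for these blocks, so only
unitarity of the other factors has to be required. -/
theorem mem_constraintSurface_iff {u v x : ℝ} {K : SL2n n} :
    K ∈ constraintSurface n u v x ↔ ∃ G α H β, G * Gᴴ = 1 ∧ H * Hᴴ = 1 ∧
      K.1 = G * triR v α ∧ K.1 = triL u (nu n x) β * H := by
  constructor
  · rintro ⟨gL, hgL, gR, hgR, bL, hbL, bR, hbR, h1, h2, h3, h4⟩
    have hL := eq_fromBlocks_of_mem_SB2n hbL h3
    have hR := eq_fromBlocks_of_mem_SB2n hbR h4
    refine ⟨gL.1, -bR.1.toBlocks₁₂, (gR⁻¹ : SL2n n).1, bL.1.toBlocks₁₂, mem_SU2n_iff.1 hgL, ?_, ?_, ?_⟩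
    · rw [coe_inv_of_unitary hgR]
      exact conjTranspose_unitary (mem_SU2n_iff.1 hgR)
    · have h5 : (bR⁻¹ : SL2n n).1 = triR v (-bR.1.toBlocks₁₂) := by
        have h6 : bR.1 * (bR⁻¹ : SL2n n).1 = 1 := congrArg Subtype.val (mul_inv_cancel bR)
        have h7 := triR_eq_inv v bR.1.toBlocks₁₂
        rw [← hR] at h7
        exact (left_inv_eq_right_inv h7 h6).symm
      rw [← h5, h1]
      rfl
    · rw [triL, ← hL, h2]
      rfl
  · rintro ⟨G, α, H, β, hG, hH, h1, h2⟩
    have hR := triR_eq_inv v (-α)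
    rw [neg_neg] at hR
    have hRdet : (fromBlocks ((Real.exp v : ℂ) • 1) (-α) 0 ((Real.exp (-v) : ℂ) • 1) : Mat2 n).det
        = 1 := by
      rw [det_fromBlocks_zero₂₁, det_smul_smul v 1 det_one]
    set bL : SL2n n := ⟨triL u (nu n x) β, det_triL u (det_nu n x) β⟩ with hbL
    set bR : SL2n n := ⟨_, hRdet⟩ with hbR
    have hgL : (K * bR).1 = G := by
      change K.1 * bR.1 = G
      rw [h1, Matrix.mul_assoc, hbR, hR, Matrix.mul_one]
    have hh : (bL⁻¹ * K).1 = H := by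
      change (bL⁻¹ : SL2n n).1 * K.1 = H
      have h6 : (bL⁻¹ : SL2n n).1 * bL.1 = 1 := congrArg Subtype.val (inv_mul_cancel bL)
      rw [h2, ← Matrix.mul_assoc]
      change (bL⁻¹ : SL2n n).1 * bL.1 * H = H
      rw [h6, Matrix.one_mul]
    have hhu : bL⁻¹ * K ∈ SU2n n := mem_SU2n_iff.2 (by rw [hh]; exact hH)
    refine ⟨K * bR, mem_SU2n_iff.2 (by rw [hgL]; exact hG), (bL⁻¹ * K)⁻¹, ?_, bL, ?_, bR, ?_,
      by group, by group, ?_, ?_⟩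
    · rw [mem_SU2n_iff, coe_inv_of_unitary hhu, hh]
      exact conjTranspose_unitary hH
    · refine mem_SB2n_of_blocks (b := bL) (P := (Real.exp u : ℂ) • nu n x) rfl ?_
        (blockTriangular_smul_one _) (fun i => ?_) (smul_one_diag_pos _)
      · intro i j hij
        have hij : j < i := hij
        simp [nu, hij.ne', hij.not_gt]
      · have := smul_one_diag_pos u i
        simpa [nu] using this
    · exact mem_SB2n_of_blocks (b := bR) rfl (blockTriangular_smul_one _)
        (blockTriangular_smul_one _) (smul_one_diag_pos _) (smul_one_diag_pos _)
    · simp [hbL, triL, blockProj, muL]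
    · simp [hbR, blockProj, muR]

/-! ### Complexification of the real identities -/

/-- A real matrix, viewed as a complex one. -/
def toC (M : Matrix (Fin n) (Fin n) ℝ) : Mat n := M.map Complex.ofReal

theorem toC_mul (M N : Matrix (Fin n) (Fin n) ℝ) : toC (M * N) = toC M * toC N :=
  Matrix.map_mul (f := Complex.ofRealHom)

theorem toC_one : toC (1 : Matrix (Fin n) (Fin n) ℝ) = 1 := by
  rw [toC, Matrix.map_one _ Complex.ofReal_zero Complex.ofReal_one]

theorem toC_transpose (M : Matrix (Fin n) (Fin n) ℝ) : toC Mᵀ = (toC M)ᴴ := by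
  ext i j; simp [toC]

theorem toC_diagonal (s : Fin n → ℝ) : toC (diagonal s) = rdiag s := by
  rw [toC, diagonal_map Complex.ofReal_zero]; rfl

theorem det_toC (M : Matrix (Fin n) (Fin n) ℝ) : (toC M).det = (M.det : ℂ) :=
  (Complex.ofRealHom.map_det M).symm

theorem toC_unitary {M : Matrix (Fin n) (Fin n) ℝ} (h : M * Mᵀ = 1) : toC M * (toC M)ᴴ = 1 := by
  rw [← toC_transpose, ← toC_mul, h, toC_one]

/-- The vector `v(x) / √n` as a complex vector. -/
def uC (n : ℕ) (x : ℝ) (j : Fin n) : ℂ := (uvec n x j : ℂ)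

theorem star_uC (n : ℕ) (x : ℝ) : star (uC n x) = uC n x := by
  ext j; simp [uC]

theorem nu_mul_conjTranspose_eq {x : ℝ} (hx : x ≠ 0) : nu n x * (nu n x)ᴴ =
    (Real.exp (-x) : ℂ) • (1 : Mat n) +
      (rankCoeff n x : ℂ) • vecMulVec (uC n x) (star (uC n x)) := by
  rw [nu_mul_conjTranspose hx, star_uC]
  ext i j
  rw [map_apply, nuSq, Matrix.add_apply, Matrix.add_apply, Matrix.smul_apply, Matrix.smul_apply,
    Matrix.smul_apply, Matrix.smul_apply, vecMulVec_apply, vecMulVec_apply, uC, uC]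
  have h1 : (((1 : Matrix (Fin n) (Fin n) ℝ) i j : ℝ) : ℂ) = (1 : Mat n) i j := by
    by_cases h : i = j <;> simp [Matrix.one_apply, h]
  simp only [smul_eq_mul, Complex.ofReal_add, Complex.ofReal_mul, h1]

theorem conj_vecMulVec (M : Mat n) (w : Fin n → ℂ) :
    M * vecMulVec w (star w) * Mᴴ = vecMulVec (M *ᵥ w) (star (M *ᵥ w)) := by
  rw [mul_vecMulVec, vecMulVec_mul, star_mulVec]

/-- Because νν† is a scalar plus rank one, a unitary ρ enters the momentum condition only through
the vector ρ†y. -/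
theorem conj_nu {x : ℝ} (hx : x ≠ 0) (s : Fin n → ℝ) {ρ : Mat n} (hρ : ρ * ρᴴ = 1) :
    rdiag s * (ρᴴ * (nu n x * (nu n x)ᴴ) * ρ) * rdiag s =
      (Real.exp (-x) : ℂ) • rdiag (fun k => s k ^ 2) + (rankCoeff n x : ℂ) •
        vecMulVec (fun k => s k * (ρᴴ *ᵥ uC n x) k) (star fun k => s k * (ρᴴ *ᵥ uC n x) k) := by
  have h1 : ρᴴ * (nu n x * (nu n x)ᴴ) * ρ = (Real.exp (-x) : ℂ) • (1 : Mat n) +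
      (rankCoeff n x : ℂ) • vecMulVec (ρᴴ *ᵥ uC n x) (star (ρᴴ *ᵥ uC n x)) := by
    rw [← conj_vecMulVec, nu_mul_conjTranspose_eq hx, Matrix.mul_add, Matrix.add_mul,
      Matrix.mul_smul, Matrix.mul_smul, Matrix.smul_mul, Matrix.smul_mul, Matrix.mul_one,
      mul_eq_one_comm.1 hρ, conjTranspose_conjTranspose]
  have h2 : (fun k => s k * (ρᴴ *ᵥ uC n x) k) = rdiag s *ᵥ (ρᴴ *ᵥ uC n x) := by
    ext k; rw [rdiag, mulVec_diagonal]
  have h3 : (rdiag fun k => s k ^ 2) = rdiag s * rdiag s := by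
    rw [rdiag_mul_rdiag]; congr 1; ext k; ring
  rw [h1, h2, h3, ← conj_vecMulVec (rdiag s), rdiag_conjTranspose, Matrix.mul_add, Matrix.add_mul,
    Matrix.mul_smul, Matrix.mul_smul, Matrix.smul_mul, Matrix.smul_mul, Matrix.mul_one]

/-- Conjugation by the block matrix (1, 1; 1, -1) diagonalizes the rotation into c + is and c - is,
whose product is one. -/
theorem det_rotBlock {s c : Fin n → ℝ} (h : ∀ k, s k ^ 2 + c k ^ 2 = 1) :
    (rotBlock s c).det = 1 := by
  set P : Mat2 n := fromBlocks 1 1 1 (-1) with hP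
  have hPP : P * P = (2 : ℂ) • 1 := by
    rw [hP, fromBlocks_multiply, ← fromBlocks_one, fromBlocks_smul, fromBlocks_inj]
    simp [two_smul]
  have hP0 : P.det ≠ 0 := by
    intro h0
    have := congrArg det hPP
    rw [det_mul, h0, zero_mul, det_smul, det_one, mul_one] at this
    exact pow_ne_zero _ two_ne_zero this.symm
  have hRP : rotBlock s c * P = P * fromBlocks (rdiag c + Complex.I • rdiag s) 0 0
      (rdiag c - Complex.I • rdiag s) := by
    rw [hP, rotBlock, fromBlocks_multiply, fromBlocks_multiply, fromBlocks_inj]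
    simp [sub_eq_add_neg, add_comm]
  have hdet := congrArg det hRP
  rw [det_mul, det_mul, mul_comm] at hdet
  rw [mul_left_cancel₀ hP0 hdet, det_fromBlocks_zero₂₁, ← det_mul]
  have : (rdiag c + Complex.I • rdiag s) * (rdiag c - Complex.I • rdiag s) = 1 := by
    have h1 : Complex.I • rdiag s = diagonal fun k => Complex.I * s k := by
      ext i j; simp [rdiag, diagonal_apply]
    rw [h1, rdiag, diagonal_add, diagonal_sub, diagonal_mul_diagonal, ← diagonal_one]
    congr 1
    ext k
    have hk : (s k : ℂ) ^ 2 + (c k : ℂ) ^ 2 = 1 := by exact_mod_cast h k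
    linear_combination hk - (s k : ℂ) ^ 2 * Complex.I_sq
  rw [this, det_one]

/-! ### The parameters q, Λ, α and T -/

section Parameters

variable {u v x : ℝ} {p : Fin n → ℝ}

/-- The diagonal entries of `cos q`. -/
def cosq (p : Fin n → ℝ) (k : Fin n) : ℝ := Real.cos (qvec p k)

/-- The diagonal entries of `Λ`, in terms of those of `sin q`. -/
def lam (u v : ℝ) (s : Fin n → ℝ) (k : Fin n) : ℝ :=
  Real.sqrt (Real.exp (-2 * u) - Real.exp (-2 * v) * s k ^ 2)

/-- Strict positivity, from u < v and sin q ≤ 1, makes Λ invertible, which is what later allows T to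
be recovered from ΛT. -/
theorem lam_pos (huv : u < v) {s : Fin n → ℝ} {k : Fin n} (hs : 0 ≤ s k) (hs1 : s k ≤ 1) :
    0 < Real.exp (-2 * u) - Real.exp (-2 * v) * s k ^ 2 := by
  have h1 : Real.exp (-2 * v) < Real.exp (-2 * u) := Real.exp_lt_exp.2 (by linarith)
  have h2 : s k ^ 2 ≤ 1 := pow_le_one₀ hs hs1
  have h3 := mul_le_mul_of_nonneg_left h2 (Real.exp_pos (-2 * v)).le
  linarith

theorem lam_sq (huv : u < v) {s : Fin n → ℝ} {k : Fin n} (hs : 0 ≤ s k) (hs1 : s k ≤ 1) :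
    lam u v s k ^ 2 = Real.exp (-2 * u) - Real.exp (-2 * v) * s k ^ 2 :=
  Real.sq_sqrt (lam_pos huv hs hs1).le

theorem le_zero_of_mem [NeZero n] (hp : p ∈ closedPolyhedron n x) (k : Fin n) : p k ≤ 0 := by
  have h0 := hp.1
  rcases eq_or_ne k 0 with rfl | hk
  · exact h0
  · have h1 := separated_of_mem hp 0 k (Fin.pos_iff_ne_zero.2 hk)
    have := abs_nonneg x
    linarith

theorem sin_qvec {k : Fin n} (hp : p k ≤ 0) : Real.sin (qvec p k) = Real.exp (p k) := by
  rw [qvec, Real.sin_arcsin (by linarith [Real.exp_pos (p k)]) (Real.exp_le_one_iff.2 hp)]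

theorem sinMat_eq (hp : ∀ k, p k ≤ 0) : sinMat p = rdiag fun k => Real.exp (p k) := by
  rw [sinMat, rdiag]
  congr 1
  ext k
  rw [sin_qvec (hp k)]

theorem Lambda_eq (hp : ∀ k, p k ≤ 0) :
    Lambda u v p = rdiag (lam u v fun k => Real.exp (p k)) := by
  rw [Lambda, rdiag]
  congr 1
  ext k
  rw [sin_qvec (hp k), lam]

theorem sin_sq_add_cosq_sq (hp : ∀ k, p k ≤ 0) (k : Fin n) :
    Real.exp (p k) ^ 2 + cosq p k ^ 2 = 1 := by
  rw [← sin_qvec (hp k), cosq, Real.sin_sq_add_cos_sq]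

theorem alpha_spec (hp : ∀ k, p k ≤ 0) (τ : Fin n → Circle) :
    Complex.I • rdiag (fun k => Real.exp (p k)) * alpha u v x p τ +
      (Real.exp v : ℂ) • rdiag (cosq p) =
      rdiag (lam u v fun k => Real.exp (p k)) * Tmat x p τ := by
  have hu : IsUnit (Complex.I • rdiag fun k => Real.exp (p k)).det := by
    rw [det_smul, rdiag, det_diagonal, isUnit_iff_ne_zero]
    refine mul_ne_zero (pow_ne_zero _ Complex.I_ne_zero) (Finset.prod_ne_zero_iff.2 fun k _ => ?_)
    exact_mod_cast (Real.exp_pos (p k)).ne'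
  rw [alpha, sinMat_eq hp, Lambda_eq hp, Matrix.mul_nonsing_inv_cancel_left _ _ hu]
  exact sub_add_cancel _ _

theorem Kmat_eq [NeZero n] (hp : ∀ k, p k ≤ 0) (τ : Fin n → Circle) :
    Kmat u v x p τ = fromBlocks (rho x p) 0 0 1 *
      (rotBlock (fun k => Real.exp (p k)) (cosq p) * triR v (alpha u v x p τ)) := by
  rw [Kmat, sinMat_eq hp, Matrix.mul_assoc]
  rfl

theorem Tmat_eq (x : ℝ) (p : Fin n → ℝ) (τ : Fin n → Circle) :
    Tmat x p τ = diagonal (fun j => (τ j : ℂ)) * toC (theta (-x) p) := rfl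

theorem circle_diagonal_unitary (τ : Fin n → Circle) :
    diagonal (fun j => (τ j : ℂ)) * (diagonal fun j => (τ j : ℂ))ᴴ = 1 := by
  rw [diagonal_conjTranspose, diagonal_mul_diagonal, ← diagonal_one]
  congr 1
  ext j
  simp [Complex.mul_conj]

theorem Tmat_unitary (hx : x ≠ 0) (hp : Separated x p) (τ : Fin n → Circle) :
    Tmat x p τ * (Tmat x p τ)ᴴ = 1 :=
  mul_unitary (circle_diagonal_unitary τ) (toC_unitary (theta_mul_transpose hx hp))

/-- The vector `r(x, p)` as a complex vector. -/
def rC (x : ℝ) (p : Fin n → ℝ) (j : Fin n) : ℂ := (rvec x p j : ℂ)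

theorem theta_conj_complex (hx : x ≠ 0) (hp : Separated x p) :
    (toC (theta (-x) p))ᴴ * rdiag (fun k => Real.exp (p k) ^ 2) * toC (theta (-x) p) =
      (Real.exp (-x) : ℂ) • rdiag (fun k => Real.exp (p k) ^ 2) + (rankCoeff n x : ℂ) •
        vecMulVec (fun k => (Real.exp (p k) : ℂ) * rC x p k)
          (star fun k => (Real.exp (p k) : ℂ) * rC x p k) := by
  rw [← toC_transpose, ← toC_diagonal, ← toC_mul, ← toC_mul]
  change toC ((theta (-x) p)ᵀ * diagonal (sqExp p) * theta (-x) p) = _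
  rw [theta_conj hx hp]
  ext i j
  rw [toC, map_apply, Matrix.add_apply, Matrix.add_apply, Matrix.smul_apply, Matrix.smul_apply,
    Matrix.smul_apply, Matrix.smul_apply, vecMulVec_apply, vecMulVec_apply]
  have h1 : ((diagonal (sqExp p) i j : ℝ) : ℂ) =
      toC (diagonal fun k => Real.exp (p k) ^ 2) i j := rfl
  simp only [Pi.star_apply, rC, wvec, star_mul', Complex.ofReal_mul, Complex.ofReal_add, smul_eq_mul,
    h1, Complex.star_def, Complex.conj_ofReal]

/-- The torus factor is diagonal, so it commutes with D and drops out. -/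
theorem Tmat_conj (hx : x ≠ 0) (hp : Separated x p) (τ : Fin n → Circle) :
    (Tmat x p τ)ᴴ * rdiag (fun k => Real.exp (p k) ^ 2) * Tmat x p τ =
      (Real.exp (-x) : ℂ) • rdiag (fun k => Real.exp (p k) ^ 2) + (rankCoeff n x : ℂ) •
        vecMulVec (fun k => (Real.exp (p k) : ℂ) * rC x p k)
          (star fun k => (Real.exp (p k) : ℂ) * rC x p k) := by
  rw [← theta_conj_complex hx hp, Tmat_eq, conjTranspose_mul]
  have h := mul_eq_one_comm.1 (circle_diagonal_unitary τ)
  set E := diagonal fun j => (τ j : ℂ) with hE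
  have hc : rdiag (fun k => Real.exp (p k) ^ 2) * E = E * rdiag (fun k => Real.exp (p k) ^ 2) := by
    rw [rdiag, hE, diagonal_mul_diagonal, diagonal_mul_diagonal]
    congr 1; ext k; ring
  calc _ = (toC (theta (-x) p))ᴴ * (Eᴴ * (rdiag (fun k => Real.exp (p k) ^ 2) * E)) *
        toC (theta (-x) p) := by simp only [Matrix.mul_assoc]
    _ = _ := by rw [hc, ← Matrix.mul_assoc Eᴴ, h, Matrix.one_mul]

end Parameters

/-! ### The matrix ρ -/

section Rho

variable [NeZero n] {x : ℝ} {p : Fin n → ℝ}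

theorem zeta_mul_transpose (hx : x ≠ 0) (hp : Separated x p) : zeta x p * (zeta x p)ᵀ = 1 := by
  rw [zeta_eq_rotTo]
  exact rotTo_mul_transpose (sum_rvec_sq hx (NeZero.ne n) hp) (rvec_nonneg _ _ _)

theorem zeta_inv (hx : x ≠ 0) (hp : Separated x p) : (zeta x p)⁻¹ = (zeta x p)ᵀ :=
  Matrix.inv_eq_right_inv (zeta_mul_transpose hx hp)

theorem kappa_mul_transpose (hx : x ≠ 0) : kappa n x * (kappa n x)ᵀ = 1 := by
  rw [kappa_eq_rotTo]
  exact rotTo_mul_transpose (sum_uvec_sq hx (NeZero.ne n)) (uvec_nonneg _ _)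

theorem rho_unitary (hx : x ≠ 0) (hp : Separated x p) : rho x p * (rho x p)ᴴ = 1 := by
  refine toC_unitary ?_
  rw [zeta_inv hx hp, transpose_mul, transpose_transpose, Matrix.mul_assoc,
    ← Matrix.mul_assoc _ (zeta x p), mul_eq_one_comm.1 (zeta_mul_transpose hx hp), Matrix.one_mul,
    kappa_mul_transpose hx]

theorem det_rho (hx : x ≠ 0) (hp : Separated x p) : (rho x p).det = 1 := by
  change (toC _).det = 1
  rw [det_toC, zeta_inv hx hp, det_mul, det_transpose, zeta_eq_rotTo, kappa_eq_rotTo,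
    det_rotTo (sum_rvec_sq hx (NeZero.ne n) hp) (rvec_nonneg _ _ _),
    det_rotTo (sum_uvec_sq hx (NeZero.ne n)) (uvec_nonneg _ _), mul_one, Complex.ofReal_one]

/-- With κe_a = y and ζe_a = r, the product ζκ^T takes y back to e_a and then to r. -/
theorem rho_conjTranspose_mulVec (hx : x ≠ 0) (hp : Separated x p) :
    (rho x p)ᴴ *ᵥ uC n x = rC x p := by
  have h : (kappa n x * (zeta x p)⁻¹)ᵀ *ᵥ uvec n x = rvec x p := by
    have h1 := mul_eq_one_comm.1 (kappa_mul_transpose (n := n) hx)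
    have h2 : kappa n x *ᵥ Pi.single (pivot n x) 1 = uvec n x := by
      rw [kappa_eq_rotTo, rotTo_mulVec_single (uvec_nonneg _ _)]
    have h3 : zeta x p *ᵥ Pi.single (pivot n x) 1 = rvec x p := by
      rw [zeta_eq_rotTo, rotTo_mulVec_single (rvec_nonneg _ _ _)]
    rw [zeta_inv hx hp, transpose_mul, transpose_transpose, ← h2, mulVec_mulVec, Matrix.mul_assoc,
      h1, Matrix.mul_one, h3]
  change (toC _)ᴴ *ᵥ _ = _
  rw [← toC_transpose]
  ext i
  have := congrArg Complex.ofReal (congrFun h i)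
  rw [rC, ← this]
  simp only [toC, mulVec, dotProduct, map_apply, uC, Complex.ofReal_sum, Complex.ofReal_mul]

end Rho

/-! ### Points of the section lie on the constraint surface -/

/-- Both sides of the criterion `exists_triL_iff` reduce to tD + c ww† with w = e^p r. -/
theorem Kmat_eq_triL_mul {u v x : ℝ} [NeZero n] (huv : u < v) (hx : x ≠ 0)
    {p : Fin n → ℝ} (hp : p ∈ closedPolyhedron n x) (τ : Fin n → Circle) :
    ∃ β H, H * Hᴴ = 1 ∧ Kmat u v x p τ = triL u (nu n x) β * H := by
  have hs := separated_of_mem hp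
  have h0 := le_zero_of_mem hp
  have h1 : ∀ k, Real.exp (p k) ≤ 1 := fun k => Real.exp_le_one_iff.2 (h0 k)
  simp only [Kmat_eq h0]
  refine (exists_triL_iff (fun k => (Real.exp_pos (p k)).ne') (sin_sq_add_cosq_sq h0)
    (fun k => lam_sq huv (Real.exp_pos (p k)).le (h1 k)) (Tmat_unitary hx hs τ) (rho_unitary hx hs)
    (alpha_spec h0 τ)).2 ?_
  rw [conj_nu hx _ (rho_unitary hx hs), Tmat_conj hx hs, rho_conjTranspose_mulVec hx hs]

theorem Kmat_mem_constraintSurface {u v x : ℝ} [NeZero n] (huv : u < v) (hx : x ≠ 0)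
    {p : Fin n → ℝ} (hp : p ∈ closedPolyhedron n x) (τ : Fin n → Circle) :
    ∃ h : (Kmat u v x p τ).det = 1, (⟨Kmat u v x p τ, h⟩ : SL2n n) ∈ constraintSurface n u v x := by
  have hs := separated_of_mem hp
  have h0 := le_zero_of_mem hp
  have hK := Kmat_eq (u := u) (v := v) (x := x) h0 τ
  have hrot := rotBlock_unitary (sin_sq_add_cosq_sq h0)
  have hdet := det_rotBlock (sin_sq_add_cosq_sq h0)
  have h : (Kmat u v x p τ).det = 1 := by
    rw [hK, det_mul, det_mul, det_fromBlocks_zero₂₁, det_rho hx hs, det_triR, hdet]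
    simp
  refine ⟨h, mem_constraintSurface_iff.2 ?_⟩
  obtain ⟨β, H, hH, hKH⟩ := Kmat_eq_triL_mul huv hx hp τ
  refine ⟨_, _, H, β, ?_, hH, hK.trans (Matrix.mul_assoc _ _ _).symm, hKH⟩
  exact mul_unitary (fromBlocks_unitary (rho_unitary hx hs) (by simp)) hrot

/-! ### Spectral tools: ordered diagonalization, polar form, interlacing -/

theorem exists_antitone_diagonalization {A : Mat n} (hA : A.IsHermitian) :
    ∃ (U : Mat n) (d : Fin n → ℝ), U * Uᴴ = 1 ∧ Antitone d ∧ A = U * rdiag d * Uᴴ := by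
  set V : Mat n := (hA.eigenvectorUnitary : Mat n)
  have hVu : V * Vᴴ = 1 := mem_unitaryGroup_iff.1 hA.eigenvectorUnitary.2
  have hVA : A = V * rdiag hA.eigenvalues * Vᴴ := hA.spectral_theorem
  set σ := Tuple.sort fun i => -hA.eigenvalues i with hσ
  have hmono := Tuple.monotone_sort fun i => -hA.eigenvalues i
  refine ⟨V.submatrix id σ, fun i => hA.eigenvalues (σ i), ?_, ?_, ?_⟩
  · rw [conjTranspose_submatrix, submatrix_mul_equiv, hVu, submatrix_id_id]
  · intro i j hij
    have := hmono hij
    simp only [Function.comp_apply] at this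
    linarith
  · have h : (rdiag fun i => hA.eigenvalues (σ i)) = (rdiag hA.eigenvalues).submatrix σ σ := by
      rw [rdiag, rdiag, submatrix_diagonal_equiv]; rfl
    rw [h, conjTranspose_submatrix, submatrix_mul_equiv, submatrix_mul_equiv, ← hVA,
      submatrix_id_id]

/-- Polar decomposition of a matrix with orthogonal rows. -/
theorem exists_polar {E : Mat n} {c : Fin n → ℝ} (h : E * Eᴴ = rdiag fun k => c k ^ 2) :
    ∃ d : Mat n, d * dᴴ = 1 ∧ E = rdiag c * d := by
  have hE : ∀ i j, ∑ m, E i m * star (E j m) = if i = j then (c i : ℂ) ^ 2 else 0 := by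
    intro i j
    have := congrFun (congrFun h i) j
    rw [Matrix.mul_apply, rdiag, diagonal_apply] at this
    simpa [conjTranspose_apply] using this
  -- The rows of E with c_i ≠ 0, divided by c_i, are orthonormal and extend to an orthonormal basis.
  -- Rows with c_i = 0 vanish, so the added basis vectors there are arbitrary.
  set w : Fin n → EuclideanSpace ℂ (Fin n) :=
    fun i => WithLp.toLp 2 fun m => (c i : ℂ)⁻¹ * E i m with hw
  have hinner : ∀ i j, inner ℂ (w i) (w j) =
      (c i : ℂ)⁻¹ * (c j : ℂ)⁻¹ * (if j = i then (c j : ℂ) ^ 2 else 0) := by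
    intro i j
    rw [← hE, Finset.mul_sum, EuclideanSpace.inner_eq_star_dotProduct, dotProduct]
    refine Finset.sum_congr rfl fun m _ => ?_
    simp [hw]
    ring
  have hon : Orthonormal ℂ (Set.domRestrict {i | c i ≠ 0} w) := by
    rw [orthonormal_iff_ite]
    rintro ⟨i, hi⟩ ⟨j, hj⟩
    have hi' : (c i : ℂ) ≠ 0 := by exact_mod_cast hi
    change inner ℂ (w i) (w j) = _
    rw [hinner]
    by_cases hij : i = j
    · subst hij
      simp only [if_true]
      field_simp
    · rw [if_neg (Ne.symm hij), if_neg (fun e => hij (Subtype.ext_iff.1 e)), mul_zero]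
  obtain ⟨b, hb⟩ := hon.exists_orthonormalBasis_extension_of_card_eq (by simp)
  refine ⟨Matrix.of fun i m => b i m, ?_, ?_⟩
  · ext i j
    have := orthonormal_iff_ite.1 b.orthonormal j i
    rw [EuclideanSpace.inner_eq_star_dotProduct, dotProduct] at this
    rw [Matrix.mul_apply, Matrix.one_apply]
    simp only [conjTranspose_apply, of_apply]
    simpa [eq_comm] using this
  · ext i m
    rw [rdiag, diagonal_mul, of_apply]
    by_cases hi : c i = 0
    · have h0 := hE i i
      rw [if_pos rfl, hi] at h0
      have h1 : ∑ m, Complex.normSq (E i m) = 0 := by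
        have : ((∑ m, Complex.normSq (E i m) : ℝ) : ℂ) = 0 := by
          rw [Complex.ofReal_sum]
          simpa [Complex.mul_conj] using h0
        exact_mod_cast this
      have h2 := (Finset.sum_eq_zero_iff_of_nonneg fun m _ => Complex.normSq_nonneg (E i m)).1 h1 m
        (Finset.mem_univ m)
      rw [Complex.normSq_eq_zero.1 h2, hi]
      simp
    · have hi' : (c i : ℂ) ≠ 0 := by exact_mod_cast hi
      rw [hb i hi]
      simp [hw]
      field_simp

theorem star_dotProduct_self (y : Fin n → ℂ) :
    star y ⬝ᵥ y = ((∑ i, Complex.normSq (y i) : ℝ) : ℂ) := by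
  rw [dotProduct, Complex.ofReal_sum]
  refine Finset.sum_congr rfl fun i _ => ?_
  rw [Complex.normSq_eq_conj_mul_self]; rfl

theorem star_dotProduct_rdiag (s : Fin n → ℝ) (y : Fin n → ℂ) :
    star y ⬝ᵥ (rdiag s *ᵥ y) = ((∑ i, s i * Complex.normSq (y i) : ℝ) : ℂ) := by
  rw [dotProduct, Complex.ofReal_sum]
  refine Finset.sum_congr rfl fun i _ => ?_
  rw [Complex.ofReal_mul, Complex.normSq_eq_conj_mul_self, rdiag, mulVec_diagonal, Pi.star_apply,
    Complex.star_def]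
  ring

/-- Interlacing for a Hermitian rank one perturbation. -/
theorem le_of_rank_one_perturbation {a b : Fin n → ℝ} (ha : Antitone a) (hb : Antitone b)
    {T : Mat n} (hT : Tᴴ * T = 1) {γ : ℂ} {w : Fin n → ℂ}
    (h : Tᴴ * rdiag b * T = rdiag a + γ • vecMulVec w (star w)) {k l : Fin n}
    (hkl : (l : ℕ) = k + 1) : a l ≤ b k := by
  -- The rows of N encode the conditions (Ty)_i = 0 for i < k, w†y = 0 and y_i = 0 for i > l. Since
  -- l = k + 1 these are n - 1 conditions, and row l is left zero, so N has a nonzero kernel vector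
  -- y. On y the perturbation vanishes, and its Rayleigh quotient is at least a_l and at most b_k.
  set N : Mat n := fun i j => if i < k then T i j else if i = k then star (w j) else
    if i = l then 0 else if i = j then 1 else 0 with hN
  have hkl' : k < l := by rw [Fin.lt_def]; omega
  have hdet : N.det = 0 := by
    refine det_eq_zero_of_row_eq_zero l fun j => ?_
    simp [hN, hkl'.not_gt, hkl'.ne']
  obtain ⟨y, hy0, hy⟩ := exists_mulVec_eq_zero_iff.2 hdet
  have hNy : ∀ i, ∑ j, N i j * y j = 0 := fun i => congrFun hy i
  have h1 : ∀ i, i < k → (T *ᵥ y) i = 0 := by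
    intro i hi
    have := hNy i
    simp only [hN, if_pos hi] at this
    exact this
  have h2 : star w ⬝ᵥ y = 0 := by
    have := hNy k
    simp only [hN, lt_irrefl, if_false, if_true] at this
    exact this
  have h3 : ∀ i, l < i → y i = 0 := by
    intro i hi
    have := hNy i
    simpa [hN, (hkl'.trans hi).not_gt, (hkl'.trans hi).ne', hi.ne'] using this
  have e1 : star (T *ᵥ y) ⬝ᵥ (rdiag b *ᵥ (T *ᵥ y)) = star y ⬝ᵥ (rdiag a *ᵥ y) := by
    have : (Tᴴ * rdiag b * T) *ᵥ y = rdiag a *ᵥ y := by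
      rw [h, add_mulVec, smul_mulVec, vecMulVec_mulVec, h2]
      simp
    rw [← this, star_mulVec, ← dotProduct_mulVec, mulVec_mulVec, mulVec_mulVec, Matrix.mul_assoc]
  have e2 : star (T *ᵥ y) ⬝ᵥ (T *ᵥ y) = star y ⬝ᵥ y := by
    rw [star_mulVec, ← dotProduct_mulVec, mulVec_mulVec, hT, one_mulVec]
  rw [star_dotProduct_rdiag, star_dotProduct_rdiag, Complex.ofReal_inj] at e1
  rw [star_dotProduct_self, star_dotProduct_self, Complex.ofReal_inj] at e2
  have e3 : a l * ∑ i, Complex.normSq (y i) ≤ ∑ i, a i * Complex.normSq (y i) := by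
    rw [Finset.mul_sum]
    refine Finset.sum_le_sum fun i _ => ?_
    rcases lt_or_ge l i with hi | hi
    · simp [h3 i hi]
    · exact mul_le_mul_of_nonneg_right (ha hi) (Complex.normSq_nonneg _)
  have e4 : ∑ i, b i * Complex.normSq ((T *ᵥ y) i) ≤ b k * ∑ i, Complex.normSq ((T *ᵥ y) i) := by
    rw [Finset.mul_sum]
    refine Finset.sum_le_sum fun i _ => ?_
    rcases lt_or_ge i k with hi | hi
    · simp [h1 i hi]
    · exact mul_le_mul_of_nonneg_right (hb hi) (Complex.normSq_nonneg _)
  have hpos : 0 < ∑ i, Complex.normSq (y i) := by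
    obtain ⟨i, hi⟩ := Function.ne_iff.1 hy0
    exact Finset.sum_pos' (fun i _ => Complex.normSq_nonneg _)
      ⟨i, Finset.mem_univ i, Complex.normSq_pos.2 hi⟩
  rw [e2, e1] at e4
  exact le_of_mul_le_mul_right (e3.trans e4) hpos

/-! ### Generalized Cartan form -/

/-- The lower row of the triangular factor is (0, e^{-u}), and the unitary factor cancels in KK†. -/
theorem bottom_row_triL {u : ℝ} {A B X Y P β : Mat n} {H : Mat2 n} (hH : H * Hᴴ = 1)
    (h : fromBlocks A B X Y = triL u P β * H) :
    X * Xᴴ + Y * Yᴴ = (Real.exp (-2 * u) : ℂ) • (1 : Mat n) := by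
  have h1 : fromBlocks A B X Y * (fromBlocks A B X Y)ᴴ = triL u P β * (triL u P β)ᴴ := by
    rw [h, conjTranspose_mul, Matrix.mul_assoc, ← Matrix.mul_assoc H, hH, Matrix.one_mul]
  rw [triL, fromBlocks_conjTranspose, fromBlocks_conjTranspose, fromBlocks_multiply,
    fromBlocks_multiply, fromBlocks_inj] at h1
  rw [h1.2.2.2, conjTranspose_zero, Matrix.mul_zero, zero_add, conjTranspose_smul,
    conjTranspose_one, Matrix.smul_mul, Matrix.mul_smul, Matrix.one_mul, smul_smul]
  congr 1
  rw [Complex.star_def, Complex.conj_ofReal, ← Complex.ofReal_mul, ← Real.exp_add]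
  congr 2
  ring

/-- Unitary matrices with the same lower blocks differ by a unitary upper left block. -/
theorem exists_unitary_of_bottom_row_eq {A B A' B' X Y : Mat n}
    (h : fromBlocks A B X Y * (fromBlocks A B X Y)ᴴ = 1)
    (h' : fromBlocks A' B' X Y * (fromBlocks A' B' X Y)ᴴ = 1) :
    ∃ ρ : Mat n, ρ * ρᴴ = 1 ∧ fromBlocks A B X Y = fromBlocks ρ 0 0 1 * fromBlocks A' B' X Y := by
  set W : Mat2 n := fromBlocks A B X Y * (fromBlocks A' B' X Y)ᴴ with hW
  have hWu : W * Wᴴ = 1 := mul_unitary h (conjTranspose_unitary h')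
  have hWe : W * fromBlocks A' B' X Y = fromBlocks A B X Y := by
    rw [hW, Matrix.mul_assoc, mul_eq_one_comm.1 h', Matrix.mul_one]
  have h1 := h'
  rw [fromBlocks_conjTranspose, fromBlocks_multiply, ← fromBlocks_one, fromBlocks_inj] at h1
  -- Equal lower rows give the quotient W of the two unitary matrices the lower row (0, 1);
  -- unitarity of W then kills its remaining off-diagonal block.
  obtain ⟨y, hy⟩ : ∃ y, W = fromBlocks (A * A'ᴴ + B * B'ᴴ) y 0 1 := by
    rw [hW, fromBlocks_conjTranspose, fromBlocks_multiply]
    exact ⟨_, by rw [h1.2.2.1, h1.2.2.2]⟩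
  have h2 := hWu
  rw [hy, fromBlocks_conjTranspose, fromBlocks_multiply, ← fromBlocks_one, fromBlocks_inj] at h2
  have hy0 : y = 0 := by simpa using h2.2.1
  subst hy0
  refine ⟨A * A'ᴴ + B * B'ᴴ, by rw [← h2.1, Matrix.zero_mul, add_zero], ?_⟩
  rw [← hy, hWe]

theorem mul_conjTranspose_diag (M : Mat n) (k : Fin n) :
    (M * Mᴴ) k k = ((∑ m, Complex.normSq (M k m) : ℝ) : ℂ) := by
  rw [Matrix.mul_apply, Complex.ofReal_sum]
  exact Finset.sum_congr rfl fun m _ => Complex.mul_conj _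

theorem fromBlocks_mul_triR (v : ℝ) (c d α : Mat n) (hd : dᴴ * d = 1) :
    fromBlocks c 0 0 d * triR v α = triR v (c * α * dᴴ) * fromBlocks c 0 0 d := by
  rw [triR, triR, fromBlocks_multiply, fromBlocks_multiply, fromBlocks_inj]
  simp [Matrix.mul_assoc, hd]

theorem fromBlocks_mul_triL (u : ℝ) (b P β : Mat n) (hb : bᴴ * b = 1) :
    fromBlocks 1 0 0 b * triL u P β = triL u P (β * bᴴ) * fromBlocks 1 0 0 b := by
  rw [triL, triL, fromBlocks_multiply, fromBlocks_multiply, fromBlocks_inj]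
  simp [Matrix.mul_assoc, hb]

/-- Reduction of an element of the constraint surface to generalized Cartan form. -/
theorem exists_cartan_form {u v : ℝ} (hvu : v ≠ -u) {K : Mat2 n} {ν α₀ β₀ : Mat n} {G H₀ : Mat2 n}
    (hG : G * Gᴴ = 1) (hH₀ : H₀ * H₀ᴴ = 1) (h1 : K = G * triR v α₀) (h2 : K = triL u ν β₀ * H₀) :
    ∃ (b c d ρ : Mat n) (p : Fin n → ℝ) (α β : Mat n) (H : Mat2 n),
      b * bᴴ = 1 ∧ c * cᴴ = 1 ∧ d * dᴴ = 1 ∧ ρ * ρᴴ = 1 ∧ H * Hᴴ = 1 ∧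
      Antitone p ∧ (∀ k, p k ≤ 0) ∧
      fromBlocks 1 0 0 b * K = fromBlocks ρ 0 0 1 *
        (rotBlock (fun k => Real.exp (p k)) (cosq p) * triR v α) * fromBlocks c 0 0 d ∧
      fromBlocks ρ 0 0 1 *
        (rotBlock (fun k => Real.exp (p k)) (cosq p) * triR v α) = triL u ν β * H := by
  obtain ⟨A, B, C, E, rfl⟩ : ∃ A B C E, G = fromBlocks A B C E := ⟨_, _, _, _, (fromBlocks_toBlocks G).symm⟩
  have hCE : C * Cᴴ + E * Eᴴ = 1 := by
    have := hG
    rw [fromBlocks_conjTranspose, fromBlocks_multiply, ← fromBlocks_one, fromBlocks_inj] at this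
    exact this.2.2.2
  -- The eigenvalues of CC†, in decreasing order, become sin² q; those of EE† are then cos² q with
  -- the same eigenvectors.
  obtain ⟨U, D, hU, hD, hCD⟩ := exists_antitone_diagonalization (isHermitian_mul_conjTranspose_self C)
  have hU' : Uᴴ * U = 1 := mul_eq_one_comm.1 hU
  have hCC : (Uᴴ * C) * (Uᴴ * C)ᴴ = rdiag D := by
    calc _ = Uᴴ * (C * Cᴴ) * U := by
          rw [conjTranspose_mul, conjTranspose_conjTranspose]; simp only [Matrix.mul_assoc]
      _ = (Uᴴ * U) * rdiag D * (Uᴴ * U) := by rw [hCD]; simp only [Matrix.mul_assoc]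
      _ = _ := by rw [hU']; simp
  have hEE : (Uᴴ * E) * (Uᴴ * E)ᴴ = 1 - rdiag D := by
    rw [eq_sub_iff_add_eq', ← hCC]
    calc _ = Uᴴ * (C * Cᴴ + E * Eᴴ) * U := by
          rw [conjTranspose_mul, conjTranspose_mul, conjTranspose_conjTranspose]
          simp only [Matrix.mul_assoc, Matrix.mul_add, Matrix.add_mul]
      _ = 1 := by rw [hCE, Matrix.mul_one, hU']
  have hDk : ∀ k, D k = ∑ m, Complex.normSq ((Uᴴ * C) k m) := fun k => by
    have h := mul_conjTranspose_diag (Uᴴ * C) k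
    rw [hCC, rdiag, diagonal_apply_eq] at h
    exact_mod_cast h
  have hEk : ∀ k, 1 - D k = ∑ m, Complex.normSq ((Uᴴ * E) k m) := fun k => by
    have h := mul_conjTranspose_diag (Uᴴ * E) k
    rw [hEE, Matrix.sub_apply, Matrix.one_apply_eq, rdiag, diagonal_apply_eq] at h
    exact_mod_cast h
  have hD1 : ∀ k, D k ≤ 1 := fun k => by
    have := Finset.sum_nonneg fun (m : Fin n) (_ : m ∈ Finset.univ) =>
      Complex.normSq_nonneg ((Uᴴ * E) k m)
    linarith [hEk k]
  -- This is where v ≠ -u enters. If D_k = 0, row k of U†C vanishes and row k of U†E has length one.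
  -- The lower row of K then has squared length e^{2v} by the first factorization and e^{-2u} by the
  -- second.
  have hD0 : ∀ k, 0 < D k := by
    intro k
    have hnn : 0 ≤ D k := by rw [hDk]; exact Finset.sum_nonneg fun m _ => Complex.normSq_nonneg _
    refine lt_of_le_of_ne hnn fun h0 => hvu ?_
    have hz : ∀ m, (Uᴴ * C) k m = 0 := fun m => by
      have h3 := (Finset.sum_eq_zero_iff_of_nonneg fun m _ =>
        Complex.normSq_nonneg ((Uᴴ * C) k m)).1 ((hDk k).symm.trans h0.symm) m (Finset.mem_univ m)
      exact Complex.normSq_eq_zero.1 h3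
    have hrow := h1.symm.trans h2
    rw [triR, fromBlocks_multiply] at hrow
    have h4 := bottom_row_triL hH₀ hrow
    set Y := C * α₀ + E * ((Real.exp v : ℂ) • (1 : Mat n)) with hY
    have h5 : (Uᴴ * Y) * (Uᴴ * Y)ᴴ = (Real.exp (-2 * u) : ℂ) • 1 -
        (Real.exp (-v) * Real.exp (-v) : ℂ) • rdiag D := by
      rw [eq_sub_iff_add_eq', ← hCC]
      calc _ = Uᴴ * (((Real.exp (-v) * Real.exp (-v) : ℂ) • (C * Cᴴ)) + Y * Yᴴ) * U := by
            rw [conjTranspose_mul, conjTranspose_mul, conjTranspose_conjTranspose]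
            simp only [Matrix.mul_assoc, Matrix.mul_add, Matrix.add_mul, Matrix.smul_mul,
              Matrix.mul_smul]
        _ = Uᴴ * ((Real.exp (-2 * u) : ℂ) • (1 : Mat n)) * U := by
            rw [← h4]
            simp only [Matrix.mul_zero, add_zero, Matrix.mul_smul, Matrix.mul_one,
              conjTranspose_smul, Matrix.smul_mul, smul_smul, Complex.star_def,
              Complex.conj_ofReal]
        _ = _ := by rw [Matrix.mul_smul, Matrix.smul_mul, Matrix.mul_one, hU']
    have h6 : ∀ m, (Uᴴ * Y) k m = Real.exp v * (Uᴴ * E) k m := fun m => by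
      rw [hY, Matrix.mul_add, ← Matrix.mul_assoc, Matrix.add_apply, Matrix.mul_apply,
        Finset.sum_eq_zero fun i _ => by rw [hz i, zero_mul], zero_add, Matrix.mul_smul,
        Matrix.mul_one, Matrix.mul_smul, Matrix.smul_apply, smul_eq_mul]
    have h7 := mul_conjTranspose_diag (Uᴴ * Y) k
    rw [h5, Matrix.sub_apply, Matrix.smul_apply, Matrix.smul_apply, Matrix.one_apply_eq, rdiag,
      diagonal_apply_eq, ← h0] at h7
    simp only [h6, Complex.normSq_mul, Complex.normSq_ofReal] at h7
    rw [← Finset.mul_sum, ← hEk, ← h0, sub_zero, mul_one, ← Real.exp_add] at h7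
    have h8 : Real.exp (-2 * u) = Real.exp (v + v) := by
      simp only [Complex.ofReal_zero, mul_zero, sub_zero, smul_eq_mul, mul_one] at h7
      exact_mod_cast h7
    rw [Real.exp_eq_exp] at h8
    linarith
  set p : Fin n → ℝ := fun k => Real.log (D k) / 2 with hp
  have hpD : ∀ k, Real.exp (p k) ^ 2 = D k := fun k => by
    rw [← Real.exp_nat_mul, hp]
    simp only
    rw [show ((2 : ℕ) : ℝ) * (Real.log (D k) / 2) = Real.log (D k) by push_cast; ring,
      Real.exp_log (hD0 k)]
  have hp0 : ∀ k, p k ≤ 0 := fun k => by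
    have := Real.log_nonpos (hD0 k).le (hD1 k)
    simp only [hp]; linarith
  have hpa : Antitone p := fun i j hij => by
    have := Real.log_le_log (hD0 j) (hD hij)
    simp only [hp]; linarith
  set s : Fin n → ℝ := fun k => Real.exp (p k) with hs
  have hs0 : ∀ k, s k ≠ 0 := fun k => (Real.exp_pos _).ne'
  have hsc : ∀ k, s k ^ 2 + cosq p k ^ 2 = 1 := sin_sq_add_cosq_sq hp0
  have hDss : rdiag D = rdiag s * rdiag s := by
    rw [rdiag_mul_rdiag]; congr 1; ext k; rw [← hpD]; ring
  set c : Mat n := -Complex.I • (rdiag (fun k => (s k)⁻¹) * (Uᴴ * C)) with hc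
  have hcu : c * cᴴ = 1 := by
    have h3 : c * cᴴ = rdiag (fun k => (s k)⁻¹) * ((Uᴴ * C) * (Uᴴ * C)ᴴ) *
        rdiag (fun k => (s k)⁻¹) := by
      rw [hc, conjTranspose_smul, conjTranspose_mul (rdiag _), rdiag_conjTranspose,
        Matrix.smul_mul, Matrix.mul_smul, smul_smul]
      simp [Matrix.mul_assoc]
    rw [h3, hCC, hDss, ← Matrix.mul_assoc, rdiag_inv_mul hs0, Matrix.one_mul, rdiag_mul_inv hs0]
  have hCc : Uᴴ * C = Complex.I • rdiag s * c := by
    rw [hc, Matrix.smul_mul, Matrix.mul_smul, smul_smul, ← Matrix.mul_assoc (rdiag s),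
      rdiag_mul_inv hs0]
    simp
  -- Unlike sin q, cos q may be singular, so d cannot be obtained by dividing as c was.
  obtain ⟨d, hdu, hEd⟩ : ∃ d : Mat n, d * dᴴ = 1 ∧ Uᴴ * E = rdiag (cosq p) * d := by
    refine exists_polar ?_
    rw [hEE, ← rdiag_one, rdiag, rdiag, rdiag, diagonal_sub]
    congr 1
    ext k
    rw [← Complex.ofReal_sub, ← hpD]
    congr 1
    linarith [hsc k]
  have hcu' := mul_eq_one_comm.1 hcu
  have hdu' := mul_eq_one_comm.1 hdu
  have hbu : fromBlocks 1 0 0 Uᴴ * (fromBlocks 1 0 0 Uᴴ : Mat2 n)ᴴ = 1 :=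
    fromBlocks_unitary (by simp) (conjTranspose_unitary hU)
  have hcdu := fromBlocks_unitary hcu hdu
  set g : Mat2 n := fromBlocks 1 0 0 Uᴴ * fromBlocks A B C E * (fromBlocks c 0 0 d)ᴴ with hg
  have hgu : g * gᴴ = 1 := mul_unitary (mul_unitary hbu hG) (conjTranspose_unitary hcdu)
  have hgb : g = fromBlocks (A * cᴴ) (B * dᴴ) (Complex.I • rdiag s) (rdiag (cosq p)) := by
    rw [hg, fromBlocks_conjTranspose, fromBlocks_multiply, fromBlocks_multiply]
    simp only [Matrix.one_mul, Matrix.zero_mul, Matrix.mul_zero, add_zero, zero_add,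
      conjTranspose_zero, hCc, hEd, Matrix.mul_assoc, hcu, hdu, Matrix.mul_one]
  rw [hgb] at hgu
  obtain ⟨ρ, hρ, hgρ⟩ := exists_unitary_of_bottom_row_eq hgu (rotBlock_unitary hsc)
  have hbK : fromBlocks 1 0 0 Uᴴ * K = fromBlocks ρ 0 0 1 *
        (rotBlock s (cosq p) * triR v (c * α₀ * dᴴ)) * fromBlocks c 0 0 d := by
    have h3 : fromBlocks 1 0 0 Uᴴ * fromBlocks A B C E =
        fromBlocks ρ 0 0 1 * rotBlock s (cosq p) * fromBlocks c 0 0 d := by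
      rw [rotBlock, ← hgρ, ← hgb, hg, Matrix.mul_assoc _ _ (fromBlocks c 0 0 d),
        mul_eq_one_comm.1 hcdu, Matrix.mul_one]
    rw [h1, ← Matrix.mul_assoc, h3, Matrix.mul_assoc _ (fromBlocks c 0 0 d),
      fromBlocks_mul_triR v c d α₀ hdu']
    simp only [Matrix.mul_assoc]
  refine ⟨Uᴴ, c, d, ρ, p, c * α₀ * dᴴ, β₀ * U, fromBlocks 1 0 0 Uᴴ * H₀ * (fromBlocks c 0 0 d)ᴴ,
    conjTranspose_unitary hU, hcu, hdu, hρ,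
    mul_unitary (mul_unitary hbu hH₀) (conjTranspose_unitary hcdu), hpa, hp0, hbK, ?_⟩
  have h3 := fromBlocks_mul_triL u Uᴴ ν β₀ (by rw [conjTranspose_conjTranspose, hU])
  rw [conjTranspose_conjTranspose] at h3
  calc _ = fromBlocks 1 0 0 Uᴴ * K * (fromBlocks c 0 0 d)ᴴ := by
        rw [hbK, Matrix.mul_assoc _ (fromBlocks c 0 0 d), hcdu, Matrix.mul_one]
    _ = _ := by
        rw [h2, ← Matrix.mul_assoc, h3]
        simp only [Matrix.mul_assoc]

/-! ### Uniqueness of T up to phases, and normalization of the gauge group element -/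

/-- The rank one data of `Tᴴ D T = t D + γ w wᴴ` are determined by `D`, up to phases. -/
theorem prod_eq_of_rank_one {D : Fin n → ℝ} {t : ℝ} {γ : ℂ} {T : Mat n} (hT : Tᴴ * T = 1)
    {w : Fin n → ℂ}
    (h : Tᴴ * rdiag D * T = (t : ℂ) • rdiag D + γ • vecMulVec w (star w)) (k : Fin n) :
    ∏ j, ((D j : ℂ) - t * D k) =
      γ * (w k * star (w k)) * ∏ j ∈ Finset.univ.erase k, ((t : ℂ) * D j - t * D k) := by
  -- Shifting by tD_k makes the k-th diagonal entry vanish, so only one term of the rank one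
  -- determinant formula survives, and it contains |w_k|².
  have h1 : Tᴴ * (rdiag D - ((t : ℂ) * D k) • 1) * T =
      diagonal (fun j => (t : ℂ) * D j - t * D k) + vecMulVec (γ • w) (star w) := by
    rw [Matrix.mul_sub, Matrix.sub_mul, h, Matrix.mul_smul, Matrix.smul_mul, Matrix.mul_one, hT,
      smul_vecMulVec]
    have : diagonal (fun j => (t : ℂ) * D j - t * D k) =
        (t : ℂ) • rdiag D - ((t : ℂ) * D k) • (1 : Mat n) := by
      ext i j
      by_cases hij : i = j <;> simp [rdiag, hij]
    rw [this]
    abel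
  have h2 := congrArg det h1
  rw [det_mul, det_mul, mul_comm, ← mul_assoc, ← det_mul, mul_eq_one_comm.1 hT, det_one, one_mul,
    det_diagonal_add_vecMulVec, Finset.prod_eq_zero (Finset.mem_univ k) (sub_self _), zero_add,
    Finset.sum_eq_single k] at h2
  · have h3 : rdiag D - ((t : ℂ) * D k) • (1 : Mat n) = diagonal fun j => (D j : ℂ) - t * D k := by
      ext i j
      by_cases hij : i = j <;> simp [rdiag, hij]
    rw [h3, det_diagonal] at h2
    rw [h2, Pi.smul_apply, smul_eq_mul, Pi.star_apply]
    ring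
  · intro j _ hj
    rw [Finset.prod_eq_zero (Finset.mem_erase.2 ⟨Ne.symm hj, Finset.mem_univ k⟩) (sub_self _),
      mul_zero]
  · intro hk
    exact absurd (Finset.mem_univ k) hk

/-- For distinct D_j the cofactor of |w_k|² in the determinant identity is nonzero, so any two
solutions have the same moduli; one of them will be the explicit θ. -/
theorem normSq_eq_of_rank_one {D : Fin n → ℝ} (hD : Function.Injective D) {t : ℝ} (ht : t ≠ 0)
    {γ : ℂ} (hγ : γ ≠ 0) {T T' : Mat n} (hT : Tᴴ * T = 1) (hT' : T'ᴴ * T' = 1) {w w' : Fin n → ℂ}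
    (h : Tᴴ * rdiag D * T = (t : ℂ) • rdiag D + γ • vecMulVec w (star w))
    (h' : T'ᴴ * rdiag D * T' = (t : ℂ) • rdiag D + γ • vecMulVec w' (star w')) (k : Fin n) :
    Complex.normSq (w k) = Complex.normSq (w' k) := by
  have h1 := (prod_eq_of_rank_one hT h k).symm.trans (prod_eq_of_rank_one hT' h' k)
  have h2 : ∏ j ∈ Finset.univ.erase k, ((t : ℂ) * D j - t * D k) ≠ 0 := by
    refine Finset.prod_ne_zero_iff.2 fun j hj => ?_
    rw [← mul_sub]
    refine mul_ne_zero (by exact_mod_cast ht) (sub_ne_zero.2 fun e => ?_)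
    exact (Finset.mem_erase.1 hj).1 (hD (by exact_mod_cast e))
  have h3 := mul_left_cancel₀ hγ (mul_right_cancel₀ h2 h1)
  simp only [Complex.star_def, Complex.mul_conj] at h3
  exact_mod_cast h3

theorem exists_phase (z : ℂ) : ∃ δ : Circle, z = δ * (Real.sqrt (Complex.normSq z) : ℂ) := by
  refine ⟨Circle.exp (Complex.arg z), ?_⟩
  rw [Circle.coe_exp, mul_comm]
  exact (Complex.norm_mul_exp_arg_mul_I z).symm

/-- Unitary matrices commuting with a regular diagonal matrix are diagonal. -/
theorem exists_circle_diagonal {D : Fin n → ℝ} (hD : Function.Injective D) {X : Mat n}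
    (hX : X * Xᴴ = 1) (h : Xᴴ * rdiag D * X = rdiag D) :
    ∃ τ : Fin n → Circle, X = diagonal fun j => (τ j : ℂ) := by
  have h1 : rdiag D * X = X * rdiag D := by
    calc _ = (X * Xᴴ) * (rdiag D * X) := by rw [hX, Matrix.one_mul]
      _ = X * (Xᴴ * rdiag D * X) := by simp only [Matrix.mul_assoc]
      _ = _ := by rw [h]
  have h2 : ∀ i j, i ≠ j → X i j = 0 := by
    intro i j hij
    have := congrFun (congrFun h1 i) j
    rw [rdiag, diagonal_mul, mul_diagonal, mul_comm] at this
    have h3 : X i j * ((D i : ℂ) - D j) = 0 := by linear_combination this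
    refine (mul_eq_zero.1 h3).resolve_right (sub_ne_zero.2 fun e => hij (hD ?_))
    exact_mod_cast e
  have h3 : X = diagonal fun j => X j j := by
    ext i j
    by_cases hij : i = j
    · subst hij; simp
    · rw [h2 i j hij, diagonal_apply_ne _ hij]
  have h4 : ∀ j, Complex.normSq (X j j) = 1 := by
    intro j
    have := congrFun (congrFun hX j) j
    rw [h3, diagonal_conjTranspose, diagonal_mul_diagonal, diagonal_apply_eq, Matrix.one_apply_eq,
      Pi.star_apply, Complex.star_def, Complex.mul_conj] at this
    exact_mod_cast this
  refine ⟨fun j => ⟨X j j, ?_⟩, h3⟩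
  rw [Submonoid.unitSphere, ← SetLike.mem_coe]
  change X j j ∈ Metric.sphere (0 : ℂ) 1
  rw [mem_sphere_zero_iff_norm, ← sq_eq_sq₀ (norm_nonneg _) zero_le_one, ← Complex.normSq_eq_norm_sq,
    h4, one_pow]

/-- Unitary gauge transformations can be normalized to have determinant one. -/
theorem mem_gaugeOrbit {x : ℝ} {K K' : SL2n n} {η b c d : Mat n} (hη : η * ηᴴ = 1)
    (hb : b * bᴴ = 1) (hc : c * cᴴ = 1) (hd : d * dᴴ = 1)
    (hN : η * (nu n x * (nu n x)ᴴ) * ηᴴ = nu n x * (nu n x)ᴴ)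
    (h : fromBlocks η 0 0 b * K.1 = K'.1 * fromBlocks c 0 0 d) : K' ∈ gaugeOrbit n x K := by
  -- The root of order 2n below needs n > 0.
  rcases Nat.eq_zero_or_pos n with rfl | hn
  · refine ⟨1, one_mem _, ?_⟩
    ext i
    rcases i with i | i <;> exact i.elim0
  have hu1 := fromBlocks_unitary hη hb
  have hu2 := fromBlocks_unitary hc hd
  have hdet : (fromBlocks η 0 0 b : Mat2 n).det = (fromBlocks c 0 0 d : Mat2 n).det := by
    have := congrArg det h
    rwa [det_mul, det_mul, K.2, K'.2, mul_one, one_mul] at this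
  set z := (fromBlocks c 0 0 d : Mat2 n).det with hz
  have hzu : z * star z = 1 := by
    have := congrArg det hu2
    rwa [det_mul, det_conjTranspose, det_one] at this
  have hz0 : z ≠ 0 := left_ne_zero_of_mul_eq_one hzu
  -- Since K and K' have determinant one, the two block-diagonal factors have the same determinant
  -- z, so one scalar ω with ω^{2n} = z⁻¹ normalizes both and cancels in the action.
  obtain ⟨ω, hω⟩ := IsAlgClosed.exists_pow_nat_eq z⁻¹ (show 0 < n + n by omega)
  have hωu : ω * star ω = 1 := by
    have h1 : ‖z‖ = 1 := by
      have := congrArg norm hzu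
      rw [norm_mul, norm_star, norm_one] at this
      nlinarith [norm_nonneg z]
    have h2 : ‖ω‖ ^ (n + n) = 1 := by rw [← norm_pow, hω, norm_inv, h1, inv_one]
    have h3 : ‖ω‖ = 1 := (pow_eq_one_iff_of_nonneg (norm_nonneg ω) (by omega)).1 h2
    rw [Complex.star_def, Complex.mul_conj, Complex.normSq_eq_norm_sq, h3]
    simp
  have hsm : ∀ A B : Mat n, ω • fromBlocks A 0 0 B = fromBlocks (ω • A) 0 0 (ω • B) := by
    intro A B; rw [fromBlocks_smul, smul_zero]
  have hsu : ∀ {A : Mat n}, A * Aᴴ = 1 → (ω • A) * (ω • A)ᴴ = 1 := by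
    intro A hA
    rw [conjTranspose_smul, Matrix.smul_mul, Matrix.mul_smul, smul_smul, hωu, hA, one_smul]
  have hd1 : ∀ M : Mat2 n, M.det = z → (ω • M).det = 1 := by
    intro M hM
    rw [det_smul, hM, Fintype.card_sum, Fintype.card_fin, hω, inv_mul_cancel₀ hz0]
  set ηL : SL2n n := ⟨ω • fromBlocks η 0 0 b, hd1 _ hdet⟩ with hηL
  set ηR : SL2n n := ⟨ω • fromBlocks c 0 0 d, hd1 _ rfl⟩ with hηR
  have hG : ∀ {A B : Mat n} {g : SL2n n}, g.1 = ω • fromBlocks A 0 0 B → A * Aᴴ = 1 → B * Bᴴ = 1 →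
      g ∈ Gplus n := by
    intro A B g hg hA hB
    refine ⟨mem_SU2n_iff.2 ?_, ?_, ?_⟩
    · rw [hg, hsm]; exact fromBlocks_unitary (hsu hA) (hsu hB)
    · rw [hg, hsm, toBlocks_fromBlocks₁₂]
    · rw [hg, hsm, toBlocks_fromBlocks₂₁]
  refine ⟨(ηL, ηR), ⟨⟨hG rfl hη hb, ?_⟩, hG rfl hc hd⟩, ?_⟩
  · change (ω • fromBlocks η 0 0 b : Mat2 n).toBlocks₁₁ * _ *
      ((ω • fromBlocks η 0 0 b : Mat2 n).toBlocks₁₁)ᴴ = _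
    rw [hsm, toBlocks_fromBlocks₁₁, conjTranspose_smul, Matrix.smul_mul, Matrix.smul_mul,
      Matrix.mul_smul, smul_smul, hωu, one_smul, hN]
  · change K' = ηL * K * ηR⁻¹
    rw [eq_mul_inv_iff_mul_eq]
    refine Subtype.ext ?_
    change K'.1 * (ω • fromBlocks c 0 0 d) = (ω • fromBlocks η 0 0 b) * K.1
    rw [Matrix.mul_smul, Matrix.smul_mul, h]

/-- Starting from the Cartan form, the unitary T and the vector ρ†y are compared with the explicit
pair θ, r. They agree up to a diagonal phase matrix Δ and a torus element; Δ is absorbed into the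
gauge transformation and the torus element becomes τ. -/
theorem exists_section_point [NeZero n] {u v x : ℝ} (huv : u < v) (hvu : v ≠ -u) (hx : x ≠ 0)
    {K : SL2n n} (hK : K ∈ constraintSurface n u v x) :
    ∃ p ∈ closedPolyhedron n x, ∃ (τ : Fin n → Circle) (η b c d : Mat n), η * ηᴴ = 1 ∧
      b * bᴴ = 1 ∧ c * cᴴ = 1 ∧ d * dᴴ = 1 ∧
      η * (nu n x * (nu n x)ᴴ) * ηᴴ = nu n x * (nu n x)ᴴ ∧
      fromBlocks η 0 0 b * K.1 = Kmat u v x p τ * fromBlocks c 0 0 d := by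
  obtain ⟨G, α₀, H₀, β₀, hG, hH₀, hK1, hK2⟩ := mem_constraintSurface_iff.1 hK
  obtain ⟨b, c, d, ρ, p, α, β, H, hb, hc, hd, hρ, hH, hpa, hp0, hbK, hKH⟩ :=
    exists_cartan_form hvu hG hH₀ hK1 hK2
  set s : Fin n → ℝ := fun k => Real.exp (p k) with hs
  have hs0 : ∀ k, s k ≠ 0 := fun k => (Real.exp_pos _).ne'
  have hs1 : ∀ k, s k ≤ 1 := fun k => Real.exp_le_one_iff.2 (hp0 k)
  have hsc : ∀ k, s k ^ 2 + cosq p k ^ 2 = 1 := sin_sq_add_cosq_sq hp0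
  have hlsq : ∀ k, lam u v s k ^ 2 = _ := fun k => lam_sq huv (Real.exp_pos (p k)).le (hs1 k)
  have hl0 : ∀ k, lam u v s k ≠ 0 := fun k =>
    (Real.sqrt_pos.2 (lam_pos huv (Real.exp_pos (p k)).le (hs1 k))).ne'
  set Ω : Mat n := Complex.I • rdiag s * α + (Real.exp v : ℂ) • rdiag (cosq p) with hΩ
  set T : Mat n := rdiag (fun k => (lam u v s k)⁻¹) * Ω with hTdef
  have hα : Ω = rdiag (lam u v s) * T := by
    rw [hTdef, ← Matrix.mul_assoc, rdiag_mul_inv hl0, Matrix.one_mul]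
  -- The lower block row of K has Gram matrix e^{-2u}, which leaves ΩΩ† = Λ².
  have hT : T * Tᴴ = 1 := by
    have h1 := hKH
    rw [rotBlock, triR, fromBlocks_multiply, fromBlocks_multiply] at h1
    have h2 := bottom_row_triL hH h1
    simp only [Matrix.zero_mul, Matrix.one_mul, Matrix.mul_zero, zero_add, add_zero,
      Matrix.mul_smul, Matrix.mul_one, smul_zero] at h2
    rw [← hΩ] at h2
    have h3 : Ω * Ωᴴ = rdiag (fun k => lam u v s k * lam u v s k) := by
      rw [eq_sub_of_add_eq' h2]
      simp only [conjTranspose_smul, rdiag_conjTranspose, Matrix.smul_mul, Matrix.mul_smul,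
        rdiag_mul_rdiag, smul_smul]
      ext i j
      by_cases hij : i = j
      · subst hij
        have h4 := hlsq i
        have h5 : Real.exp (-2 * v) = Real.exp (-v) * Real.exp (-v) := by
          rw [← Real.exp_add]; congr 1; ring
        have h6 : (lam u v s i : ℂ) * lam u v s i = (Real.exp (-2 * u) : ℂ) -
            Real.exp (-v) * Real.exp (-v) * (s i) ^ 2 := by
          rw [pow_two, h5] at h4
          exact_mod_cast h4
        simp only [rdiag, Matrix.sub_apply, Matrix.smul_apply, Matrix.one_apply_eq,
          diagonal_apply_eq, smul_eq_mul, Complex.ofReal_mul, h6, Complex.star_def,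
          map_mul, Complex.conj_ofReal, Complex.conj_I]
        linear_combination ((Real.exp (-v) : ℂ) * Real.exp (-v) * s i * s i) * Complex.I_sq
      · simp [rdiag, hij]
    rw [hTdef, conjTranspose_mul, rdiag_conjTranspose]
    calc _ = rdiag (fun k => (lam u v s k)⁻¹) * (Ω * Ωᴴ) * rdiag (fun k => (lam u v s k)⁻¹) := by
          simp only [Matrix.mul_assoc]
      _ = 1 := by
          rw [h3, ← rdiag_mul_rdiag, ← Matrix.mul_assoc, rdiag_inv_mul hl0, Matrix.one_mul,
            rdiag_mul_inv hl0]
  have hT' : Tᴴ * T = 1 := mul_eq_one_comm.1 hT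
  have hTD := (exists_triL_iff hs0 hsc hlsq hT hρ hα).1 ⟨β, H, hH, hKH⟩
  rw [conj_nu hx s hρ] at hTD
  set r := ρᴴ *ᵥ uC n x with hr
  set w : Fin n → ℂ := fun k => s k * r k with hw
  set t := Real.exp (-x) with ht
  have ht0 : 0 < t := Real.exp_pos _
  set D : Fin n → ℝ := fun k => s k ^ 2 with hDdef
  have hDa : Antitone D := fun i j hij =>
    pow_le_pow_left₀ (Real.exp_pos _).le (Real.exp_le_exp.2 (hpa hij)) 2
  have htD : (t : ℂ) • rdiag D = rdiag fun k => t * D k := by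
    ext i j; by_cases hij : i = j <;> simp [rdiag, hij]
  have htDa : Antitone fun k => t * D k := fun i j hij => mul_le_mul_of_nonneg_left (hDa hij) ht0.le
  have hDe : ∀ k, D k = Real.exp (2 * p k) := fun k => sqExp_eq p k
  -- Interlacing is used twice: for T†DT = tD + c ww† and for the inverted equation T(tD)T† = D - c
  -- (Tw)(Tw)†. The two inequalities bound the gap below by -x/2 and by x/2, hence by |x|/2.
  have hp : p ∈ closedPolyhedron n x := by
    refine ⟨hp0 0, fun k l hkl => ?_⟩
    have h1 : t * D l ≤ D k := le_of_rank_one_perturbation htDa hDa hT' (by rw [hTD, htD]) hkl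
    have h2 : D l ≤ t * D k := by
      refine le_of_rank_one_perturbation (T := Tᴴ) (w := T *ᵥ w) (γ := -(rankCoeff n x : ℂ)) hDa htDa
        (by rw [conjTranspose_conjTranspose, hT]) ?_ hkl
      rw [← htD, eq_sub_of_add_eq hTD.symm, ← conj_vecMulVec, conjTranspose_conjTranspose,
        Matrix.mul_sub, Matrix.sub_mul, Matrix.mul_smul, Matrix.smul_mul, neg_smul, ← sub_eq_add_neg]
      congr 1
      calc _ = (T * Tᴴ) * rdiag D * (T * Tᴴ) := by simp only [Matrix.mul_assoc]
        _ = _ := by rw [hT, Matrix.one_mul, Matrix.mul_one]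
    rw [hDe, hDe, ht, ← Real.exp_add, Real.exp_le_exp] at h1 h2
    rcases abs_cases x with ⟨h3, -⟩ | ⟨h3, -⟩ <;> rw [h3] <;> linarith
  have hsep := separated_of_mem hp
  have hDi : Function.Injective D := hsep.sqExp_injective hx
  have hn : n ≠ 0 := NeZero.ne n
  have hγ : (rankCoeff n x : ℂ) ≠ 0 := by exact_mod_cast rankCoeff_ne_zero hx hn
  have hθu := toC_unitary (theta_mul_transpose hx hsep)
  have hθu' := mul_eq_one_comm.1 hθu
  have hθD := theta_conj_complex hx hsep
  set θ := toC (theta (-x) p) with hθ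
  have hrn : ∀ k, Real.sqrt (Complex.normSq (r k)) = rvec x p k := by
    intro k
    have h1 := normSq_eq_of_rank_one hDi ht0.ne' hγ hT' hθu' hTD hθD k
    rw [hw, Complex.normSq_mul, Complex.normSq_mul] at h1
    have h2 := mul_left_cancel₀ (by simpa using hs0 k) h1
    rw [h2, rC, Complex.normSq_ofReal, Real.sqrt_mul_self (rvec_nonneg _ _ _)]
  choose δ hδ using fun k => exists_phase (r k)
  set Δ : Mat n := diagonal fun k => (δ k : ℂ) with hΔdef
  have hΔ : Δ * Δᴴ = 1 := circle_diagonal_unitary δ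
  have hΔ' : Δᴴ * Δ = 1 := mul_eq_one_comm.1 hΔ
  have hΔd : ∀ f : Fin n → ℝ, rdiag f * Δ = Δ * rdiag f := by
    intro f
    rw [rdiag, hΔdef, diagonal_mul_diagonal, diagonal_mul_diagonal]
    congr 1; ext k; ring
  have hΔd' : ∀ f : Fin n → ℝ, Δᴴ * rdiag f = rdiag f * Δᴴ := by
    intro f
    have := congrArg conjTranspose (hΔd f)
    rwa [conjTranspose_mul, conjTranspose_mul, rdiag_conjTranspose] at this
  have hrΔ : r = Δ *ᵥ rC x p := by
    ext k
    rw [hΔdef, mulVec_diagonal, rC, ← hrn, ← hδ]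
  have hΔw : Δᴴ *ᵥ w = fun k => (s k : ℂ) * rC x p k := by
    have h1 : w = rdiag s *ᵥ r := by ext k; rw [rdiag, mulVec_diagonal]
    rw [h1, hrΔ, mulVec_mulVec, mulVec_mulVec, Matrix.mul_assoc, hΔd, ← Matrix.mul_assoc, hΔ',
      Matrix.one_mul]
    ext k
    rw [rdiag, mulVec_diagonal]
  -- Conjugation by Δ, which commutes with D, replaces ρ†y by its vector of moduli r, so that T₂ and
  -- θ solve the same equation.
  set T₂ : Mat n := Δᴴ * T * Δ with hT₂
  have hT₂u : T₂ * T₂ᴴ = 1 := mul_unitary (mul_unitary (conjTranspose_unitary hΔ) hT) hΔ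
  have hT₂D : T₂ᴴ * rdiag D * T₂ = θᴴ * rdiag D * θ := by
    rw [hθD]
    calc _ = Δᴴ * (Tᴴ * (Δ * rdiag D * Δᴴ) * T) * Δ := by
          rw [hT₂, conjTranspose_mul, conjTranspose_mul, conjTranspose_conjTranspose]
          simp only [Matrix.mul_assoc]
      _ = Δᴴ * (Tᴴ * rdiag D * T) * Δ := by
          rw [← hΔd, Matrix.mul_assoc (rdiag D), hΔ, Matrix.mul_one]
      _ = _ := by
          rw [hTD, Matrix.mul_add, Matrix.add_mul, Matrix.mul_smul, Matrix.mul_smul,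
            Matrix.smul_mul, Matrix.smul_mul, hΔd', Matrix.mul_assoc (rdiag D), hΔ', Matrix.mul_one]
          have := conj_vecMulVec Δᴴ w
          rw [conjTranspose_conjTranspose, hΔw] at this
          rw [this]
  -- T₂θ† commutes with D, which has simple spectrum; this is the torus element of the section.
  obtain ⟨τ, hτ⟩ := exists_circle_diagonal hDi (mul_unitary hT₂u (conjTranspose_unitary hθu)) (by
    calc _ = θ * (T₂ᴴ * rdiag D * T₂) * θᴴ := by
          rw [conjTranspose_mul, conjTranspose_conjTranspose]; simp only [Matrix.mul_assoc]
      _ = (θ * θᴴ) * rdiag D * (θ * θᴴ) := by rw [hT₂D]; simp only [Matrix.mul_assoc]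
      _ = _ := by rw [hθu, Matrix.one_mul, Matrix.mul_one])
  have hT₂τ : T₂ = Tmat x p τ := by
    rw [Tmat_eq, ← hτ, Matrix.mul_assoc, hθu', Matrix.mul_one]
  have hα₂ : Δᴴ * α * Δ = alpha u v x p τ := by
    have h1 := alpha_spec (u := u) (v := v) (x := x) hp0 τ
    rw [← hT₂τ] at h1
    have h2 : Complex.I • rdiag s * (Δᴴ * α * Δ) + (Real.exp v : ℂ) • rdiag (cosq p) =
        rdiag (lam u v s) * T₂ := by
      calc _ = Δᴴ * Ω * Δ := by
            rw [hΩ, Matrix.mul_add, Matrix.add_mul, Matrix.mul_smul Δᴴ (Real.exp v : ℂ), Matrix.smul_mul, hΔd',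
              Matrix.smul_mul _ (rdiag (cosq p) * Δᴴ), Matrix.mul_assoc _ Δᴴ Δ, hΔ', Matrix.mul_one]
            congr 1
            simp only [Matrix.smul_mul, Matrix.mul_smul]
            rw [← Matrix.mul_assoc Δᴴ (rdiag s), hΔd']
            simp only [Matrix.mul_assoc]
        _ = _ := by
            rw [hα, hT₂, ← Matrix.mul_assoc Δᴴ (rdiag _), hΔd']
            simp only [Matrix.mul_assoc]
    have h3 := add_right_cancel (h2.trans h1.symm)
    have h4 := congrArg (fun M => rdiag (fun k => (s k)⁻¹) * (-Complex.I • M)) h3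
    rw [← hs] at h4
    simpa [Matrix.smul_mul, Matrix.mul_smul, smul_smul, ← Matrix.mul_assoc, rdiag_inv_mul hs0]
      using h4
  have hrho := rho_unitary hx hsep
  -- η carries ρΔ to the section's ρ(x, p). Both ρΔ and ρ(x, p) send r to y, so η fixes y and
  -- therefore preserves νν†.
  set η : Mat n := rho x p * Δᴴ * ρᴴ with hη
  have hηu : η * ηᴴ = 1 :=
    mul_unitary (mul_unitary hrho (conjTranspose_unitary hΔ)) (conjTranspose_unitary hρ)
  have hηρ : η * ρ * Δ = rho x p := by
    rw [hη, Matrix.mul_assoc _ ρᴴ, mul_eq_one_comm.1 hρ, Matrix.mul_one, Matrix.mul_assoc, hΔ',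
      Matrix.mul_one]
  have hηuC : η *ᵥ uC n x = uC n x := by
    rw [hη, ← mulVec_mulVec, ← hr, hrΔ, mulVec_mulVec, Matrix.mul_assoc, hΔ', Matrix.mul_one,
      ← rho_conjTranspose_mulVec hx hsep, mulVec_mulVec, hrho, one_mulVec]
  refine ⟨p, hp, τ, η, Δᴴ * b, Δᴴ * c, Δᴴ * d, hηu, mul_unitary (conjTranspose_unitary hΔ) hb,
    mul_unitary (conjTranspose_unitary hΔ) hc, mul_unitary (conjTranspose_unitary hΔ) hd, ?_, ?_⟩
  · rw [nu_mul_conjTranspose_eq hx, Matrix.mul_add, Matrix.add_mul, Matrix.mul_smul,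
      Matrix.mul_smul, Matrix.smul_mul, Matrix.smul_mul, conj_vecMulVec, hηuC, Matrix.mul_one, hηu]
  · have h1 : fromBlocks η 0 0 (Δᴴ * b) = fromBlocks η 0 0 Δᴴ * fromBlocks 1 0 0 b := by
      rw [fromBlocks_multiply]; simp
    have h2 : fromBlocks (Δᴴ * c) 0 0 (Δᴴ * d) = fromBlocks Δᴴ 0 0 Δᴴ * fromBlocks c 0 0 d := by
      rw [fromBlocks_multiply]; simp
    have h3 : fromBlocks η 0 0 Δᴴ * fromBlocks ρ 0 0 1 =
        fromBlocks (rho x p) 0 0 1 * fromBlocks Δᴴ 0 0 Δᴴ := by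
      rw [fromBlocks_multiply, fromBlocks_multiply, ← hηρ, Matrix.mul_assoc (η * ρ), hΔ]
      simp
    have h4 : fromBlocks Δᴴ 0 0 Δᴴ * rotBlock s (cosq p) =
        rotBlock s (cosq p) * fromBlocks Δᴴ 0 0 Δᴴ := by
      rw [rotBlock, fromBlocks_multiply, fromBlocks_multiply]
      simp [hΔd']
    have h5 := fromBlocks_mul_triR v Δᴴ Δᴴ α (by rw [conjTranspose_conjTranspose, hΔ])
    rw [conjTranspose_conjTranspose, hα₂] at h5
    rw [h1, h2, Matrix.mul_assoc, hbK, Kmat_eq hp0, ← hs]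
    calc _ = (fromBlocks η 0 0 Δᴴ * fromBlocks ρ 0 0 1) * rotBlock s (cosq p) * triR v α *
          fromBlocks c 0 0 d := by simp only [Matrix.mul_assoc]
      _ = fromBlocks (rho x p) 0 0 1 * (fromBlocks Δᴴ 0 0 Δᴴ * rotBlock s (cosq p)) * triR v α *
          fromBlocks c 0 0 d := by rw [h3]; simp only [Matrix.mul_assoc]
      _ = fromBlocks (rho x p) 0 0 1 * rotBlock s (cosq p) * (fromBlocks Δᴴ 0 0 Δᴴ * triR v α) *
          fromBlocks c 0 0 d := by rw [h4]; simp only [Matrix.mul_assoc]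
      _ = _ := by rw [h5]; simp only [Matrix.mul_assoc]

end RSReduction

end

theorem proposition3p3 (n : ℕ) [NeZero n] (hn : 2 ≤ n) (u v x : ℝ)
    (huv : u < v) (hvu : v ≠ -u) (hx : x ≠ 0) :
    (∀ p ∈ RSReduction.closedPolyhedron n x, ∀ τ : Fin n → Circle,
      RSReduction.Tmat x p τ ∈ Matrix.unitaryGroup (Fin n) ℂ ∧
      RSReduction.rho x p ∈ Matrix.specialUnitaryGroup (Fin n) ℂ ∧
      ∃ h : (RSReduction.Kmat u v x p τ).det = 1,
        (⟨RSReduction.Kmat u v x p τ, h⟩ : RSReduction.SL2n n) ∈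
          RSReduction.constraintSurface n u v x) ∧
    (∀ K ∈ RSReduction.constraintSurface n u v x,
      (RSReduction.gaugeOrbit n x K ∩ RSReduction.sectionSet n u v x).Nonempty) := by
  refine ⟨fun p hp τ => ?_, fun K hK => ?_⟩
  · have hs := RSReduction.separated_of_mem hp
    exact ⟨Matrix.mem_unitaryGroup_iff.2 (RSReduction.Tmat_unitary hx hs τ),
      Matrix.mem_specialUnitaryGroup_iff.2 ⟨Matrix.mem_unitaryGroup_iff.2
        (RSReduction.rho_unitary hx hs), RSReduction.det_rho hx hs⟩,
      RSReduction.Kmat_mem_constraintSurface huv hx hp τ⟩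
  · obtain ⟨p, hp, τ, η, b, c, d, hη, hb, hc, hd, hN, h⟩ :=
      RSReduction.exists_section_point huv hvu hx hK
    obtain ⟨hdet, -⟩ := RSReduction.Kmat_mem_constraintSurface huv hx hp τ
    exact ⟨⟨_, hdet⟩, RSReduction.mem_gaugeOrbit hη hb hc hd hN h, p, hp, τ, rfl⟩
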